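/- Let $\Bbbk\in\{\mathbb R,\mathbb C\}$. All bornological $\Bbbk$-vector spaces (algebras, modules) are complete, i.e. every bounded set is contained in a bounded disc $D$ (circled convex set) whose gauge is a norm on the span of $D$ for which this span is a Banach space. Let $B$ be a unital bornological $\Bbbk$-algebra (bounded multiplication) that is multiplicatively convex: each bounded set is absorbed by a bounded disc closed under multiplication. $\mathrm{Mod}(B)$ is the category of unital bornological right $B$-modules (bounded action) with bounded $B$-linear maps; $\mathcal L_B(M,N)$ is the space of these maps with the equibounded bornology, and $\otimes_B$ is the complete $B$-balanced tensor product (the complete bornological space that is universal for bounded $B$-balanced bilinear maps). A $B$-module is finitely generated projective if it is a direct summand, by bounded $B$-linear maps, of some $B^n$, $n\in\mathbb N$. All complexes of $B$-modules are cochain complexes which are zero outside a finite range of degrees, and chain maps and homotopies in $\mathrm{Mod}(B)$ are bounded and $B$-linear. For complexes $M,N$ let $\mathcal L_B^\bullet(M,N)$ be the complex of graded maps, with $d(h)=d_N h-(-1)^{i}h\,d_M$ for $h$ of degree $i$, and let $$\nu:\ M^\bullet\otimes_B\mathcal L_B^\bullet(M,B)\longrightarrow\mathcal L_B^\bullet(M,M),\qquad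 \nu(x\otimes\varphi)(m)=x\,\varphi(m),$$ be the natural bounded chain map from the total complex. A graded map $M\to M$ is nuclear if it is in the image of $\nu$, and algebraically nuclear if it is the image under $\nu$ of a finite sum of elementary tensors $x\otimes\varphi$. Two graded maps $f,g$ of degree $0$ are homotopic if $f-g=d(h)$ for some $h\in\mathcal L_B^{-1}(M,M)$. Then for every complex $M^\bullet$ in $\mathrm{Mod}(B)$ the following are equivalent. 1. $M^\bullet$ is homotopy equivalent to a complex of finitely generated projective $B$-modules. 2. $\nu: M^\bullet\otimes_B\mathcal L_B^\bullet(M,B)\to\mathcal L_B^\bullet(M,M)$ is a homotopy equivalence of complexes of bornological vector spaces (with bounded $\Bbbk$-linear inverse and homotopies). 3. $\mathrm{id}_M$ is homotopic to a nuclear map. 4. $\mathrm{id}_M$ is homotopic to an algebraically nuclear map. 5. There are a complex $T$ (zero outside a finite range of degrees) of finitely generated projective $B$-modules and chain maps $M\xrightarrow{f}T\xrightarrow{g}M$ such that $gf$ is homotopic to $\mathrm{id}_M$. -/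

import Mathlib

open CategoryTheory Bornology Set
open scoped Pointwise

universe u

namespace Born

set_option linter.unusedSectionVars false

/-! ### Bornological vector spaces -/

/-- A map is bounded if it sends bounded sets to bounded sets. -/
def IsBddMap {V W : Type*} [Bornology V] [Bornology W] (f : V → W) : Prop :=
  ∀ S : Set V, IsBounded S → IsBounded (f '' S)

/-- A bornological vector space: the bornology is closed under sums and homotheties. -/
class BornVec (𝕜 V : Type*) [RCLike 𝕜] [AddCommGroup V] [Module 𝕜 V] [Bornology V] : Prop where
  isBounded_add : ∀ {S T : Set V}, IsBounded S → IsBounded T → IsBounded (S + T)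
  isBounded_smul : ∀ (c : 𝕜) {S : Set V}, IsBounded S → IsBounded (c • S)

section Basic

variable (𝕜 : Type*) {V : Type*} [RCLike 𝕜] [AddCommGroup V] [Module 𝕜 V]

/-- A disc: a (nonempty) circled and convex set. -/
structure IsDisc (D : Set V) : Prop where
  nonempty : D.Nonempty
  circled : ∀ (c : 𝕜), ‖c‖ ≤ 1 → ∀ x ∈ D, c • x ∈ D
  convex : ∀ x ∈ D, ∀ y ∈ D, ∀ t : ℝ, 0 ≤ t → t ≤ 1 → (t : 𝕜) • x + ((1 - t : ℝ) : 𝕜) • y ∈ D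

/-- The sequence `u` converges to `x` for the gauge of `D`. -/
def TendstoGauge (D : Set V) (u : ℕ → V) (x : V) : Prop :=
  ∀ ε : ℝ, 0 < ε → ∃ N, ∀ n, N ≤ n → u n - x ∈ (ε : 𝕜) • D

/-- The sequence `u` is Cauchy for the gauge of `D`. -/
def CauchyGauge (D : Set V) (u : ℕ → V) : Prop :=
  ∀ ε : ℝ, 0 < ε → ∃ N, ∀ m n, N ≤ m → N ≤ n → u m - u n ∈ (ε : 𝕜) • D

/-- A completant disc: the gauge of `D` is a norm on the linear span `V_D` of `D`, and `V_D` is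
complete for this norm. (A sequence which is Cauchy for the gauge eventually stays in one coset of
`V_D`, and a sequence in `V_D` can only converge to a point of `V_D`, so that the last field is
the completeness of `V_D`.) -/
structure IsCompletant (D : Set V) : Prop extends IsDisc 𝕜 D where
  norming : ∀ x : V, (∀ ε : ℝ, 0 < ε → x ∈ (ε : 𝕜) • D) → x = 0
  complete : ∀ u : ℕ → V, CauchyGauge 𝕜 D u → ∃ x, TendstoGauge 𝕜 D u x

/-- Convergence of a sequence in a bornological vector space. -/
def TendstoBorn [Bornology V] (u : ℕ → V) (x : V) : Prop :=
  ∃ S : Set V, IsBounded S ∧ TendstoGauge 𝕜 S u x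

/-- Closed sets of a bornological vector space. -/
def IsBornClosed [Bornology V] (C : Set V) : Prop :=
  ∀ (u : ℕ → V) (x : V), (∀ n, u n ∈ C) → TendstoBorn 𝕜 u x → x ∈ C

/-- The smallest closed linear subspace that contains `A`. -/
def closedSpan [Bornology V] (A : Set V) : Submodule 𝕜 V :=
  sInf {W : Submodule 𝕜 V | A ⊆ W ∧ IsBornClosed 𝕜 (W : Set V)}

end Basic

/-- A complete bornological vector space: every bounded set is contained in a bounded completant
disc. -/
class CompleteBorn (𝕜 V : Type*) [RCLike 𝕜] [AddCommGroup V] [Module 𝕜 V] [Bornology V] : Prop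
    extends BornVec 𝕜 V where
  exists_completant : ∀ S : Set V, IsBounded S → ∃ D, S ⊆ D ∧ IsBounded D ∧ IsCompletant 𝕜 D

/-! #### Elementary facts on discs -/

section Discs

variable {𝕜 : Type*} {V : Type*} [RCLike 𝕜] [AddCommGroup V] [Module 𝕜 V] {D : Set V}

lemma IsDisc.zero_mem (h : IsDisc 𝕜 D) : (0 : V) ∈ D := by
  obtain ⟨x, hx⟩ := h.nonempty
  simpa using h.circled 0 (by simp) x hx

lemma IsDisc.mono (h : IsDisc 𝕜 D) {a : 𝕜} {b : ℝ} (hab : ‖a‖ ≤ b) {x : V} (hx : x ∈ D) :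
    a • x ∈ (b : 𝕜) • D := by
  rcases eq_or_ne b 0 with rfl | hb
  · have : a = 0 := norm_le_zero_iff.1 hab
    subst this
    exact ⟨0, h.zero_mem, by simp⟩
  · have hb' : (b : 𝕜) ≠ 0 := by exact_mod_cast hb
    have hb0 : 0 < b := lt_of_le_of_ne ((norm_nonneg a).trans hab) hb.symm
    refine ⟨((b : 𝕜)⁻¹ * a) • x, h.circled _ ?_ x hx, ?_⟩
    · rw [norm_mul, norm_inv, RCLike.norm_ofReal, abs_of_pos hb0, inv_mul_le_iff₀ hb0]
      simpa using hab
    · simp only [smul_smul]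
      rw [mul_inv_cancel_left₀ hb']

lemma IsDisc.smul_mono (h : IsDisc 𝕜 D) {a b : ℝ} (ha : 0 ≤ a) (hab : a ≤ b) {x : V}
    (hx : x ∈ (a : 𝕜) • D) : x ∈ (b : 𝕜) • D := by
  obtain ⟨d, hd, rfl⟩ := hx
  exact h.mono (by rwa [RCLike.norm_ofReal, abs_of_nonneg ha]) hd

lemma IsDisc.smul_mem (h : IsDisc 𝕜 D) (c : 𝕜) {a : ℝ} (ha : 0 ≤ a) {x : V}
    (hx : x ∈ (a : 𝕜) • D) : c • x ∈ ((‖c‖ * a : ℝ) : 𝕜) • D := by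
  obtain ⟨d, hd, rfl⟩ := hx
  simp only [smul_smul]
  exact h.mono (by rw [norm_mul, RCLike.norm_ofReal, abs_of_nonneg ha]) hd

lemma IsDisc.add_mem (h : IsDisc 𝕜 D) {a b : ℝ} (ha : 0 ≤ a) (hb : 0 ≤ b) {x y : V}
    (hx : x ∈ (a : 𝕜) • D) (hy : y ∈ (b : 𝕜) • D) : x + y ∈ ((a + b : ℝ) : 𝕜) • D := by
  obtain ⟨d, hd, rfl⟩ := hx
  obtain ⟨e, he, rfl⟩ := hy
  rcases eq_or_lt_of_le (add_nonneg ha hb) with h0 | h0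
  · have ha0 : a = 0 := by linarith
    have hb0 : b = 0 := by linarith
    subst ha0 hb0
    exact ⟨0, h.zero_mem, by simp⟩
  · refine ⟨_, h.convex d hd e he (a / (a + b)) (by positivity)
      (div_le_one_of_le₀ (by linarith) h0.le), ?_⟩
    have h0' : (a + b : ℝ) ≠ 0 := h0.ne'
    simp only [smul_add, smul_smul, ← RCLike.ofReal_mul]
    congr 3
    · field_simp
    · field_simp; ring

lemma IsDisc.neg_mem (h : IsDisc 𝕜 D) {a : ℝ} (ha : 0 ≤ a) {x : V}
    (hx : x ∈ (a : 𝕜) • D) : -x ∈ (a : 𝕜) • D := by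
  simpa using h.smul_mem (-1) ha hx

lemma IsDisc.sub_mem (h : IsDisc 𝕜 D) {a b : ℝ} (ha : 0 ≤ a) (hb : 0 ≤ b) {x y : V}
    (hx : x ∈ (a : 𝕜) • D) (hy : y ∈ (b : 𝕜) • D) : x - y ∈ ((a + b : ℝ) : 𝕜) • D := by
  rw [sub_eq_add_neg]
  exact h.add_mem ha hb hx (h.neg_mem hb hy)

lemma IsDisc.sum_mem (h : IsDisc 𝕜 D) {ι : Type*} (s : Finset ι) (a : ι → 𝕜) (x : ι → V)
    (hx : ∀ i ∈ s, a i ≠ 0 → x i ∈ D) : ∑ i ∈ s, a i • x i ∈ ((∑ i ∈ s, ‖a i‖ : ℝ) : 𝕜) • D := by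
  classical
  induction s using Finset.induction_on with
  | empty => exact ⟨0, h.zero_mem, by simp⟩
  | insert i s hi ih =>
    rw [Finset.sum_insert hi, Finset.sum_insert hi]
    refine h.add_mem (norm_nonneg _) (Finset.sum_nonneg fun _ _ => norm_nonneg _) ?_
      (ih fun j hj => hx j (Finset.mem_insert_of_mem hj))
    by_cases ha : a i = 0
    · rw [ha]; exact ⟨0, h.zero_mem, by simp⟩
    · exact h.mono le_rfl (hx i (Finset.mem_insert_self _ _) ha)

lemma gauge_mono {S T : Set V} (hST : S ⊆ T) {u : ℕ → V} {x : V} (h : TendstoGauge 𝕜 S u x) :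
    TendstoGauge 𝕜 T u x := fun ε hε => by
  obtain ⟨N, hN⟩ := h ε hε
  exact ⟨N, fun n hn => Set.smul_set_mono hST (hN n hn)⟩

lemma TendstoGauge.unique (h : IsCompletant 𝕜 D) {u : ℕ → V} {x y : V}
    (hx : TendstoGauge 𝕜 D u x) (hy : TendstoGauge 𝕜 D u y) : x = y := by
  rw [← sub_eq_zero]
  refine h.norming _ fun ε hε => ?_
  obtain ⟨N, hN⟩ := hx (ε / 2) (half_pos hε)
  obtain ⟨M, hM⟩ := hy (ε / 2) (half_pos hε)
  have h1 := h.sub_mem (half_pos hε).le (half_pos hε).le (hM (max N M) (le_max_right _ _))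
    (hN (max N M) (le_max_left _ _))
  rwa [add_halves, sub_sub_sub_cancel_left] at h1

lemma TendstoBorn.unique [Bornology V] [CompleteBorn 𝕜 V] {u : ℕ → V} {x y : V}
    (hx : TendstoBorn 𝕜 u x) (hy : TendstoBorn 𝕜 u y) : x = y := by
  obtain ⟨S, hS, hx⟩ := hx
  obtain ⟨T, hT, hy⟩ := hy
  obtain ⟨D, hD, _, hc⟩ := CompleteBorn.exists_completant (𝕜 := 𝕜) _ (hS.union hT)
  exact TendstoGauge.unique hc (gauge_mono (subset_union_left.trans hD) hx)
    (gauge_mono (subset_union_right.trans hD) hy)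

/-- A criterion for completeness of the span of a disc. -/
lemma complete_of_series (h : IsDisc 𝕜 D)
    (hs : ∀ x : ℕ → V, (∀ n, x n ∈ D) →
      ∃ y, TendstoGauge 𝕜 D (fun n => ∑ i ∈ Finset.range n, ((2⁻¹ ^ i : ℝ) : 𝕜) • x i) y)
    (u : ℕ → V) (hu : CauchyGauge 𝕜 D u) : ∃ x, TendstoGauge 𝕜 D u x := by
  have hp : ∀ k : ℕ, (0 : ℝ) < 2⁻¹ ^ k := fun k => by positivity
  choose N hN using fun k : ℕ => hu (2⁻¹ ^ k) (hp k)
  let M : ℕ → ℕ := fun k => ∑ i ∈ Finset.range (k + 1), N i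
  have hNM : ∀ k, N k ≤ M k := fun k =>
    Finset.single_le_sum (f := N) (fun _ _ => Nat.zero_le _) (Finset.self_mem_range_succ k)
  have hMM : ∀ k, M k ≤ M (k + 1) := fun k => by
    simp only [M]; rw [Finset.sum_range_succ _ (k + 1)]; exact Nat.le_add_right _ _
  have hd : ∀ k, ∃ d ∈ D, ((2⁻¹ ^ k : ℝ) : 𝕜) • d = u (M (k + 1)) - u (M k) := fun k =>
    hN k _ _ ((hNM k).trans (hMM k)) (hNM k)
  choose d hdD hd using hd
  obtain ⟨y, hy⟩ := hs d hdD
  have hsum : ∀ n, ∑ i ∈ Finset.range n, ((2⁻¹ ^ i : ℝ) : 𝕜) • d i = u (M n) - u (M 0) := by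
    intro n
    rw [← Finset.sum_range_sub (fun k => u (M k))]
    exact Finset.sum_congr rfl fun i _ => hd i
  refine ⟨y + u (M 0), fun ε hε => ?_⟩
  obtain ⟨K, hK⟩ := hy (ε / 2) (half_pos hε)
  obtain ⟨J, hJ⟩ := exists_pow_lt_of_lt_one (half_pos hε) (by norm_num : (2⁻¹ : ℝ) < 1)
  let k := max K J
  refine ⟨N k, fun n hn => ?_⟩
  have h1 := hK k (le_max_left _ _)
  simp only [hsum] at h1
  have h2 := hN k n (M k) hn (hNM k)
  have h3 : (2⁻¹ : ℝ) ^ k ≤ ε / 2 :=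
    (pow_le_pow_of_le_one (by norm_num) (by norm_num) (le_max_right K J)).trans hJ.le
  have h4 := h.add_mem (half_pos hε).le (half_pos hε).le h1 (h.smul_mono (hp k).le h3 h2)
  rw [add_halves] at h4
  convert h4 using 1
  abel

/-- The partial sums of a geometrically weighted series in a completant disc converge. -/
lemma IsCompletant.series (h : IsCompletant 𝕜 D) (x : ℕ → V) (hx : ∀ n, x n ∈ D) :
    ∃ y, TendstoGauge 𝕜 D (fun n => ∑ i ∈ Finset.range n, ((2⁻¹ ^ i : ℝ) : 𝕜) • x i) y := by
  refine h.complete _ fun ε hε => ?_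
  have hsum : CauchySeq fun n => ∑ i ∈ Finset.range n, ‖(((2⁻¹ : ℝ) ^ i : ℝ) : 𝕜)‖ := by
    refine (Summable.hasSum (f := fun i : ℕ => ‖(((2⁻¹ : ℝ) ^ i : ℝ) : 𝕜)‖) ?_).tendsto_sum_nat.cauchySeq
    simp only [RCLike.norm_ofReal, abs_pow]
    exact summable_geometric_of_lt_one (by positivity) (by rw [abs_of_pos] <;> norm_num)
  obtain ⟨N, hN⟩ := Metric.cauchySeq_iff.1 hsum ε hε
  have key : ∀ m n, N ≤ m → m ≤ n → ∑ i ∈ Finset.range n, ((2⁻¹ ^ i : ℝ) : 𝕜) • x i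
      - ∑ i ∈ Finset.range m, ((2⁻¹ ^ i : ℝ) : 𝕜) • x i ∈ (ε : 𝕜) • D := by
    intro m n hm hmn
    have h1 := hN n (hm.trans hmn) m hm
    rw [← Finset.sum_Ico_eq_sub _ hmn]
    rw [Real.dist_eq, ← Finset.sum_Ico_eq_sub _ hmn] at h1
    exact h.smul_mono (Finset.sum_nonneg fun _ _ => norm_nonneg _) (le_of_abs_le h1.le)
      (h.sum_mem _ _ _ fun i _ _ => hx i)
  refine ⟨N, fun m n hm hn => ?_⟩
  rcases le_total m n with hmn | hmn
  · rw [← neg_sub]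
    exact h.neg_mem hε.le (key m n hm hmn)
  · exact key n m hn hmn

end Discs

/-! ### Summable families in a complete bornological vector space -/

section Sums

variable {𝕜 : Type*} {V : Type*} [RCLike 𝕜] [AddCommGroup V] [Module 𝕜 V]

/-- The finite partial sums of the family `v` converge to `x`, for the gauge of `D`. -/
def HasGaugeSum (𝕜 : Type*) [RCLike 𝕜] [Module 𝕜 V] {ι : Type*} (D : Set V) (v : ι → V) (x : V) :
    Prop :=
  ∀ ε : ℝ, 0 < ε → ∃ s : Finset ι, ∀ t, s ⊆ t → x - ∑ i ∈ t, v i ∈ (ε : 𝕜) • D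

/-- The finite partial sums of the family `v` converge to `x`. -/
def HasBornSum (𝕜 : Type*) [RCLike 𝕜] [Module 𝕜 V] [Bornology V] {ι : Type*} (v : ι → V) (x : V) :
    Prop :=
  ∃ D : Set V, IsBounded D ∧ IsDisc 𝕜 D ∧ HasGaugeSum 𝕜 D v x

variable {ι : Type*} {D : Set V}

lemma exists_hasGaugeSum (h : IsCompletant 𝕜 D) (f : ι → 𝕜) (hf : Summable fun i => ‖f i‖)
    (g : ι → V) (hg : ∀ i, f i ≠ 0 → g i ∈ D) :
    ∃ x, HasGaugeSum 𝕜 D (fun i => f i • g i) x := by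
  classical
  have hp : ∀ k : ℕ, (0 : ℝ) < 2⁻¹ ^ k := fun k => by positivity
  have hsmall : ∀ ε : ℝ, 0 < ε → ∃ s : Finset ι, ∀ t, Disjoint t s → ∑ i ∈ t, ‖f i‖ < ε := by
    intro ε hε
    obtain ⟨s, hs⟩ := summable_iff_vanishing_norm.1 hf ε hε
    exact ⟨s, fun t ht => lt_of_abs_lt (hs t ht)⟩
  choose s hs using fun k : ℕ => hsmall (2⁻¹ ^ k) (hp k)
  let u : ℕ → V := fun k => ∑ i ∈ s k, f i • g i
  have hdiff : ∀ (t t' : Finset ι) (a b : ℝ), 0 ≤ a → 0 ≤ b → ∑ i ∈ t \ t', ‖f i‖ ≤ a →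
      ∑ i ∈ t' \ t, ‖f i‖ ≤ b →
      ∑ i ∈ t, f i • g i - ∑ i ∈ t', f i • g i ∈ ((a + b : ℝ) : 𝕜) • D := by
    intro t t' a b ha hb hta htb
    rw [← Finset.sum_sdiff_sub_sum_sdiff]
    exact h.sub_mem ha hb
      (h.smul_mono (Finset.sum_nonneg fun _ _ => norm_nonneg _) hta (h.sum_mem _ _ _ fun i _ => hg i))
      (h.smul_mono (Finset.sum_nonneg fun _ _ => norm_nonneg _) htb (h.sum_mem _ _ _ fun i _ => hg i))
  have hu : CauchyGauge 𝕜 D u := by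
    intro ε hε
    obtain ⟨K, hK⟩ := exists_pow_lt_of_lt_one (half_pos hε) (by norm_num : (2⁻¹ : ℝ) < 1)
    have hle : ∀ m, K ≤ m → (2⁻¹ : ℝ) ^ m ≤ ε / 2 := fun m hm =>
      (pow_le_pow_of_le_one (by norm_num) (by norm_num) hm).trans hK.le
    refine ⟨K, fun m n hm hn => ?_⟩
    have := hdiff (s m) (s n) (ε / 2) (ε / 2) (half_pos hε).le (half_pos hε).le
      (((hs n _ Finset.sdiff_disjoint).le).trans (hle n hn))
      (((hs m _ Finset.sdiff_disjoint).le).trans (hle m hm))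
    rwa [add_halves] at this
  obtain ⟨x, hx⟩ := h.complete u hu
  refine ⟨x, fun ε hε => ?_⟩
  obtain ⟨N, hN⟩ := hx (ε / 2) (half_pos hε)
  obtain ⟨K, hK⟩ := exists_pow_lt_of_lt_one (by positivity : (0 : ℝ) < ε / 4)
    (by norm_num : (2⁻¹ : ℝ) < 1)
  have hle : ∀ m, K ≤ m → (2⁻¹ : ℝ) ^ m ≤ ε / 4 := fun m hm =>
    (pow_le_pow_of_le_one (by norm_num) (by norm_num) hm).trans hK.le
  refine ⟨s K, fun t ht => ?_⟩
  let n := max N K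
  have h1 := h.neg_mem (half_pos hε).le (hN n (le_max_left _ _))
  rw [neg_sub] at h1
  have h2 := hdiff (s n) t (ε / 4) (ε / 4) (by positivity) (by positivity)
      (((hs K _ (Finset.sdiff_disjoint.mono_right ht)).le).trans (hle K le_rfl))
      (((hs n _ Finset.sdiff_disjoint).le).trans (hle n (le_max_right _ _)))
  have h3 := h.add_mem (half_pos hε).le (by positivity) h1 h2
  have e1 : ε / 2 + (ε / 4 + ε / 4) = ε := by ring
  have e2 : x - u n + (∑ i ∈ s n, f i • g i - ∑ i ∈ t, f i • g i) = x - ∑ i ∈ t, f i • g i :=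
    sub_add_sub_cancel _ _ _
  rwa [e1, e2] at h3

lemma HasGaugeSum.mem (h : IsDisc 𝕜 D) {f : ι → 𝕜} {g : ι → V} {x : V}
    (hg : ∀ i, f i ≠ 0 → g i ∈ D) (hx : HasGaugeSum 𝕜 D (fun i => f i • g i) x) {C : ℝ}
    (hf : Summable fun i => ‖f i‖) (hC : ∑' i, ‖f i‖ ≤ C) : x ∈ ((C + 1 : ℝ) : 𝕜) • D := by
  obtain ⟨s, hs⟩ := hx 1 one_pos
  have h1 := hs s subset_rfl
  have h2 := h.sum_mem s f g fun i _ => hg i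
  have h0 : 0 ≤ ∑ i ∈ s, ‖f i‖ := Finset.sum_nonneg fun _ _ => norm_nonneg _
  have hle : ∑ i ∈ s, ‖f i‖ ≤ C := (hf.sum_le_tsum s fun _ _ => norm_nonneg _).trans hC
  have h3 := h.add_mem (h0.trans hle) zero_le_one (h.smul_mono h0 hle h2) h1
  simpa using h3

lemma HasBornSum.unique [Bornology V] [CompleteBorn 𝕜 V] {v : ι → V} {x y : V}
    (hx : HasBornSum 𝕜 v x) (hy : HasBornSum 𝕜 v y) : x = y := by
  classical
  obtain ⟨S, hS, -, hx⟩ := hx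
  obtain ⟨T, hT, -, hy⟩ := hy
  obtain ⟨D, hD, _, h⟩ := CompleteBorn.exists_completant (𝕜 := 𝕜) _ (hS.union hT)
  rw [← sub_eq_zero]
  refine h.norming _ fun ε hε => ?_
  obtain ⟨s, hs⟩ := hx (ε / 2) (half_pos hε)
  obtain ⟨t, ht⟩ := hy (ε / 2) (half_pos hε)
  have h1 := h.sub_mem (half_pos hε).le (half_pos hε).le
    (Set.smul_set_mono (subset_union_left.trans hD) (hs (s ∪ t) Finset.subset_union_left))
    (Set.smul_set_mono (subset_union_right.trans hD) (ht (s ∪ t) Finset.subset_union_right))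
  rwa [add_halves, sub_sub_sub_cancel_right] at h1

lemma HasBornSum.add [Bornology V] [CompleteBorn 𝕜 V] {v w : ι → V} {x y : V}
    (hx : HasBornSum 𝕜 v x) (hy : HasBornSum 𝕜 w y) : HasBornSum 𝕜 (fun i => v i + w i) (x + y) := by
  classical
  obtain ⟨S, hS, -, hx⟩ := hx
  obtain ⟨T, hT, -, hy⟩ := hy
  obtain ⟨D, hD, hb, h⟩ := CompleteBorn.exists_completant (𝕜 := 𝕜) _ (hS.union hT)
  refine ⟨D, hb, h.toIsDisc, fun ε hε => ?_⟩
  obtain ⟨s, hs⟩ := hx (ε / 2) (half_pos hε)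
  obtain ⟨t, ht⟩ := hy (ε / 2) (half_pos hε)
  refine ⟨s ∪ t, fun r hr => ?_⟩
  have h1 := h.add_mem (half_pos hε).le (half_pos hε).le
    (Set.smul_set_mono (subset_union_left.trans hD) (hs r (Finset.subset_union_left.trans hr)))
    (Set.smul_set_mono (subset_union_right.trans hD) (ht r (Finset.subset_union_right.trans hr)))
  rwa [add_halves, sub_add_sub_comm, ← Finset.sum_add_distrib] at h1

lemma HasBornSum.map {W : Type*} [AddCommGroup W] [Module 𝕜 W] [Bornology V] [Bornology W]
    {v : ι → V} {x : V} (hx : HasBornSum 𝕜 v x) (T : V →ₗ[𝕜] W) (hT : IsBddMap T) :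
    HasBornSum 𝕜 (fun i => T (v i)) (T x) := by
  obtain ⟨D, hb, h, hx⟩ := hx
  refine ⟨T '' D, hT _ hb, ⟨h.nonempty.image _, ?_, ?_⟩, fun ε hε => ?_⟩
  · rintro c hc _ ⟨x, hx, rfl⟩
    exact ⟨c • x, h.circled c hc x hx, by simp⟩
  · rintro _ ⟨x, hx, rfl⟩ _ ⟨y, hy, rfl⟩ t h0 h1
    exact ⟨_, h.convex x hx y hy t h0 h1, by simp⟩
  · obtain ⟨s, hs⟩ := hx ε hε
    refine ⟨s, fun t ht => ?_⟩
    obtain ⟨d, hd, he⟩ := hs t ht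
    refine ⟨T d, ⟨d, hd, rfl⟩, ?_⟩
    have := congrArg T he
    simpa using this

lemma HasBornSum.finite [Bornology V] [CompleteBorn 𝕜 V] (v : ι → V) (s : Finset ι)
    (hs : ∀ i, i ∉ s → v i = 0) : HasBornSum 𝕜 v (∑ i ∈ s, v i) := by
  obtain ⟨D, hD, hb, h⟩ := CompleteBorn.exists_completant (𝕜 := 𝕜) (∅ : Set V) isBounded_empty
  refine ⟨D, hb, h.toIsDisc, fun ε hε => ⟨s, fun t ht => ?_⟩⟩
  rw [Finset.sum_subset ht fun i _ hi => hs i hi, sub_self]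
  exact ⟨0, h.zero_mem, smul_zero _⟩

end Sums

lemma BornVec.smul_map (𝕜 : Type*) {V : Type*} [RCLike 𝕜] [AddCommGroup V] [Module 𝕜 V]
    [Bornology V] [BornVec 𝕜 V] (c : 𝕜) : IsBddMap fun x : V => c • x :=
  fun _ hS => BornVec.isBounded_smul c hS

/-! ### The free complete bornological vector space on a bornological set -/

section L1

variable (𝕜 : Type*) [RCLike 𝕜] (P : Type*) [Bornology P]

/-- The space `ℓ¹(P)` of absolutely summable functions on `P` with bounded support: the union of
the Banach spaces `ℓ¹(S)` over the bounded subsets `S` of `P`. -/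
def L1 : Submodule 𝕜 (P → 𝕜) where
  carrier := {f | IsBounded (Function.support f) ∧ Summable fun p => ‖f p‖}
  zero_mem' := by
    refine ⟨?_, ?_⟩
    · simp
    · simp
  add_mem' := by
    rintro f g ⟨hf, hf'⟩ ⟨hg, hg'⟩
    refine ⟨(hf.union hg).subset (Function.support_add f g), ?_⟩
    exact Summable.of_nonneg_of_le (fun _ => norm_nonneg _) (fun p => norm_add_le (f p) (g p))
      (hf'.add hg')
  smul_mem' := by
    rintro c f ⟨hf, hf'⟩
    refine ⟨hf.subset (Function.support_const_smul_subset c f), ?_⟩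
    simpa only [Pi.smul_apply, norm_smul] using hf'.mul_left ‖c‖

/-- The ball of radius `C` of `ℓ¹(S)`. -/
def L1.ball (S : Set P) (C : ℝ) : Set (L1 𝕜 P) :=
  {f | Function.support f.1 ⊆ S ∧ ∑' p, ‖f.1 p‖ ≤ C}

/-- A set is bounded in `ℓ¹(P)` if it is contained in a ball of `ℓ¹(S)`, with `S` bounded. -/
instance L1.instBornology : Bornology (L1 𝕜 P) :=
  Bornology.ofBounded {A | ∃ S : Set P, IsBounded S ∧ ∃ C : ℝ, A ⊆ L1.ball 𝕜 P S C}
    ⟨∅, isBounded_empty, 0, empty_subset _⟩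
    (fun _ ⟨S, hS, C, h⟩ _ hs => ⟨S, hS, C, hs.trans h⟩)
    (fun _ ⟨S, hS, C, h⟩ _ ⟨S', hS', C', h'⟩ => ⟨S ∪ S', hS.union hS', max C C',
      union_subset
        (fun f hf => ⟨(h hf).1.trans subset_union_left, (h hf).2.trans (le_max_left _ _)⟩)
        (fun f hf => ⟨(h' hf).1.trans subset_union_right, (h' hf).2.trans (le_max_right _ _)⟩)⟩)
    (fun f => ⟨_, f.2.1, _, by rintro _ rfl; exact ⟨subset_rfl, le_rfl⟩⟩)

variable {𝕜 P}

lemma L1.isBounded_iff {A : Set (L1 𝕜 P)} :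
    IsBounded A ↔ ∃ S : Set P, IsBounded S ∧ ∃ C : ℝ, A ⊆ L1.ball 𝕜 P S C :=
  Bornology.isBounded_ofBounded_iff _

open Classical in
/-- The basis vector of `ℓ¹(P)` at the point `p`. -/
noncomputable def L1.single (p : P) : L1 𝕜 P :=
  ⟨Pi.single p 1, (isBounded_singleton (x := p)).subset (Pi.support_single_subset),
    summable_of_ne_finset_zero (s := {p}) (fun q hq => by
      simp only [Finset.mem_singleton] at hq; simp [Pi.single_eq_of_ne hq])⟩

lemma L1.isDisc_ball (S : Set P) {C : ℝ} (hC : 0 ≤ C) : IsDisc 𝕜 (L1.ball 𝕜 P S C) where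
  nonempty := ⟨0, by simp [L1.ball, hC]⟩
  circled := by
    rintro c hc f ⟨hf, hf'⟩
    refine ⟨(Function.support_const_smul_subset c f.1).trans hf, ?_⟩
    simp only [SetLike.val_smul, Pi.smul_apply, norm_smul, tsum_mul_left]
    exact (mul_le_of_le_one_left (tsum_nonneg fun _ => norm_nonneg _) hc).trans hf'
  convex := by
    rintro f ⟨hf, hf'⟩ g ⟨hg, hg'⟩ t h0 h1
    have ht : ‖(t : 𝕜)‖ = t := by rw [RCLike.norm_ofReal, abs_of_nonneg h0]
    have ht' : ‖((1 - t : ℝ) : 𝕜)‖ = 1 - t := by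
      rw [RCLike.norm_ofReal, abs_of_nonneg (sub_nonneg.2 h1)]
    refine ⟨?_, ?_⟩
    · intro p hp
      by_contra hpS
      have h1 : f.1 p = 0 := by_contra fun h => hpS (hf h)
      have h2 : g.1 p = 0 := by_contra fun h => hpS (hg h)
      simp [h1, h2] at hp
    · calc ∑' p, ‖((t : 𝕜) • f + ((1 - t : ℝ) : 𝕜) • g).1 p‖
          ≤ ∑' p, (t * ‖f.1 p‖ + (1 - t) * ‖g.1 p‖) := by
            refine Summable.tsum_le_tsum (fun p => ?_)
              ((t : 𝕜) • f + ((1 - t : ℝ) : 𝕜) • g).2.2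
              ((f.2.2.mul_left _).add (g.2.2.mul_left _))
            refine (norm_add_le _ _).trans (le_of_eq ?_)
            simp only [SetLike.val_smul, Pi.smul_apply, norm_smul, ht, ht']
        _ = t * ∑' p, ‖f.1 p‖ + (1 - t) * ∑' p, ‖g.1 p‖ := by
            rw [Summable.tsum_add (f.2.2.mul_left _) (g.2.2.mul_left _), tsum_mul_left,
              tsum_mul_left]
        _ ≤ t * C + (1 - t) * C := add_le_add (mul_le_mul_of_nonneg_left hf' h0)
            (mul_le_mul_of_nonneg_left hg' (sub_nonneg.2 h1))
        _ = C := by ring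

lemma L1.mem_smul_ball {S : Set P} {C ε : ℝ} (hε : 0 < ε) {f : L1 𝕜 P} :
    f ∈ (ε : 𝕜) • L1.ball 𝕜 P S C ↔ f ∈ L1.ball 𝕜 P S (ε * C) := by
  have hε' : (ε : 𝕜) ≠ 0 := by exact_mod_cast hε.ne'
  rw [Set.mem_smul_set_iff_inv_smul_mem₀ hε']
  simp only [L1.ball, Set.mem_ofPred_eq, SetLike.val_smul, Pi.smul_apply, norm_smul, tsum_mul_left,
    norm_inv, RCLike.norm_ofReal, abs_of_pos hε]
  rw [inv_mul_le_iff₀ hε]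
  refine and_congr_left fun _ => ?_
  rw [Function.support_const_smul_of_ne_zero _ _ (inv_ne_zero hε')]

lemma weighted_series_l1 {𝕜 : Type*} [RCLike 𝕜] {P : Type*}
    (w : ℕ → ℝ) (hpow : ∀ i, 0 ≤ w i) (hg : Summable w) (f : ℕ → P → 𝕜)
    (hf : ∀ i, Summable fun p => ‖f i p‖) (hf1 : ∀ i, ∑' p, ‖f i p‖ ≤ 1) :
    ∃ y : P → 𝕜, (Summable fun p => ‖y p‖) ∧ (∀ p, (∀ i, f i p = 0) → y p = 0) ∧
      ∀ n, ∑' p, ‖∑ i ∈ Finset.range n, (w i : 𝕜) * f i p - y p‖ ≤ ∑' i, w (i + n) := by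
  have hm : ∀ i, Summable fun p => w i * ‖f i p‖ := fun i => (hf i).mul_left (w i)
  have hF : Summable fun x : ℕ × P => w x.1 * ‖f x.1 x.2‖ := by
    have hx : ∀ x : ℕ × P, 0 ≤ w x.1 * ‖f x.1 x.2‖ := fun x =>
      mul_nonneg (hpow x.1) (norm_nonneg (f x.1 x.2))
    rw [summable_prod_of_nonneg hx]
    refine ⟨hm, ?_⟩
    have h0 : ∀ i, 0 ≤ ∑' p, w i * ‖f i p‖ := fun i => by
      rw [tsum_mul_left]
      exact mul_nonneg (hpow i) (tsum_nonneg fun p => norm_nonneg (f i p))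
    have h1 : ∀ i, ∑' p, w i * ‖f i p‖ ≤ w i := fun i => by
      rw [tsum_mul_left]
      exact mul_le_of_le_one_right (hpow i) (hf1 i)
    exact Summable.of_nonneg_of_le h0 h1 hg
  have hnorm : ∀ (i : ℕ) (p : P), ‖(w i : 𝕜) * f i p‖ = w i * ‖f i p‖ :=
    fun i p => by rw [norm_mul, RCLike.norm_ofReal, abs_of_nonneg (hpow i)]
  have hFp : ∀ p, Summable fun i : ℕ => w i * ‖f i p‖ := fun p =>
    hF.comp_injective (i := fun i : ℕ => (i, p)) (Prod.mk_left_injective p)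
  have hFp' : ∀ p, Summable fun i : ℕ => (w i : 𝕜) * f i p := fun p =>
    Summable.of_norm (by simpa only [hnorm] using hFp p)
  have hFn : ∀ n, Summable fun x : ℕ × P => w (x.1 + n) * ‖f (x.1 + n) x.2‖ := fun n =>
    hF.comp_injective (i := fun x : ℕ × P => (x.1 + n, x.2)) (by
      rintro ⟨a, b⟩ ⟨c, d⟩ h; simpa using h)
  have hFnp : ∀ n p, Summable fun i : ℕ => w (i + n) * ‖f (i + n) p‖ := fun n p =>
    (hFn n).comp_injective (i := fun i : ℕ => (i, p)) (Prod.mk_left_injective p)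
  have hle : ∀ n p, ‖∑' i : ℕ, (w (i + n) : 𝕜) * f (i + n) p‖
      ≤ ∑' i : ℕ, w (i + n) * ‖f (i + n) p‖ := fun n p => by
    have := norm_tsum_le_tsum_norm (f := fun i : ℕ => (w (i + n) : 𝕜) * f (i + n) p)
      (by simpa only [hnorm] using hFnp n p)
    simpa only [hnorm] using this
  have hsw : ∀ n, Summable fun p => ∑' i : ℕ, w (i + n) * ‖f (i + n) p‖ := fun n =>
    (hFn n).prod_symm.prod
  have hy : ∀ n, Summable fun p => ‖∑' i : ℕ, (w (i + n) : 𝕜) * f (i + n) p‖ := fun n =>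
    Summable.of_nonneg_of_le (fun _ => norm_nonneg _) (hle n) (hsw n)
  refine ⟨fun p => ∑' i : ℕ, (w i : 𝕜) * f i p, by simpa using hy 0,
    fun p hp => by simp [hp], fun n => ?_⟩
  have hval : ∀ p, ‖∑ i ∈ Finset.range n, (w i : 𝕜) * f i p
      - ∑' i : ℕ, (w i : 𝕜) * f i p‖
        = ‖∑' i : ℕ, (w (i + n) : 𝕜) * f (i + n) p‖ := by
    intro p
    rw [← (hFp' p).sum_add_tsum_nat_add n, ← norm_neg]
    congr 1
    ring
  simp only [hval]
  calc ∑' p, ‖∑' i : ℕ, (w (i + n) : 𝕜) * f (i + n) p‖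
      ≤ ∑' p, ∑' i : ℕ, w (i + n) * ‖f (i + n) p‖ :=
        Summable.tsum_le_tsum (hle n) (hy n) (hsw n)
    _ = ∑' i : ℕ, ∑' p, w (i + n) * ‖f (i + n) p‖ :=
        (hFn n).tsum_comm' (fun i => hm (i + n)) (hFnp n)
    _ ≤ ∑' i : ℕ, w (i + n) := by
        refine Summable.tsum_le_tsum (fun i => ?_) (hFn n).prod
          (hg.comp_injective (add_left_injective n))
        rw [tsum_mul_left]
        exact mul_le_of_le_one_right (hpow _) (hf1 (i + n))

lemma L1.completant_ball (S : Set P) (hS : IsBounded S) : IsCompletant 𝕜 (L1.ball 𝕜 P S 1) where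
  toIsDisc := L1.isDisc_ball S zero_le_one
  norming := by
    intro f hf
    have h0 : ∑' p, ‖f.1 p‖ ≤ 0 := le_of_forall_pos_le_add fun ε hε => by
      simpa using ((L1.mem_smul_ball hε).1 (hf ε hε)).2
    ext p
    exact norm_le_zero_iff.1 ((f.2.2.le_tsum p fun _ _ => norm_nonneg _).trans h0)
  complete := by
    refine complete_of_series (L1.isDisc_ball S zero_le_one) fun f hf => ?_
    obtain ⟨y, hy, hy0, hyn⟩ := weighted_series_l1 (fun i : ℕ => (2⁻¹ : ℝ) ^ i)
      (fun i => by positivity) (summable_geometric_of_lt_one (by norm_num) (by norm_num))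
      (fun i => (f i).1) (fun i => (f i).2.2) fun i => (hf i).2
    have hf0 : ∀ p, p ∉ S → ∀ i, (f i).1 p = 0 := fun p hp i =>
      by_contra fun h => hp ((hf i).1 h)
    have hsupp : Function.support y ⊆ S := fun p hp => by
      by_contra hpS
      exact hp (hy0 p (hf0 p hpS))
    refine ⟨⟨y, hS.subset hsupp, hy⟩, fun ε hε => ?_⟩
    obtain ⟨N, hN⟩ := exists_pow_lt_of_lt_one (half_pos hε) (by norm_num : (2⁻¹ : ℝ) < 1)
    refine ⟨N, fun n hn => ?_⟩
    have hval : ∀ p, (∑ i ∈ Finset.range n, ((2⁻¹ ^ i : ℝ) : 𝕜) • f i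
        - (⟨y, hS.subset hsupp, hy⟩ : L1 𝕜 P)).1 p
        = ∑ i ∈ Finset.range n, ((2⁻¹ ^ i : ℝ) : 𝕜) * (f i).1 p - y p := fun p => by
      simp
    rw [L1.mem_smul_ball hε]
    refine ⟨fun p hp => ?_, ?_⟩
    · by_contra hpS
      refine hp ?_
      rw [hval, hy0 p (hf0 p hpS)]
      simp [hf0 p hpS]
    · simp only [hval]
      have h1 : (2⁻¹ : ℝ) ^ n ≤ ε / 2 :=
        (pow_le_pow_of_le_one (by norm_num) (by norm_num) hn).trans hN.le
      have h2 : ∑' i : ℕ, (2⁻¹ : ℝ) ^ (i + n) = 2 * 2⁻¹ ^ n := by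
        simp only [pow_add]
        rw [tsum_mul_right, tsum_geometric_of_lt_one (by norm_num) (by norm_num)]
        norm_num
      have h3 := hyn n
      rw [h2] at h3
      linarith

instance : CompleteBorn 𝕜 (L1 𝕜 P) where
  isBounded_add := by
    intro A A' hA hA'
    obtain ⟨S, hS, C, h⟩ := L1.isBounded_iff.1 hA
    obtain ⟨S', hS', C', h'⟩ := L1.isBounded_iff.1 hA'
    refine L1.isBounded_iff.2 ⟨S ∪ S', hS.union hS', C + C', ?_⟩
    rintro _ ⟨f, hf, g, hg, rfl⟩
    refine ⟨(Function.support_add f.1 g.1).trans (union_subset_union (h hf).1 (h' hg).1), ?_⟩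
    refine (Summable.tsum_le_tsum (fun p => norm_add_le (f.1 p) (g.1 p)) (f + g).2.2
      (f.2.2.add g.2.2)).trans ?_
    rw [Summable.tsum_add f.2.2 g.2.2]
    exact add_le_add (h hf).2 (h' hg).2
  isBounded_smul := by
    intro c A hA
    obtain ⟨S, hS, C, h⟩ := L1.isBounded_iff.1 hA
    refine L1.isBounded_iff.2 ⟨S, hS, ‖c‖ * C, ?_⟩
    rintro _ ⟨f, hf, rfl⟩
    refine ⟨(Function.support_const_smul_subset c f.1).trans (h hf).1, ?_⟩
    simp only [SetLike.val_smul, Pi.smul_apply, norm_smul, tsum_mul_left]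
    exact mul_le_mul_of_nonneg_left (h hf).2 (norm_nonneg _)
  exists_completant := by
    intro A hA
    obtain ⟨S, hS, C, h⟩ := L1.isBounded_iff.1 hA
    have hC : (0 : ℝ) < max C 1 := lt_max_of_lt_right one_pos
    refine ⟨L1.ball 𝕜 P S (max C 1), fun f hf => ⟨(h hf).1, (h hf).2.trans (le_max_left _ _)⟩,
      L1.isBounded_iff.2 ⟨S, hS, _, subset_rfl⟩, ?_⟩
    have heq : ∀ ε : ℝ, 0 < ε → (ε : 𝕜) • L1.ball 𝕜 P S (max C 1)
        = ((ε * max C 1 : ℝ) : 𝕜) • L1.ball 𝕜 P S 1 := fun ε hε => by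
      ext f
      rw [L1.mem_smul_ball hε, L1.mem_smul_ball (mul_pos hε hC), mul_one]
    have hb := L1.completant_ball (𝕜 := 𝕜) S hS
    refine ⟨L1.isDisc_ball S hC.le, fun f hf => hb.norming f fun ε hε => ?_, fun u hu => ?_⟩
    · have := hf (ε / max C 1) (div_pos hε hC)
      rwa [heq _ (div_pos hε hC), div_mul_cancel₀ _ hC.ne'] at this
    · obtain ⟨x, hx⟩ := hb.complete u fun ε hε => by
        have := hu (ε / max C 1) (div_pos hε hC)
        rwa [heq _ (div_pos hε hC), div_mul_cancel₀ _ hC.ne'] at this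
      refine ⟨x, fun ε hε => ?_⟩
      rw [heq _ hε]
      exact hx _ (mul_pos hε hC)

/-- Every element of `ℓ¹(P)` is the sum of its coordinates. -/
lemma L1.hasBornSum (f : L1 𝕜 P) : HasBornSum 𝕜 (fun p => f.1 p • L1.single (𝕜 := 𝕜) p) f := by
  classical
  have hs1 : ∀ p : P, L1.single (𝕜 := 𝕜) p ∈ L1.ball 𝕜 P {p} 1 := fun p => by
    refine ⟨Pi.support_single_subset, ?_⟩
    rw [tsum_eq_single p]
    · simp [L1.single]
    · intro q hq; simp [L1.single, Pi.single_eq_of_ne hq]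
  refine ⟨L1.ball 𝕜 P (Function.support f.1) 1, L1.isBounded_iff.2 ⟨_, f.2.1, _, subset_rfl⟩,
    L1.isDisc_ball _ zero_le_one, fun ε hε => ?_⟩
  obtain ⟨s, hs⟩ := summable_iff_vanishing_norm.1 f.2.2 (ε / 2) (half_pos hε)
  refine ⟨s, fun t ht => ?_⟩
  rw [L1.mem_smul_ball hε]
  have hval : ∀ q, (f - ∑ p ∈ t, f.1 p • L1.single (𝕜 := 𝕜) p).1 q = if q ∈ t then 0 else f.1 q := by
    intro q
    have : (f - ∑ p ∈ t, f.1 p • L1.single (𝕜 := 𝕜) p).1 q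
        = f.1 q - ∑ p ∈ t, f.1 p * (Pi.single p (1 : 𝕜) : P → 𝕜) q := by
      simp [L1.single]
    rw [this]
    simp only [Pi.single_apply, mul_ite, mul_one, mul_zero, Finset.sum_ite_eq]
    split_ifs <;> simp
  refine ⟨fun q hq => ?_, ?_⟩
  · rw [Function.mem_support, hval] at hq
    split_ifs at hq with h
    · exact absurd rfl hq
    · exact hq
  · refine (Subtype.property (_ : L1 𝕜 P)).2.tsum_le_of_sum_le fun r => ?_
    have h1 := hs (r.filter (· ∉ t)) (Finset.disjoint_left.2 fun q hq hq' =>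
      (Finset.mem_filter.1 hq).2 (ht hq'))
    have h2 := (le_of_lt (lt_of_abs_lt h1))
    rw [Finset.sum_filter] at h2
    refine le_trans (le_of_eq (Finset.sum_congr rfl fun q _ => ?_)) (h2.trans (by linarith))
    rw [hval]
    split_ifs <;> simp_all

variable {X : Type*} [AddCommGroup X] [Module 𝕜 X] [Bornology X] [CompleteBorn 𝕜 X]

lemma L1.exists_sum {g : P → X} (hg : IsBddMap g) (f : L1 𝕜 P) :
    ∃ x, HasBornSum 𝕜 (fun p => f.1 p • g p) x := by
  obtain ⟨D, hD, hb, h⟩ := CompleteBorn.exists_completant (𝕜 := 𝕜) _ (hg _ f.2.1)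
  obtain ⟨x, hx⟩ := exists_hasGaugeSum h f.1 f.2.2 g fun p hp => hD ⟨p, hp, rfl⟩
  exact ⟨x, D, hb, h.toIsDisc, hx⟩

/-- The bounded linear map `∑ f(p) p ↦ ∑ f(p) g(p)` given by a bounded map `g` on `P` with values
in a complete space. -/
noncomputable def L1.lift (g : P → X) (hg : IsBddMap g) : L1 𝕜 P →ₗ[𝕜] X where
  toFun f := (L1.exists_sum hg f).choose
  map_add' f f' := by
    refine HasBornSum.unique (L1.exists_sum hg (f + f')).choose_spec ?_
    have := (L1.exists_sum hg f).choose_spec.add (L1.exists_sum hg f').choose_spec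
    refine (congrArg (fun v => HasBornSum 𝕜 v _) ?_).mp this
    funext p
    exact (add_smul (f.1 p) (f'.1 p) (g p)).symm
  map_smul' c f := by
    refine HasBornSum.unique (L1.exists_sum hg (c • f)).choose_spec ?_
    have := (L1.exists_sum hg f).choose_spec.map (LinearMap.lsmul 𝕜 X c)
      (BornVec.smul_map 𝕜 c)
    refine (congrArg (fun v => HasBornSum 𝕜 v _) ?_).mp this
    funext p
    exact smul_smul c (f.1 p) (g p)

lemma L1.lift_spec (g : P → X) (hg : IsBddMap g) (f : L1 𝕜 P) :
    HasBornSum 𝕜 (fun p => f.1 p • g p) (L1.lift g hg f) := (L1.exists_sum hg f).choose_spec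

lemma L1.lift_single (g : P → X) (hg : IsBddMap g) (p : P) :
    L1.lift (𝕜 := 𝕜) g hg (L1.single p) = g p := by
  classical
  refine HasBornSum.unique (L1.lift_spec (𝕜 := 𝕜) g hg (L1.single p)) ?_
  have := HasBornSum.finite (𝕜 := 𝕜) (fun q => (L1.single (𝕜 := 𝕜) p).1 q • g q) {p} fun q hq => by
    simp only [Finset.mem_singleton] at hq
    simp [L1.single, Pi.single_eq_of_ne hq]
  simpa [L1.single] using this

lemma L1.isBddMap_lift (g : P → X) (hg : IsBddMap g) : IsBddMap (L1.lift (𝕜 := 𝕜) g hg) := by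
  intro A hA
  obtain ⟨S, hS, C, h⟩ := L1.isBounded_iff.1 hA
  obtain ⟨D, hD, hb, hc⟩ := CompleteBorn.exists_completant (𝕜 := 𝕜) _ (hg _ hS)
  refine (BornVec.isBounded_smul ((C + 1 : ℝ) : 𝕜) hb).subset ?_
  rintro _ ⟨f, hf, rfl⟩
  have hfg : ∀ p, f.1 p ≠ 0 → g p ∈ D := fun p hp => hD ⟨p, (h hf).1 hp, rfl⟩
  obtain ⟨x, hx⟩ := exists_hasGaugeSum hc f.1 f.2.2 g hfg
  rw [HasBornSum.unique (L1.lift_spec g hg f) ⟨D, hb, hc.toIsDisc, hx⟩]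
  exact hx.mem hc.toIsDisc hfg f.2.2 (h hf).2

/-- A bounded linear map on `ℓ¹(P)` is determined by its values on the points of `P`. -/
lemma L1.hom_ext {F G : L1 𝕜 P →ₗ[𝕜] X} (hF : IsBddMap F) (hG : IsBddMap G)
    (h : ∀ p, F (L1.single p) = G (L1.single p)) : F = G := by
  ext1 f
  refine HasBornSum.unique ((L1.hasBornSum f).map F hF) ?_
  simpa [h] using (L1.hasBornSum f).map G hG

end L1

/-! ### Closed subspaces and quotients -/

section Quotient

variable {𝕜 : Type*} {V : Type*} [RCLike 𝕜] [AddCommGroup V] [Module 𝕜 V] [Bornology V]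

lemma subset_closedSpan (A : Set V) : A ⊆ closedSpan 𝕜 A := fun x hx => by
  simp only [closedSpan, SetLike.mem_coe, Submodule.mem_sInf]
  exact fun W hW => hW.1 hx

lemma closedSpan_le {A : Set V} {W : Submodule 𝕜 V} (hA : A ⊆ W)
    (hW : IsBornClosed 𝕜 (W : Set V)) : closedSpan 𝕜 A ≤ W := sInf_le ⟨hA, hW⟩

lemma isBornClosed_closedSpan (A : Set V) : IsBornClosed 𝕜 (closedSpan 𝕜 A : Set V) := by
  intro u x hu hx
  simp only [closedSpan, SetLike.mem_coe, Submodule.mem_sInf] at hu ⊢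
  exact fun W hW => hW.2 u x (fun n => hu n W hW) hx

lemma isBornClosed_ker {W : Type*} [AddCommGroup W] [Module 𝕜 W] [Bornology W] [CompleteBorn 𝕜 W]
    (T : V →ₗ[𝕜] W) (hT : IsBddMap T) : IsBornClosed 𝕜 (LinearMap.ker T : Set V) := by
  rintro u x hu ⟨S, hS, h⟩
  simp only [SetLike.mem_coe, LinearMap.mem_ker] at hu ⊢
  refine TendstoBorn.unique (𝕜 := 𝕜) (u := fun _ => (0 : W))
    ⟨T '' S, hT S hS, fun ε hε => ?_⟩ ⟨{0}, isBounded_singleton, fun ε hε => ⟨0, fun n _ => by simp⟩⟩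
  obtain ⟨N, hN⟩ := h ε hε
  refine ⟨N, fun n hn => ?_⟩
  obtain ⟨d, hd, he⟩ := hN n hn
  refine ⟨T d, ⟨d, hd, rfl⟩, ?_⟩
  have := congrArg T he
  simpa [hu] using this

/-- The quotient of a complete bornological vector space by a closed subspace is complete. -/
lemma completeBorn_quotient [CompleteBorn 𝕜 V] (W : Submodule 𝕜 V)
    (hW : IsBornClosed 𝕜 (W : Set V)) (Q : Bornology (V ⧸ W))
    (hQ : ∀ A : Set (V ⧸ W), IsBounded A ↔ ∃ A' : Set V, IsBounded A' ∧ A ⊆ W.mkQ '' A') :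
    CompleteBorn 𝕜 (V ⧸ W) where
  isBounded_add := by
    intro S T hS hT
    obtain ⟨S', hS', hS⟩ := (hQ S).1 hS
    obtain ⟨T', hT', hT⟩ := (hQ T).1 hT
    refine (hQ _).2 ⟨S' + T', BornVec.isBounded_add (𝕜 := 𝕜) hS' hT', ?_⟩
    rw [Set.image_add]
    exact Set.add_subset_add hS hT
  isBounded_smul := by
    intro c S hS
    obtain ⟨S', hS', hS⟩ := (hQ S).1 hS
    refine (hQ _).2 ⟨c • S', BornVec.isBounded_smul c hS', ?_⟩
    rw [Set.image_smul_comm _ _ _ (fun x => W.mkQ.map_smul c x)]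
    exact Set.smul_set_mono hS
  exists_completant := by
    intro S hS
    obtain ⟨S', hS', hS⟩ := (hQ S).1 hS
    obtain ⟨D, hD, hb, h⟩ := CompleteBorn.exists_completant (𝕜 := 𝕜) _ hS'
    have hsm : ∀ (ε : 𝕜) (A : Set V), ε • (W.mkQ '' A) = W.mkQ '' (ε • A) := fun ε A =>
      (Set.image_smul_comm _ _ _ (fun x => W.mkQ.map_smul ε x)).symm
    have hdisc : IsDisc 𝕜 (W.mkQ '' D) := by
      refine ⟨h.nonempty.image _, ?_, ?_⟩
      · rintro c hc _ ⟨x, hx, rfl⟩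
        exact ⟨c • x, h.circled c hc x hx, by simp⟩
      · rintro _ ⟨x, hx, rfl⟩ _ ⟨y, hy, rfl⟩ t h0 h1
        exact ⟨_, h.convex x hx y hy t h0 h1, by simp⟩
    refine ⟨W.mkQ '' D, hS.trans (Set.image_mono hD), (hQ _).2 ⟨D, hb, subset_rfl⟩, hdisc, ?_, ?_⟩
    · intro z hz
      obtain ⟨x, rfl⟩ := W.mkQ_surjective z
      have hz' : ∀ n : ℕ, ∃ w ∈ W, x - w ∈ ((1 / (n + 1) : ℝ) : 𝕜) • D := fun n => by
        have := hz (1 / (n + 1)) (by positivity)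
        rw [hsm] at this
        obtain ⟨y, hy, he⟩ := this
        refine ⟨x - y, ?_, by simpa using hy⟩
        rw [← Submodule.ker_mkQ W, LinearMap.mem_ker, map_sub, he, sub_self]
      choose w hw hw' using hz'
      have hx : x ∈ W := hW w x hw ⟨D, hb, fun ε hε => by
        obtain ⟨N, hN⟩ := exists_nat_one_div_lt hε
        refine ⟨N, fun n hn => ?_⟩
        rw [← neg_sub]
        refine h.neg_mem hε.le (h.smul_mono (by positivity) ?_ (hw' n))
        exact (Nat.one_div_le_one_div hn).trans hN.le⟩
      rwa [← LinearMap.mem_ker, Submodule.ker_mkQ]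
    · refine complete_of_series hdisc fun z hz => ?_
      choose x hx hxz using hz
      obtain ⟨y, hy⟩ := h.series x hx
      refine ⟨W.mkQ y, fun ε hε => ?_⟩
      obtain ⟨N, hN⟩ := hy ε hε
      refine ⟨N, fun n hn => ?_⟩
      rw [hsm]
      refine ⟨_, hN n hn, ?_⟩
      simp only [map_sub, map_sum, map_smul, hxz]

end Quotient

/-! ### The complete balanced tensor product -/

section Tensor

variable (𝕜 B M N : Type*) [RCLike 𝕜] [Ring B]
  [AddCommGroup M] [Module 𝕜 M] [Module Bᵐᵒᵖ M] [Bornology M]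
  [AddCommGroup N] [Module 𝕜 N] [Module B N] [Bornology N]

/-- The relations that define the `B`-balanced tensor product of a right `B`-module `M` (a module
over `Bᵐᵒᵖ`) and a left `B`-module `N`: additivity and homogeneity in each variable, and
`m b ⊗ n = m ⊗ b n`. -/
inductive BTensor.Rel : L1 𝕜 (M × N) → Prop
  | add_left (m m' : M) (n : N) :
      BTensor.Rel (L1.single (m + m', n) - L1.single (m, n) - L1.single (m', n))
  | add_right (m : M) (n n' : N) :
      BTensor.Rel (L1.single (m, n + n') - L1.single (m, n) - L1.single (m, n'))
  | smul_left (c : 𝕜) (m : M) (n : N) :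
      BTensor.Rel (L1.single (c • m, n) - c • L1.single (m, n))
  | smul_right (c : 𝕜) (m : M) (n : N) :
      BTensor.Rel (L1.single (m, c • n) - c • L1.single (m, n))
  | balanced (b : B) (m : M) (n : N) :
      BTensor.Rel (L1.single (MulOpposite.op b • m, n) - L1.single (m, b • n))

/-- The closed subspace of `ℓ¹(M × N)` generated by the relations. -/
def BTensor.relations : Submodule 𝕜 (L1 𝕜 (M × N)) :=
  closedSpan 𝕜 {x | BTensor.Rel 𝕜 B M N x}

/-- The complete `B`-balanced tensor product `M ⊗_B N` of bornological modules: the quotient of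
`ℓ¹(M × N)` by the closed subspace generated by the relations. It is the complete bornological
vector space that is universal for bounded `B`-balanced bilinear maps on `M × N` (see
`BTensor.lift`, `BTensor.lift_tmul`, `BTensor.hom_ext` below). -/
def BTensor : Type _ := L1 𝕜 (M × N) ⧸ BTensor.relations 𝕜 B M N

namespace BTensor

noncomputable instance : AddCommGroup (BTensor 𝕜 B M N) :=
  inferInstanceAs (AddCommGroup (L1 𝕜 (M × N) ⧸ BTensor.relations 𝕜 B M N))

noncomputable instance : Module 𝕜 (BTensor 𝕜 B M N) :=
  inferInstanceAs (Module 𝕜 (L1 𝕜 (M × N) ⧸ BTensor.relations 𝕜 B M N))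

/-- The quotient map. -/
noncomputable def mkQ : L1 𝕜 (M × N) →ₗ[𝕜] BTensor 𝕜 B M N := (BTensor.relations 𝕜 B M N).mkQ

lemma mkQ_surjective : Function.Surjective (mkQ 𝕜 B M N) :=
  (BTensor.relations 𝕜 B M N).mkQ_surjective

/-- The quotient bornology: the bounded sets are the images of the bounded sets. -/
instance : Bornology (BTensor 𝕜 B M N) :=
  Bornology.ofBounded {A | ∃ A' : Set (L1 𝕜 (M × N)), IsBounded A' ∧ A ⊆ mkQ 𝕜 B M N '' A'}
    ⟨∅, isBounded_empty, empty_subset _⟩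
    (fun _ ⟨A, hA, h⟩ _ hs => ⟨A, hA, hs.trans h⟩)
    (fun _ ⟨A, hA, h⟩ _ ⟨A', hA', h'⟩ => ⟨A ∪ A', hA.union hA', by
      rw [Set.image_union]; exact union_subset_union h h'⟩)
    (fun z => by
      obtain ⟨x, rfl⟩ := mkQ_surjective 𝕜 B M N z
      exact ⟨{x}, isBounded_singleton, by simp⟩)

lemma isBounded_iff {A : Set (BTensor 𝕜 B M N)} :
    IsBounded A ↔ ∃ A' : Set (L1 𝕜 (M × N)), IsBounded A' ∧ A ⊆ mkQ 𝕜 B M N '' A' :=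
  Bornology.isBounded_ofBounded_iff _

instance : CompleteBorn 𝕜 (BTensor 𝕜 B M N) :=
  completeBorn_quotient (BTensor.relations 𝕜 B M N) (isBornClosed_closedSpan _) _
    fun _ => isBounded_iff 𝕜 B M N

lemma isBddMap_mkQ : IsBddMap (mkQ 𝕜 B M N) := fun A hA =>
  (isBounded_iff 𝕜 B M N).2 ⟨A, hA, subset_rfl⟩

variable {M N}

/-- The elementary tensor `m ⊗ n`. -/
noncomputable def tmul (m : M) (n : N) : BTensor 𝕜 B M N := mkQ 𝕜 B M N (L1.single (m, n))

variable {𝕜 B}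

lemma mkQ_eq_zero_of_rel {x : L1 𝕜 (M × N)} (hx : Rel 𝕜 B M N x) : mkQ 𝕜 B M N x = 0 :=
  (Submodule.Quotient.mk_eq_zero _).2 (subset_closedSpan _ hx)

lemma isBddMap_single {P : Type*} [Bornology P] : IsBddMap (L1.single (𝕜 := 𝕜) (P := P)) := by
  classical
  intro S hS
  refine L1.isBounded_iff.2 ⟨S, hS, 1, ?_⟩
  rintro _ ⟨p, hp, rfl⟩
  refine ⟨Pi.support_single_subset.trans (by simpa using hp), ?_⟩
  rw [tsum_eq_single p]
  · simp [L1.single]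
  · intro q hq; simp [L1.single, Pi.single_eq_of_ne hq]

variable {X : Type*} [AddCommGroup X] [Module 𝕜 X] [Bornology X]

variable (𝕜 B) in
/-- Bounded `B`-balanced bilinear maps. -/
structure IsBalanced (β : M × N → X) : Prop where
  add_left : ∀ m m' n, β (m + m', n) = β (m, n) + β (m', n)
  add_right : ∀ m n n', β (m, n + n') = β (m, n) + β (m, n')
  smul_left : ∀ (c : 𝕜) m n, β (c • m, n) = c • β (m, n)
  smul_right : ∀ (c : 𝕜) m n, β (m, c • n) = c • β (m, n)
  balanced : ∀ (b : B) m n, β (MulOpposite.op b • m, n) = β (m, b • n)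
  bounded : IsBddMap β

lemma isBalanced_tmul : IsBalanced 𝕜 B fun p : M × N => tmul 𝕜 B p.1 p.2 where
  add_left m m' n := by
    have := mkQ_eq_zero_of_rel (Rel.add_left (𝕜 := 𝕜) (B := B) m m' n)
    rw [map_sub, map_sub, sub_sub, sub_eq_zero] at this
    exact this
  add_right m n n' := by
    have := mkQ_eq_zero_of_rel (Rel.add_right (𝕜 := 𝕜) (B := B) m n n')
    rw [map_sub, map_sub, sub_sub, sub_eq_zero] at this
    exact this
  smul_left c m n := by
    have := mkQ_eq_zero_of_rel (Rel.smul_left (𝕜 := 𝕜) (B := B) c m n)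
    rw [map_sub, map_smul, sub_eq_zero] at this
    exact this
  smul_right c m n := by
    have := mkQ_eq_zero_of_rel (Rel.smul_right (𝕜 := 𝕜) (B := B) c m n)
    rw [map_sub, map_smul, sub_eq_zero] at this
    exact this
  balanced b m n := by
    have := mkQ_eq_zero_of_rel (Rel.balanced (𝕜 := 𝕜) (B := B) b m n)
    rw [map_sub, sub_eq_zero] at this
    exact this
  bounded S hS := by
    have := isBddMap_mkQ 𝕜 B M N _ (isBddMap_single (𝕜 := 𝕜) S hS)
    rwa [Set.image_image] at this

variable [CompleteBorn 𝕜 X]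

/-- The bounded linear map on `M ⊗_B N` given by a bounded balanced bilinear map on `M × N` with
values in a complete space. -/
noncomputable def lift (β : M × N → X) (hβ : IsBalanced 𝕜 B β) : BTensor 𝕜 B M N →ₗ[𝕜] X :=
  (BTensor.relations 𝕜 B M N).liftQ (L1.lift β hβ.bounded) <| by
    refine closedSpan_le ?_ (isBornClosed_ker _ (L1.isBddMap_lift β hβ.bounded))
    rintro x hx
    rw [SetLike.mem_coe, LinearMap.mem_ker]
    cases hx with
    | add_left m m' n => simp [L1.lift_single, hβ.add_left]
    | add_right m n n' => simp [L1.lift_single, hβ.add_right]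
    | smul_left c m n => simp [L1.lift_single, hβ.smul_left]
    | smul_right c m n => simp [L1.lift_single, hβ.smul_right]
    | balanced b m n => simp [L1.lift_single, hβ.balanced]

lemma lift_mkQ (β : M × N → X) (hβ : IsBalanced 𝕜 B β) (x : L1 𝕜 (M × N)) :
    lift β hβ (mkQ 𝕜 B M N x) = L1.lift β hβ.bounded x := rfl

@[simp]
lemma lift_tmul (β : M × N → X) (hβ : IsBalanced 𝕜 B β) (m : M) (n : N) :
    lift β hβ (tmul 𝕜 B m n) = β (m, n) := by
  rw [tmul, lift_mkQ, L1.lift_single]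

lemma isBddMap_lift (β : M × N → X) (hβ : IsBalanced 𝕜 B β) : IsBddMap (lift β hβ) := by
  intro A hA
  obtain ⟨A', hA', h⟩ := (isBounded_iff 𝕜 B M N).1 hA
  refine (L1.isBddMap_lift (𝕜 := 𝕜) β hβ.bounded A' hA').subset ?_
  rintro _ ⟨z, hz, rfl⟩
  obtain ⟨x, hx, rfl⟩ := h hz
  exact ⟨x, hx, rfl⟩

/-- Bounded linear maps on `M ⊗_B N` with values in a complete space are determined by their
values on elementary tensors. -/
lemma hom_ext {F G : BTensor 𝕜 B M N →ₗ[𝕜] X} (hF : IsBddMap F) (hG : IsBddMap G)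
    (h : ∀ m n, F (tmul 𝕜 B m n) = G (tmul 𝕜 B m n)) : F = G := by
  have : F ∘ₗ mkQ 𝕜 B M N = G ∘ₗ mkQ 𝕜 B M N := by
    refine L1.hom_ext (fun A hA => ?_) (fun A hA => ?_) fun p => h p.1 p.2
    · have := hF _ (isBddMap_mkQ 𝕜 B M N A hA)
      rwa [Set.image_image] at this
    · have := hG _ (isBddMap_mkQ 𝕜 B M N A hA)
      rwa [Set.image_image] at this
  ext z
  obtain ⟨x, rfl⟩ := mkQ_surjective 𝕜 B M N z
  exact LinearMap.congr_fun this x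

end BTensor

end Tensor

/-! ### Bornological algebras and modules -/

/-- A unital (complete) bornological algebra: the multiplication `B × B → B` is bounded. -/
class BornAlg (𝕜 B : Type*) [RCLike 𝕜] [Ring B] [Algebra 𝕜 B] [Bornology B] : Prop
    extends CompleteBorn 𝕜 B where
  isBounded_mul : ∀ {S T : Set B}, IsBounded S → IsBounded T → IsBounded (S * T)

/-- A bornological algebra is multiplicatively convex if each bounded set is absorbed by a bounded
disc that is closed under multiplication. -/
def MulConvex (𝕜 B : Type*) [RCLike 𝕜] [Ring B] [Algebra 𝕜 B] [Bornology B] : Prop :=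
  ∀ S : Set B, IsBounded S → ∃ D : Set B, IsBounded D ∧ IsDisc 𝕜 D ∧ D * D ⊆ D ∧
    ∃ c : 𝕜, S ⊆ c • D

/-- A (complete) bornological right `B`-module, for a unital bornological algebra `B`: a unital
module over `Bᵐᵒᵖ` such that the action `M × B → M` is bounded. -/
class BornMod (𝕜 B M : Type*) [RCLike 𝕜] [Ring B] [Bornology B]
    [AddCommGroup M] [Module 𝕜 M] [Module Bᵐᵒᵖ M] [Bornology M] : Prop
    extends CompleteBorn 𝕜 M where
  isBounded_act : ∀ {S : Set M} {T : Set B}, IsBounded S → IsBounded T →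
    IsBounded (Set.image2 (fun m b => MulOpposite.op b • m) S T)

instance (𝕜 B : Type*) [RCLike 𝕜] [Ring B] [Algebra 𝕜 B] [Bornology B] [BornAlg 𝕜 B] :
    BornMod 𝕜 B B where
  isBounded_act {S T} hS hT := by
    simpa [Set.image2_mul] using BornAlg.isBounded_mul (𝕜 := 𝕜) hS hT

section Hom

variable (𝕜 B M N : Type*) [RCLike 𝕜] [Ring B] [Algebra 𝕜 B]
  [AddCommGroup M] [Module Bᵐᵒᵖ M] [Bornology M]
  [AddCommGroup N] [Module 𝕜 N] [Module Bᵐᵒᵖ N] [IsScalarTower 𝕜 Bᵐᵒᵖ N] [Bornology N]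
  [BornVec 𝕜 N]

/-- The space `ℒ_B(M, N)` of bounded `B`-linear maps between right `B`-modules. -/
def BHom : Submodule 𝕜 (M →ₗ[Bᵐᵒᵖ] N) where
  carrier := {f | IsBddMap f}
  zero_mem' S hS := by
    refine (isBounded_singleton (x := (0 : N))).subset ?_
    rintro _ ⟨x, _, rfl⟩
    simp
  add_mem' {f g} hf hg S hS := by
    refine (BornVec.isBounded_add (𝕜 := 𝕜) (hf S hS) (hg S hS)).subset ?_
    rintro _ ⟨x, hx, rfl⟩
    exact ⟨f x, ⟨x, hx, rfl⟩, g x, ⟨x, hx, rfl⟩, rfl⟩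
  smul_mem' c f hf S hS := by
    refine (BornVec.isBounded_smul c (hf S hS)).subset ?_
    rintro _ ⟨x, hx, rfl⟩
    exact ⟨f x, ⟨x, hx, rfl⟩, rfl⟩

/-- The equibounded bornology: a set `H` of maps is bounded if `H(U)` is bounded for every
bounded set `U`. -/
instance BHom.instBornology : Bornology (BHom 𝕜 B M N) :=
  Bornology.ofBounded
    {H | ∀ U : Set M, IsBounded U → IsBounded (Set.image2 (fun f x => f.1 x) H U)}
    (fun U _ => by simp)
    (fun _ h _ hs U hU => (h U hU).subset (Set.image2_subset_right hs))
    (fun _ h _ h' U hU => by rw [Set.image2_union_left]; exact (h U hU).union (h' U hU))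
    (fun f U hU => by rw [Set.image2_singleton_left]; exact f.2 U hU)

variable {𝕜 B M N}

lemma BHom.isBounded_iff {H : Set (BHom 𝕜 B M N)} : IsBounded H ↔
    ∀ U : Set M, IsBounded U → IsBounded (Set.image2 (fun f x => f.1 x) H U) :=
  Bornology.isBounded_ofBounded_iff _

instance BHom.instBornVec : BornVec 𝕜 (BHom 𝕜 B M N) where
  isBounded_add {H K} hH hK := by
    refine BHom.isBounded_iff.2 fun U hU => ?_
    refine (BornVec.isBounded_add (𝕜 := 𝕜) (BHom.isBounded_iff.1 hH U hU)
      (BHom.isBounded_iff.1 hK U hU)).subset ?_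
    rintro _ ⟨_, ⟨f, hf, g, hg, rfl⟩, x, hx, rfl⟩
    exact ⟨f.1 x, ⟨f, hf, x, hx, rfl⟩, g.1 x, ⟨g, hg, x, hx, rfl⟩, rfl⟩
  isBounded_smul c {H} hH := by
    refine BHom.isBounded_iff.2 fun U hU => ?_
    refine (BornVec.isBounded_smul c (BHom.isBounded_iff.1 hH U hU)).subset ?_
    rintro _ ⟨_, ⟨f, hf, rfl⟩, x, hx, rfl⟩
    exact ⟨f.1 x, ⟨f, hf, x, hx, rfl⟩, rfl⟩

end Hom

/-- `ℒ_B(M, N)` is complete when `N` is. -/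
instance BHom.instCompleteBorn {𝕜 B M N : Type*} [RCLike 𝕜] [Ring B] [Algebra 𝕜 B] [Bornology B]
    [AddCommGroup M] [Module Bᵐᵒᵖ M] [Bornology M]
    [AddCommGroup N] [Module 𝕜 N] [Module Bᵐᵒᵖ N] [IsScalarTower 𝕜 Bᵐᵒᵖ N] [Bornology N]
    [BornMod 𝕜 B N] : CompleteBorn 𝕜 (BHom 𝕜 B M N) where
  exists_completant := by
    intro H hH
    choose D hD hb hc using fun U : {U : Set M // IsBounded U} =>
      CompleteBorn.exists_completant (𝕜 := 𝕜) _ (BHom.isBounded_iff.1 hH U.1 U.2)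
    let E : Set (BHom 𝕜 B M N) := {f | ∀ U, ∀ x ∈ U.1, f.1 x ∈ D U}
    have hE : IsDisc 𝕜 E := by
      refine ⟨⟨0, fun U x _ => (hc U).zero_mem⟩, fun c hc' f hf U x hx =>
        (hc U).circled c hc' _ (hf U x hx), fun f hf g hg t h0 h1 U x hx =>
        (hc U).convex _ (hf U x hx) _ (hg U x hx) t h0 h1⟩
    have hsm : ∀ {ε : 𝕜} {f : BHom 𝕜 B M N}, f ∈ ε • E → ∀ U, ∀ x ∈ U.1, f.1 x ∈ ε • D U := by
      rintro ε _ ⟨f, hf, rfl⟩ U x hx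
      exact ⟨f.1 x, hf U x hx, rfl⟩
    have hsm' : ∀ {ε : ℝ}, 0 < ε → ∀ {f : BHom 𝕜 B M N},
        (∀ U, ∀ x ∈ U.1, f.1 x ∈ (ε : 𝕜) • D U) → f ∈ (ε : 𝕜) • E := by
      intro ε hε f hf
      have hε' : (ε : 𝕜) ≠ 0 := by exact_mod_cast hε.ne'
      rw [Set.mem_smul_set_iff_inv_smul_mem₀ hε']
      intro U x hx
      have := hf U x hx
      rw [Set.mem_smul_set_iff_inv_smul_mem₀ hε'] at this
      exact this
    refine ⟨E, fun f hf U x hx => hD U ⟨f, hf, x, hx, rfl⟩, BHom.isBounded_iff.2 fun U hU => ?_,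
      hE, fun f hf => ?_, fun u hu => ?_⟩
    · refine (hb ⟨U, hU⟩).subset ?_
      rintro _ ⟨f, hf, x, hx, rfl⟩
      exact hf ⟨U, hU⟩ x hx
    · ext x
      exact (hc ⟨{x}, isBounded_singleton⟩).norming _ fun ε hε => hsm (hf ε hε) _ x rfl
    · have hux : ∀ U : {U : Set M // IsBounded U}, ∀ x ∈ U.1,
          CauchyGauge 𝕜 (D U) (fun n => (u n).1 x) := by
        intro U x hx ε hε
        obtain ⟨N, hN⟩ := hu ε hε
        exact ⟨N, fun m n hm hn => hsm (hN m n hm hn) U x hx⟩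
      choose y hy using fun (U : {U : Set M // IsBounded U}) (x : M) (hx : x ∈ U.1) =>
        (hc U).complete _ (hux U x hx)
      let g : M → N := fun x => y ⟨{x}, isBounded_singleton⟩ x rfl
      have hg : ∀ x, TendstoBorn 𝕜 (fun n => (u n).1 x) (g x) := fun x =>
        ⟨_, hb _, hy ⟨{x}, isBounded_singleton⟩ x rfl⟩
      have hgU : ∀ (U : {U : Set M // IsBounded U}) (x : M) (hx : x ∈ U.1),
          TendstoGauge 𝕜 (D U) (fun n => (u n).1 x) (g x) := by
        intro U x hx
        have : g x = y U x hx := TendstoBorn.unique (hg x) ⟨_, hb U, hy U x hx⟩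
        rw [this]
        exact hy U x hx
      have hadd : ∀ x x', g (x + x') = g x + g x' := by
        intro x x'
        let U : {U : Set M // IsBounded U} :=
          ⟨{x, x', x + x'}, by
            refine (isBounded_singleton.insert _).insert _⟩
        refine TendstoGauge.unique (hc U) (hgU U (x + x') (by simp [U])) fun ε hε => ?_
        obtain ⟨N, hN⟩ := hgU U x (by simp [U]) (ε / 2) (half_pos hε)
        obtain ⟨N', hN'⟩ := hgU U x' (by simp [U]) (ε / 2) (half_pos hε)
        refine ⟨max N N', fun n hn => ?_⟩
        have := (hc U).add_mem (half_pos hε).le (half_pos hε).le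
          (hN n ((le_max_left _ _).trans hn)) (hN' n ((le_max_right _ _).trans hn))
        rw [add_halves] at this
        rw [map_add]
        rwa [sub_add_sub_comm] at this
      have hsmul : ∀ (b : Bᵐᵒᵖ) x, g (b • x) = b • g x := by
        intro b x
        refine TendstoBorn.unique (𝕜 := 𝕜) (hg (b • x)) ?_
        obtain ⟨S, hS, hx⟩ := hg x
        refine ⟨Set.image2 (fun m b => MulOpposite.op b • m) S {b.unop},
          BornMod.isBounded_act (𝕜 := 𝕜) hS isBounded_singleton, fun ε hε => ?_⟩
        obtain ⟨N, hN⟩ := hx ε hε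
        refine ⟨N, fun n hn => ?_⟩
        obtain ⟨d, hd, he⟩ := hN n hn
        refine ⟨b • d, ⟨d, hd, _, rfl, rfl⟩, ?_⟩
        simp only [map_smul, ← smul_sub]
        rw [smul_comm]
        exact congrArg (b • ·) he
      have hunif : ∀ ε : ℝ, 0 < ε → ∃ N, ∀ n, N ≤ n → ∀ U : {U : Set M // IsBounded U}, ∀ x ∈ U.1,
          (u n).1 x - g x ∈ (ε : 𝕜) • D U := by
        intro ε hε
        obtain ⟨N, hN⟩ := hu (ε / 2) (half_pos hε)
        refine ⟨N, fun n hn U x hx => ?_⟩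
        obtain ⟨K, hK⟩ := hgU U x hx (ε / 2) (half_pos hε)
        have := (hc U).add_mem (half_pos hε).le (half_pos hε).le
          (hsm (hN n (max N K) hn (le_max_left _ _)) U x hx) (hK (max N K) (le_max_right _ _))
        rw [add_halves] at this
        convert this using 1
        exact (sub_add_sub_cancel ((u n).1 x) ((u (max N K)).1 x) (g x)).symm
      let G : M →ₗ[Bᵐᵒᵖ] N := { toFun := g, map_add' := hadd, map_smul' := hsmul }
      have hG : IsBddMap G := by
        intro U hU
        obtain ⟨N, hN⟩ := hunif 1 one_pos
        refine (BornVec.isBounded_add (𝕜 := 𝕜) ((u N).2 U hU)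
          (BornVec.isBounded_smul (-(1 : ℝ) : 𝕜) (hb ⟨U, hU⟩))).subset ?_
        rintro _ ⟨x, hx, rfl⟩
        obtain ⟨d, hd, he⟩ := hN N le_rfl ⟨U, hU⟩ x hx
        refine ⟨(u N).1 x, ⟨x, hx, rfl⟩, _, ⟨d, hd, rfl⟩, ?_⟩
        have he' : ((1 : ℝ) : 𝕜) • d = (u N).1 x - g x := he
        change (u N).1 x + (-((1 : ℝ) : 𝕜)) • d = g x
        rw [neg_smul, he']
        abel
      refine ⟨⟨G, hG⟩, fun ε hε => ?_⟩
      obtain ⟨N, hN⟩ := hunif ε hε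
      exact ⟨N, fun n hn => hsm' hε (hN n hn)⟩

section Comp

variable {𝕜 B M N K : Type*} [RCLike 𝕜] [Ring B] [Algebra 𝕜 B]
  [AddCommGroup M] [Module Bᵐᵒᵖ M] [Bornology M]
  [Module 𝕜 M] [IsScalarTower 𝕜 Bᵐᵒᵖ M] [BornVec 𝕜 M]
  [AddCommGroup N] [Module 𝕜 N] [Module Bᵐᵒᵖ N] [IsScalarTower 𝕜 Bᵐᵒᵖ N] [Bornology N]
  [BornVec 𝕜 N]
  [AddCommGroup K] [Module 𝕜 K] [Module Bᵐᵒᵖ K] [IsScalarTower 𝕜 Bᵐᵒᵖ K] [Bornology K]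
  [BornVec 𝕜 K]

variable (𝕜 B M) in
/-- The identity map. -/
def BHom.id : BHom 𝕜 B M M := ⟨LinearMap.id, fun S hS => by simpa using hS⟩

/-- Composition of bounded `B`-linear maps. -/
def BHom.comp (g : BHom 𝕜 B N K) (f : BHom 𝕜 B M N) : BHom 𝕜 B M K :=
  ⟨g.1 ∘ₗ f.1, fun S hS => by
    have := g.2 _ (f.2 S hS)
    rwa [Set.image_image] at this⟩

@[simp]
lemma BHom.comp_apply (g : BHom 𝕜 B N K) (f : BHom 𝕜 B M N) (x : M) :
    (BHom.comp g f).1 x = g.1 (f.1 x) := rfl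

@[simp]
lemma BHom.id_apply (x : M) : (BHom.id 𝕜 B M).1 x = x := rfl

end Comp

/-- The left `B`-module structure of `ℒ_B(M, B)`: `(b φ)(x) = b φ(x)`. -/
instance BHom.instModuleDual {𝕜 B M : Type*} [RCLike 𝕜] [Ring B] [Algebra 𝕜 B] [Bornology B]
    [BornAlg 𝕜 B] [AddCommGroup M] [Module Bᵐᵒᵖ M] [Bornology M] :
    Module B (BHom 𝕜 B M B) where
  smul b φ := ⟨b • φ.1, fun S hS => by
    refine (BornAlg.isBounded_mul (𝕜 := 𝕜) (isBounded_singleton (x := b)) (φ.2 S hS)).subset ?_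
    rintro _ ⟨x, hx, rfl⟩
    exact ⟨b, rfl, φ.1 x, ⟨x, hx, rfl⟩, rfl⟩⟩
  one_smul φ := Subtype.ext (one_smul B φ.1)
  mul_smul b c φ := Subtype.ext (mul_smul b c φ.1)
  smul_zero b := Subtype.ext (smul_zero b)
  smul_add b φ ψ := Subtype.ext (smul_add b φ.1 ψ.1)
  add_smul b c φ := Subtype.ext (add_smul b c φ.1)
  zero_smul φ := Subtype.ext (zero_smul B φ.1)

lemma BHom.smul_dual_apply {𝕜 B M : Type*} [RCLike 𝕜] [Ring B] [Algebra 𝕜 B] [Bornology B]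
    [BornAlg 𝕜 B] [AddCommGroup M] [Module Bᵐᵒᵖ M] [Bornology M] (b : B) (φ : BHom 𝕜 B M B)
    (x : M) : (b • φ).1 x = b * φ.1 x := rfl

/-! ### The nuclear map for modules -/

section Bdd

variable {V W K : Type*} [Bornology V] [Bornology W] [Bornology K]

lemma IsBddMap.comp {g : W → K} {f : V → W} (hg : IsBddMap g) (hf : IsBddMap f) :
    IsBddMap fun x => g (f x) := fun S hS => by
  have := hg _ (hf S hS)
  rwa [Set.image_image] at this

lemma IsBddMap.add (𝕜 : Type*) [RCLike 𝕜] [AddCommGroup W] [Module 𝕜 W] [BornVec 𝕜 W]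
    {f g : V → W} (hf : IsBddMap f) (hg : IsBddMap g) : IsBddMap fun x => f x + g x :=
  fun S hS => by
    refine (BornVec.isBounded_add (𝕜 := 𝕜) (hf S hS) (hg S hS)).subset ?_
    rintro _ ⟨x, hx, rfl⟩
    exact ⟨f x, ⟨x, hx, rfl⟩, g x, ⟨x, hx, rfl⟩, rfl⟩

lemma IsBddMap.units_smul (𝕜 : Type*) [RCLike 𝕜] [AddCommGroup W] [Module 𝕜 W] [BornVec 𝕜 W]
    {f : V → W} (hf : IsBddMap f) (e : ℤˣ) : IsBddMap fun x => e • f x := by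
  rcases Int.units_eq_one_or e with rfl | rfl
  · simpa using hf
  · have := (BornVec.smul_map 𝕜 (V := W) (-1)).comp hf
    simpa using this

lemma isBddMap_eval {ι : Type*} {Y : ι → Type*} [∀ i, Bornology (Y i)] (i : ι) :
    IsBddMap fun x : ∀ i, Y i => x i := fun _ hS => forall_isBounded_image_eval_iff.2 hS i

lemma isBddMap_pi {ι : Type*} {Y : ι → Type*} [∀ i, Bornology (Y i)] {f : V → ∀ i, Y i}
    (h : ∀ i, IsBddMap fun x => f x i) : IsBddMap f := fun S hS =>
  forall_isBounded_image_eval_iff.1 fun i => by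
    have := h i S hS
    rwa [Set.image_image]

end Bdd

/-- The product bornology on a product of bornological vector spaces. -/
instance {𝕜 ι : Type*} {Y : ι → Type*} [RCLike 𝕜] [∀ i, AddCommGroup (Y i)] [∀ i, Module 𝕜 (Y i)]
    [∀ i, Bornology (Y i)] [∀ i, BornVec 𝕜 (Y i)] : BornVec 𝕜 (∀ i, Y i) where
  isBounded_add {S T} hS hT := forall_isBounded_image_eval_iff.1 fun i => by
    refine (BornVec.isBounded_add (𝕜 := 𝕜) (isBddMap_eval i S hS) (isBddMap_eval i T hT)).subset ?_
    rintro _ ⟨_, ⟨x, hx, y, hy, rfl⟩, rfl⟩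
    exact ⟨x i, ⟨x, hx, rfl⟩, y i, ⟨y, hy, rfl⟩, rfl⟩
  isBounded_smul c {S} hS := forall_isBounded_image_eval_iff.1 fun i => by
    refine (BornVec.isBounded_smul c (isBddMap_eval i S hS)).subset ?_
    rintro _ ⟨_, ⟨x, hx, rfl⟩, rfl⟩
    exact ⟨x i, ⟨x, hx, rfl⟩, rfl⟩

section Nuclear

variable (𝕜 : Type*) {B : Type*} [RCLike 𝕜] [Ring B] [Algebra 𝕜 B] [Bornology B] [BornAlg 𝕜 B]

variable (B) in
/-- The dual left `B`-module `ℒ_B(P, B)`. -/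
abbrev Dual (P : Type*) [AddCommGroup P] [Module Bᵐᵒᵖ P] [Bornology P] : Type _ := BHom 𝕜 B P B

variable {P P' P'' N N' N'' : Type*}
  [AddCommGroup P] [Module 𝕜 P] [Module Bᵐᵒᵖ P] [IsScalarTower 𝕜 Bᵐᵒᵖ P] [Bornology P]
  [BornMod 𝕜 B P]
  [AddCommGroup P'] [Module 𝕜 P'] [Module Bᵐᵒᵖ P'] [IsScalarTower 𝕜 Bᵐᵒᵖ P'] [Bornology P']
  [BornMod 𝕜 B P']
  [AddCommGroup P''] [Module 𝕜 P''] [Module Bᵐᵒᵖ P''] [IsScalarTower 𝕜 Bᵐᵒᵖ P''] [Bornology P'']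
  [BornMod 𝕜 B P'']
  [AddCommGroup N] [Module 𝕜 N] [Module Bᵐᵒᵖ N] [IsScalarTower 𝕜 Bᵐᵒᵖ N] [Bornology N]
  [BornMod 𝕜 B N]
  [AddCommGroup N'] [Module 𝕜 N'] [Module Bᵐᵒᵖ N'] [IsScalarTower 𝕜 Bᵐᵒᵖ N'] [Bornology N']
  [BornMod 𝕜 B N']
  [AddCommGroup N''] [Module 𝕜 N''] [Module Bᵐᵒᵖ N''] [IsScalarTower 𝕜 Bᵐᵒᵖ N''] [Bornology N'']
  [BornMod 𝕜 B N'']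

variable {𝕜}

lemma isBddMap_postcomp (f : BHom 𝕜 B N N') :
    IsBddMap fun φ : BHom 𝕜 B P N => BHom.comp f φ := fun H hH => by
  refine BHom.isBounded_iff.2 fun U hU => (f.2 _ (BHom.isBounded_iff.1 hH U hU)).subset ?_
  rintro _ ⟨_, ⟨φ, hφ, rfl⟩, x, hx, rfl⟩
  exact ⟨φ.1 x, ⟨φ, hφ, x, hx, rfl⟩, rfl⟩

lemma isBddMap_precomp (g : BHom 𝕜 B P P') :
    IsBddMap fun φ : BHom 𝕜 B P' N => BHom.comp φ g := fun H hH => by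
  refine BHom.isBounded_iff.2 fun U hU => (BHom.isBounded_iff.1 hH _ (g.2 U hU)).subset ?_
  rintro _ ⟨_, ⟨φ, hφ, rfl⟩, x, hx, rfl⟩
  exact ⟨φ, hφ, g.1 x, ⟨x, hx, rfl⟩, rfl⟩

/-- The rank one map `n ⊗ φ : x ↦ n φ(x)`. -/
def rankOne (n : N) (φ : Dual 𝕜 B P) : BHom 𝕜 B P N :=
  ⟨{ toFun := fun x => MulOpposite.op (φ.1 x) • n
     map_add' := fun x y => by rw [map_add, MulOpposite.op_add, add_smul]
     map_smul' := fun r x => by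
      rw [map_smul, RingHom.id_apply, smul_smul]
      rfl }, fun S hS => by
    refine (BornMod.isBounded_act (𝕜 := 𝕜) (isBounded_singleton (x := n)) (φ.2 S hS)).subset ?_
    rintro _ ⟨x, hx, rfl⟩
    exact ⟨n, rfl, φ.1 x, ⟨x, hx, rfl⟩, rfl⟩⟩

lemma rankOne_apply (n : N) (φ : Dual 𝕜 B P) (x : P) :
    (rankOne n φ).1 x = MulOpposite.op (φ.1 x) • n := rfl

lemma isBalanced_rankOne : BTensor.IsBalanced 𝕜 B
    (fun p : N × Dual 𝕜 B P => (rankOne p.1 p.2 : BHom 𝕜 B P N)) where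
  add_left n n' φ := Subtype.ext <| LinearMap.ext fun x => smul_add (MulOpposite.op (φ.1 x)) n n'
  add_right n φ ψ := Subtype.ext <| LinearMap.ext fun x =>
    add_smul (MulOpposite.op (φ.1 x)) (MulOpposite.op (ψ.1 x)) n
  smul_left c n φ := Subtype.ext <| LinearMap.ext fun x => smul_comm (MulOpposite.op (φ.1 x)) c n
  smul_right c n φ := Subtype.ext <| LinearMap.ext fun x =>
    smul_assoc c (MulOpposite.op (φ.1 x)) n
  balanced b n φ := Subtype.ext <| LinearMap.ext fun x =>
    (mul_smul (MulOpposite.op (φ.1 x)) (MulOpposite.op b) n).symm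
  bounded S hS := by
    obtain ⟨h1, h2⟩ := isBounded_image_fst_and_snd.2 hS
    refine BHom.isBounded_iff.2 fun U hU =>
      (BornMod.isBounded_act (𝕜 := 𝕜) h1 (BHom.isBounded_iff.1 h2 U hU)).subset ?_
    rintro _ ⟨_, ⟨p, hp, rfl⟩, x, hx, rfl⟩
    exact ⟨p.1, ⟨p, hp, rfl⟩, p.2.1 x, ⟨p.2, ⟨p, hp, rfl⟩, x, hx, rfl⟩, rfl⟩

/-- The natural map `N ⊗_B ℒ_B(P, B) → ℒ_B(P, N)`, `(n ⊗ φ)(x) = n φ(x)`. -/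
noncomputable def nuc (P N : Type*)
    [AddCommGroup P] [Module 𝕜 P] [Module Bᵐᵒᵖ P] [IsScalarTower 𝕜 Bᵐᵒᵖ P] [Bornology P]
    [BornMod 𝕜 B P]
    [AddCommGroup N] [Module 𝕜 N] [Module Bᵐᵒᵖ N] [IsScalarTower 𝕜 Bᵐᵒᵖ N] [Bornology N]
    [BornMod 𝕜 B N] : BTensor 𝕜 B N (Dual 𝕜 B P) →ₗ[𝕜] BHom 𝕜 B P N :=
  BTensor.lift (fun p : N × Dual 𝕜 B P => (rankOne p.1 p.2 : BHom 𝕜 B P N)) isBalanced_rankOne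

lemma isBddMap_nuc : IsBddMap (nuc (𝕜 := 𝕜) (B := B) P N) := BTensor.isBddMap_lift _ _

@[simp]
lemma nuc_tmul (n : N) (φ : Dual 𝕜 B P) :
    nuc P N (BTensor.tmul 𝕜 B n φ) = (rankOne n φ : BHom 𝕜 B P N) := BTensor.lift_tmul _ _ _ _

lemma isBalanced_tmap (f : BHom 𝕜 B N N') (g : BHom 𝕜 B P P') : BTensor.IsBalanced 𝕜 B
    (fun p : N × Dual 𝕜 B P' => BTensor.tmul 𝕜 B (f.1 p.1) (BHom.comp p.2 g : Dual 𝕜 B P)) where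
  add_left n n' φ := by
    simp only [map_add]; exact BTensor.isBalanced_tmul.add_left _ _ _
  add_right n φ ψ :=
    (BTensor.isBalanced_tmul (𝕜 := 𝕜) (B := B) (M := N') (N := Dual 𝕜 B P)).add_right (f.1 n)
      (BHom.comp φ g) (BHom.comp ψ g)
  smul_left c n φ := by
    have : f.1 (c • n) = c • f.1 n := (f.1.restrictScalars 𝕜).map_smul c n
    simp only [this]; exact BTensor.isBalanced_tmul.smul_left _ _ _
  smul_right c n φ :=
    (BTensor.isBalanced_tmul (𝕜 := 𝕜) (B := B) (M := N') (N := Dual 𝕜 B P)).smul_right c (f.1 n)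
      (BHom.comp φ g)
  balanced b n φ := by
    simp only [map_smul]; exact BTensor.isBalanced_tmul.balanced _ _ _
  bounded S hS := by
    obtain ⟨h1, h2⟩ := isBounded_image_fst_and_snd.2 hS
    refine (BTensor.isBalanced_tmul (𝕜 := 𝕜) (B := B) (M := N') (N := Dual 𝕜 B P)).bounded _
      ((f.2 _ h1).prod (isBddMap_precomp g _ h2)) |>.subset ?_
    rintro _ ⟨p, hp, rfl⟩
    exact ⟨(f.1 p.1, BHom.comp p.2 g), ⟨⟨p.1, ⟨p, hp, rfl⟩, rfl⟩, ⟨p.2, ⟨p, hp, rfl⟩, rfl⟩⟩, rfl⟩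

/-- The map `N ⊗_B ℒ_B(P', B) → N' ⊗_B ℒ_B(P, B)`, `n ⊗ φ ↦ f(n) ⊗ (φ ∘ g)`. -/
noncomputable def tmap (f : BHom 𝕜 B N N') (g : BHom 𝕜 B P P') :
    BTensor 𝕜 B N (Dual 𝕜 B P') →ₗ[𝕜] BTensor 𝕜 B N' (Dual 𝕜 B P) :=
  BTensor.lift _ (isBalanced_tmap f g)

lemma isBddMap_tmap (f : BHom 𝕜 B N N') (g : BHom 𝕜 B P P') : IsBddMap (tmap f g) :=
  BTensor.isBddMap_lift _ _

@[simp]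
lemma tmap_tmul (f : BHom 𝕜 B N N') (g : BHom 𝕜 B P P') (n : N) (φ : Dual 𝕜 B P') :
    tmap f g (BTensor.tmul 𝕜 B n φ) = BTensor.tmul 𝕜 B (f.1 n) (BHom.comp φ g : Dual 𝕜 B P) :=
  BTensor.lift_tmul _ _ _ _

lemma tmap_tmap (f : BHom 𝕜 B N N') (f' : BHom 𝕜 B N' N'') (g : BHom 𝕜 B P P')
    (g' : BHom 𝕜 B P' P'') (z : BTensor 𝕜 B N (Dual 𝕜 B P'')) :
    tmap f' g (tmap f g' z) = tmap (BHom.comp f' f) (BHom.comp g' g) z := by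
  have : tmap f' g ∘ₗ tmap f g' = tmap (BHom.comp f' f) (BHom.comp g' g) :=
    BTensor.hom_ext ((isBddMap_tmap f' g).comp (isBddMap_tmap f g')) (isBddMap_tmap _ _)
      fun m n => by
        rw [LinearMap.comp_apply, tmap_tmul, tmap_tmul, tmap_tmul]; rfl
  exact LinearMap.congr_fun this z

lemma isBddMap_zero {V W : Type*} [Bornology V] [Bornology W] [Zero W] :
    IsBddMap fun _ : V => (0 : W) := fun S _ =>
  (isBounded_singleton (x := (0 : W))).subset (by rintro _ ⟨x, _, rfl⟩; rfl)

lemma tmap_zero_left (g : BHom 𝕜 B P P') (z : BTensor 𝕜 B N (Dual 𝕜 B P')) :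
    tmap (0 : BHom 𝕜 B N N') g z = 0 := by
  have : tmap (0 : BHom 𝕜 B N N') g = 0 :=
    BTensor.hom_ext (isBddMap_tmap _ _) isBddMap_zero fun m n => by
      rw [tmap_tmul]
      have := (BTensor.isBalanced_tmul (𝕜 := 𝕜) (B := B) (M := N') (N := Dual 𝕜 B P)).smul_left 0 0
        (BHom.comp n g)
      simpa using this
  exact LinearMap.congr_fun this z

lemma tmap_zero_right (f : BHom 𝕜 B N N') (z : BTensor 𝕜 B N (Dual 𝕜 B P')) :
    tmap f (0 : BHom 𝕜 B P P') z = 0 := by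
  have : tmap f (0 : BHom 𝕜 B P P') = 0 :=
    BTensor.hom_ext (isBddMap_tmap _ _) isBddMap_zero fun m n => by
      rw [tmap_tmul]
      have h0 : (BHom.comp n (0 : BHom 𝕜 B P P') : Dual 𝕜 B P) = 0 :=
        Subtype.ext (LinearMap.ext fun x => map_zero n.1)
      have := (BTensor.isBalanced_tmul (𝕜 := 𝕜) (B := B) (M := N') (N := Dual 𝕜 B P)).smul_right 0
        (f.1 m) 0
      rw [h0]
      simpa using this
  exact LinearMap.congr_fun this z

/-- Naturality of the map `nuc`. -/
lemma nuc_tmap (f : BHom 𝕜 B N N') (g : BHom 𝕜 B P P') (z : BTensor 𝕜 B N (Dual 𝕜 B P')) :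
    nuc P N' (tmap f g z) = BHom.comp f (BHom.comp (nuc P' N z) g) := by
  let R : BHom 𝕜 B P' N →ₗ[𝕜] BHom 𝕜 B P N' :=
    { toFun := fun φ => BHom.comp f (BHom.comp φ g)
      map_add' := fun φ ψ => Subtype.ext <| LinearMap.ext fun x => map_add f.1 _ _
      map_smul' := fun c φ => Subtype.ext <| LinearMap.ext fun x =>
        (f.1.restrictScalars 𝕜).map_smul c _ }
  have hR : IsBddMap R := (isBddMap_postcomp f).comp (isBddMap_precomp g)
  have : nuc P N' ∘ₗ tmap f g = R ∘ₗ nuc P' N :=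
    BTensor.hom_ext (isBddMap_nuc.comp (isBddMap_tmap f g)) (hR.comp isBddMap_nuc) fun m n => by
      rw [LinearMap.comp_apply, tmap_tmul, nuc_tmul, LinearMap.comp_apply, nuc_tmul]
      exact Subtype.ext <| LinearMap.ext fun x => (map_smul f.1 _ _).symm
  exact LinearMap.congr_fun this z

end Nuclear

/-! ### The category of bornological modules, and complexes -/

section Category

variable (𝕜 : Type) (B : Type u) [RCLike 𝕜] [Ring B] [Algebra 𝕜 B] [Bornology B] [BornAlg 𝕜 B]

/-- The objects of `Mod(B)`: (complete) bornological right `B`-modules. -/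
structure BMod where
  carrier : Type u
  [addCommGroup : AddCommGroup carrier]
  [module : Module 𝕜 carrier]
  [moduleOp : Module Bᵐᵒᵖ carrier]
  [isScalarTower : IsScalarTower 𝕜 Bᵐᵒᵖ carrier]
  [bornology : Bornology carrier]
  [bornMod : BornMod 𝕜 B carrier]

attribute [instance] BMod.addCommGroup BMod.module BMod.moduleOp BMod.isScalarTower BMod.bornology
  BMod.bornMod

variable {𝕜 B}

/-- The category `Mod(B)`; the morphisms are the bounded `B`-linear maps. -/
instance BMod.instCategory : Category (BMod 𝕜 B) where
  Hom M N := BHom 𝕜 B M.carrier N.carrier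
  id M := BHom.id 𝕜 B M.carrier
  comp f g := BHom.comp g f

instance BMod.instPreadditive : Preadditive (BMod 𝕜 B) where
  homGroup M N := inferInstanceAs (AddCommGroup (BHom 𝕜 B M.carrier N.carrier))
  add_comp _ _ _ f f' g := Subtype.ext <| LinearMap.ext fun x =>
    map_add (Subtype.val g : _ →ₗ[_] _) (f.1 x) (f'.1 x)
  comp_add _ _ _ _ _ _ := rfl

instance BMod.instLinear : Linear 𝕜 (BMod 𝕜 B) where
  homModule M N := inferInstanceAs (Module 𝕜 (BHom 𝕜 B M.carrier N.carrier))
  smul_comp _ _ _ c f g := Subtype.ext <| LinearMap.ext fun x =>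
    ((Subtype.val g : _ →ₗ[_] _).restrictScalars 𝕜).map_smul c (f.1 x)
  comp_smul _ _ _ _ _ _ := rfl

instance (M N : BMod 𝕜 B) : Bornology (M ⟶ N) :=
  inferInstanceAs (Bornology (BHom 𝕜 B M.carrier N.carrier))

instance (M N : BMod 𝕜 B) : BornVec 𝕜 (M ⟶ N) :=
  inferInstanceAs (BornVec 𝕜 (BHom 𝕜 B M.carrier N.carrier))

/-- A finitely generated projective bornological `B`-module: a direct summand, by bounded
`B`-linear maps, of some finite free module `B^n`. -/
def IsFGProjective (P : BMod 𝕜 B) : Prop :=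
  ∃ (n : ℕ) (i : P.carrier →ₗ[Bᵐᵒᵖ] (Fin n → B)) (r : (Fin n → B) →ₗ[Bᵐᵒᵖ] P.carrier),
    IsBddMap i ∧ IsBddMap r ∧ r ∘ₗ i = LinearMap.id

/-- A complex is bounded (in grading degree) if it vanishes outside a finite range of degrees. -/
def IsBoundedComplex (M : CochainComplex (BMod 𝕜 B) ℤ) : Prop :=
  ∃ a b : ℤ, ∀ i, (i < a ∨ b < i) → Subsingleton (M.X i).carrier

end Category

section Bor

variable (𝕜 : Type) [RCLike 𝕜]

/-- The space of bounded linear maps between bornological vector spaces. -/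
def BddLin (V W : Type*) [AddCommGroup V] [Module 𝕜 V] [Bornology V]
    [AddCommGroup W] [Module 𝕜 W] [Bornology W] [BornVec 𝕜 W] : AddSubgroup (V →ₗ[𝕜] W) where
  carrier := {f | IsBddMap f}
  zero_mem' := isBddMap_zero
  add_mem' hf hg := IsBddMap.add 𝕜 hf hg
  neg_mem' {f} hf := by
    have : IsBddMap fun x => (-1 : 𝕜) • f x := (BornVec.smul_map 𝕜 (-1)).comp hf
    simp only [neg_smul, one_smul] at this
    exact this

/-- Bornological vector spaces over `𝕜`. -/
structure Bor where
  carrier : Type u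
  [addCommGroup : AddCommGroup carrier]
  [module : Module 𝕜 carrier]
  [bornology : Bornology carrier]
  [bornVec : BornVec 𝕜 carrier]

attribute [instance] Bor.addCommGroup Bor.module Bor.bornology Bor.bornVec

variable {𝕜}

/-- The category of bornological vector spaces and bounded linear maps. -/
instance Bor.instCategory : Category (Bor.{u} 𝕜) where
  Hom V W := BddLin 𝕜 V.carrier W.carrier
  id V := ⟨LinearMap.id, fun S hS => by simpa using hS⟩
  comp f g := ⟨g.1 ∘ₗ f.1, by
    have := IsBddMap.comp (g := g.1) (f := f.1) g.2 f.2
    exact this⟩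

instance Bor.instPreadditive : Preadditive (Bor.{u} 𝕜) where
  homGroup V W := inferInstanceAs (AddCommGroup (BddLin 𝕜 V.carrier W.carrier))
  add_comp _ _ _ f f' g := Subtype.ext <| LinearMap.ext fun x =>
    map_add (Subtype.val g : _ →ₗ[_] _) (f.1 x) (f'.1 x)
  comp_add _ _ _ _ _ _ := rfl

end Bor

section Complexes

open CochainComplex.HomComplex

variable {𝕜 : Type} {B : Type u} [RCLike 𝕜] [Ring B] [Algebra 𝕜 B] [Bornology B]
  [BornAlg 𝕜 B] (M N : CochainComplex (BMod 𝕜 B) ℤ)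

/-- The bornology of `ℒ_B^n(M, N) = ∏_{p + n = q} ℒ_B(M^p, N^q)` is the product of the
equibounded bornologies. -/
instance (n : ℤ) : Bornology (Cochain M N n) :=
  inferInstanceAs (Bornology (∀ T : Triplet n, M.X T.p ⟶ N.X T.q))

instance (n : ℤ) : BornVec 𝕜 (Cochain M N n) :=
  inferInstanceAs (BornVec 𝕜 (∀ T : Triplet n, M.X T.p ⟶ N.X T.q))

lemma isBddMap_δ (n m : ℤ) : IsBddMap (δ n m : Cochain M N n → Cochain M N m) := by
  refine isBddMap_pi (Y := fun T : Triplet m => M.X T.p ⟶ N.X T.q) ?_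
  rintro ⟨p, q, hpq⟩
  have hv : ∀ p q hpq, IsBddMap fun z : Cochain M N n => z.v p q hpq := fun p q hpq =>
    isBddMap_eval (Y := fun T : Triplet n => M.X T.p ⟶ N.X T.q) ⟨p, q, hpq⟩
  exact IsBddMap.add 𝕜 ((isBddMap_postcomp (N.d (p + n) q)).comp (hv p (p + n) rfl))
    (IsBddMap.units_smul 𝕜 ((isBddMap_precomp (M.d p (p + m - n))).comp (hv _ q _)) m.negOnePow)

/-- The complex `ℒ_B^•(M, N)` of bornological vector spaces: in degree `n` the space of graded maps
of degree `n`, with the differential `δ(h) = d_N ∘ h - (-1)^n h ∘ d_M`. -/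
def homComplex : CochainComplex (Bor.{u} 𝕜) ℤ where
  X n := { carrier := Cochain M N n }
  d n m := ⟨δ_hom 𝕜 M N n m, isBddMap_δ M N n m⟩
  shape n m h := Subtype.ext <| LinearMap.ext fun z => δ_shape n m h z
  d_comp_d' n m k _ _ := Subtype.ext <| LinearMap.ext fun z => δ_δ n m k z

/-- The degree `n` part `∏_{p + n = q} N^q ⊗_B ℒ_B(M^p, B)` of `N^• ⊗_B ℒ_B^•(M, B)`. Here
`ℒ_B(M^p, B)` sits in degree `-p`. For bounded complexes the product is finite in the sense that
all but finitely many factors vanish, so that it is the direct sum. -/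
abbrev TensorDual (n : ℤ) : Type u :=
  ∀ T : Triplet n, BTensor 𝕜 B (N.X T.q).carrier (Dual 𝕜 B (M.X T.p).carrier)

variable {M N}

/-- The differential of the total complex `N^• ⊗_B ℒ_B^•(M, B)`. On `x ⊗ φ`, with `x ∈ N^q` and
`φ ∈ ℒ_B^{-p}(M, B) = ℒ_B(M^p, B)`, `n = q - p`, it is given by
`d(x ⊗ φ) = dx ⊗ φ + (-1)^q x ⊗ dφ`, where `dφ = -(-1)^{-p} φ ∘ d_M`; thus
`d(x ⊗ φ) = dx ⊗ φ + (-1)^{n+1} x ⊗ (φ ∘ d_M)`. (As for the differential of graded maps, this is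
written for all degrees `n` and `m`, and vanishes unless `n + 1 = m`.) -/
noncomputable def tensorδ (n m : ℤ) : TensorDual M N n →ₗ[𝕜] TensorDual M N m where
  toFun u := fun ⟨p, q, hpq⟩ =>
    tmap (N.d (p + n) q) (𝟙 (M.X p)) (u ⟨p, p + n, rfl⟩) +
      m.negOnePow • tmap (𝟙 (N.X q)) (M.d p (p + m - n))
        (u ⟨p + m - n, q, by rw [← hpq, sub_add_cancel]⟩)
  map_add' u v := by
    funext ⟨p, q, hpq⟩
    simp only [Pi.add_apply, map_add, smul_add]
    abel
  map_smul' c u := by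
    funext ⟨p, q, hpq⟩
    simp only [Pi.smul_apply, map_smul, RingHom.id_apply, smul_add]
    rw [smul_comm]

lemma isBddMap_tensorδ (n m : ℤ) :
    IsBddMap (tensorδ n m : TensorDual M N n →ₗ[𝕜] TensorDual M N m) := by
  refine isBddMap_pi ?_
  rintro ⟨p, q, hpq⟩
  have hv : ∀ T, IsBddMap fun u : TensorDual M N n => u T := fun T => isBddMap_eval T
  exact IsBddMap.add 𝕜 ((isBddMap_tmap (N.d (p + n) q) (𝟙 (M.X p))).comp (hv ⟨p, p + n, rfl⟩))
    (IsBddMap.units_smul 𝕜 ((isBddMap_tmap (𝟙 (N.X q)) (M.d p (p + m - n))).comp (hv _))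
      m.negOnePow)

lemma tensorδ_shape (n m : ℤ) (h : ¬ n + 1 = m) :
    (tensorδ n m : TensorDual M N n →ₗ[𝕜] TensorDual M N m) = 0 := by
  refine LinearMap.ext fun u => ?_
  funext ⟨p, q, hpq⟩
  have h1 : N.d (p + n) q = 0 := N.shape _ _ (by simp; omega)
  have h2 : M.d p (p + m - n) = 0 := M.shape _ _ (by simp; omega)
  change tmap (N.d (p + n) q) _ _ + m.negOnePow • tmap _ (M.d p (p + m - n)) _ = 0
  rw [h1, h2]
  erw [tmap_zero_left, tmap_zero_right]
  simp

lemma tensorδ_apply (n m : ℤ) (h : n + 1 = m) (u : TensorDual M N n) (p q : ℤ) (hpq : p + m = q)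
    (p' q' : ℤ) (hp' : p' = p + 1) (hq' : q' = q - 1) :
    tensorδ n m u ⟨p, q, hpq⟩ =
      tmap (N.d q' q) (𝟙 (M.X p)) (u ⟨p, q', by omega⟩) +
        m.negOnePow • tmap (𝟙 (N.X q)) (M.d p p') (u ⟨p', q, by omega⟩) := by
  obtain rfl : q' = p + n := by omega
  obtain rfl : p' = p + m - n := by omega
  rfl

lemma total_square {X Y Y' : Type*} [AddCommGroup X] [AddCommGroup Y] [AddCommGroup Y']
    [Module 𝕜 X] [Module 𝕜 Y] [Module 𝕜 Y'] (T : Y →ₗ[𝕜] X) (T' : Y' →ₗ[𝕜] X) (a b : Y) (a' b' : Y')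
    (e e' : ℤˣ) (h : T a = 0) (h' : T' b' = 0) (hb : T b = T' a') (he : e' = -e) :
    T (a + e • b) + e' • T' (a' + e • b') = 0 := by
  subst he
  simp only [Units.smul_def, map_add, map_zsmul, h, h', hb, Units.val_neg, neg_smul, smul_zero,
    zero_add, add_zero, add_neg_cancel]

lemma tmap_d_left (p i j k : ℤ)
    (z : BTensor 𝕜 B (N.X i).carrier (Dual 𝕜 B (M.X p).carrier)) :
    tmap (N.d j k) (𝟙 (M.X p)) (tmap (N.d i j) (𝟙 (M.X p)) z) = 0 := by
  refine (tmap_tmap (N.d i j) (N.d j k) (𝟙 (M.X p)) (𝟙 (M.X p)) z).trans ?_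
  have h0 : BHom.comp (N.d j k) (N.d i j) = 0 := N.d_comp_d i j k
  rw [h0]
  exact tmap_zero_left _ z

lemma tmap_d_right (q i j k : ℤ)
    (z : BTensor 𝕜 B (N.X q).carrier (Dual 𝕜 B (M.X k).carrier)) :
    tmap (𝟙 (N.X q)) (M.d i j) (tmap (𝟙 (N.X q)) (M.d j k) z) = 0 := by
  refine (tmap_tmap (𝟙 (N.X q)) (𝟙 (N.X q)) (M.d i j) (M.d j k) z).trans ?_
  have h0 : BHom.comp (M.d j k) (M.d i j) = 0 := M.d_comp_d i j k
  rw [h0]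
  exact tmap_zero_right _ z

lemma tmap_d_comm (p p' q q' : ℤ)
    (z : BTensor 𝕜 B (N.X q').carrier (Dual 𝕜 B (M.X p').carrier)) :
    tmap (N.d q' q) (𝟙 (M.X p)) (tmap (𝟙 (N.X q')) (M.d p p') z) =
      tmap (𝟙 (N.X q)) (M.d p p') (tmap (N.d q' q) (𝟙 (M.X p')) z) :=
  (tmap_tmap (𝟙 (N.X q')) (N.d q' q) (𝟙 (M.X p)) (M.d p p') z).trans
    (tmap_tmap (N.d q' q) (𝟙 (N.X q)) (M.d p p') (𝟙 (M.X p')) z).symm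

lemma tensorδ_tensorδ (n m k : ℤ) (u : TensorDual M N n) :
    tensorδ m k (tensorδ n m u) = 0 := by
  by_cases h : n + 1 = m
  swap
  · rw [tensorδ_shape n m h, LinearMap.zero_apply, map_zero]
  by_cases h' : m + 1 = k
  swap
  · rw [tensorδ_shape m k h', LinearMap.zero_apply]
  funext ⟨p, q, hpq⟩
  rw [tensorδ_apply m k h' _ p q hpq (p + 1) (q - 1) rfl rfl,
    tensorδ_apply n m h u p (q - 1) (by omega) (p + 1) (q - 1 - 1) rfl rfl,
    tensorδ_apply n m h u (p + 1) q (by omega) (p + 1 + 1) (q - 1) rfl rfl]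
  exact total_square (tmap (N.d (q - 1) q) (𝟙 (M.X p))) (tmap (𝟙 (N.X q)) (M.d p (p + 1)))
    _ _ _ _ m.negOnePow k.negOnePow (tmap_d_left _ _ _ _ _) (tmap_d_right _ _ _ _ _)
    (tmap_d_comm _ _ _ _ _) (by rw [← h', Int.negOnePow_succ])

variable (M N) in
/-- The total complex `N^• ⊗_B ℒ_B^•(M, B)` of bornological vector spaces. -/
noncomputable def tensorComplex : CochainComplex (Bor.{u} 𝕜) ℤ where
  X n := { carrier := TensorDual M N n }
  d n m := ⟨tensorδ n m, isBddMap_tensorδ n m⟩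
  shape n m h := Subtype.ext (tensorδ_shape n m h)
  d_comp_d' n m k _ _ := Subtype.ext <| LinearMap.ext fun u => tensorδ_tensorδ n m k u

/-- The natural map `N^• ⊗_B ℒ_B^•(M, B) → ℒ_B^•(M, N)`, `(x ⊗ φ)(m) = x φ(m)`, in degree `n`. -/
noncomputable def nuclear (n : ℤ) : TensorDual M N n →ₗ[𝕜] Cochain M N n where
  toFun u := Cochain.mk fun p q hpq => nuc (M.X p).carrier (N.X q).carrier (u ⟨p, q, hpq⟩)
  map_add' u v := by
    ext p q hpq
    exact map_add (nuc (M.X p).carrier (N.X q).carrier) _ _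
  map_smul' c u := by
    ext p q hpq
    exact map_smul (nuc (M.X p).carrier (N.X q).carrier) _ _

lemma isBddMap_nuclear (n : ℤ) : IsBddMap (nuclear n : TensorDual M N n →ₗ[𝕜] Cochain M N n) := by
  refine isBddMap_pi (Y := fun T : Triplet n => M.X T.p ⟶ N.X T.q) ?_
  rintro ⟨p, q, hpq⟩
  have hv : ∀ T, IsBddMap fun u : TensorDual M N n => u T := fun T => isBddMap_eval T
  exact (isBddMap_nuc (𝕜 := 𝕜) (P := (M.X p).carrier) (N := (N.X q).carrier)).comp (hv ⟨p, q, hpq⟩)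

lemma nuclear_tensorδ (n m : ℤ) (u : TensorDual M N n) :
    nuclear m (tensorδ n m u) = δ n m (nuclear n u) := by
  ext p q hpq
  refine (map_add (nuc (M.X p).carrier (N.X q).carrier) _ _).trans ?_
  refine congrArg₂ (· + ·) ?_ ?_
  · exact nuc_tmap _ _ _
  · rw [Units.smul_def, map_zsmul, Units.smul_def]
    exact congrArg _ (nuc_tmap _ _ _)

variable (M N) in
/-- The natural morphism of complexes `N^• ⊗_B ℒ_B^•(M, B) → ℒ_B^•(M, N)`. -/
noncomputable def nuclearMap : tensorComplex M N ⟶ homComplex M N where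
  f n := ⟨nuclear n, isBddMap_nuclear n⟩
  comm' n m _ := Subtype.ext <| LinearMap.ext fun u => (nuclear_tensorδ n m u).symm

/-- A graded map from `M^•` to `N^•` is nuclear if it is in the image of
`N^• ⊗_B ℒ_B^•(M, B)`. -/
def IsNuclear {n : ℤ} (f : Cochain M N n) : Prop := ∃ u : TensorDual M N n, nuclear n u = f

/-- A graded map is algebraically nuclear if it comes from the algebraic tensor product, that is,
from an element whose components are finite sums of elementary tensors. -/
def IsAlgNuclear {n : ℤ} (f : Cochain M N n) : Prop :=
  ∃ u : TensorDual M N n,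
    (∀ T, u T ∈ Submodule.span 𝕜 {z | ∃ x φ, z = BTensor.tmul 𝕜 B x φ}) ∧ nuclear n u = f

/-- Two graded maps `f`, `g` of degree `0` are homotopic if `f - g = δ(h)` for a graded map `h`
of degree `-1`. -/
def IsHomotopic (f g : Cochain M N 0) : Prop := ∃ h : Cochain M N (-1), f - g = δ (-1) 0 h

end Complexes

end Born

-- The implications are proved in the cycle 1 ⇒ 5 ⇒ 2 ⇒ 3 ⇒ 4 ⇒ 1, and 1 ⇒ 5 is immediate.
--
-- 5 ⇒ 2. For a finitely generated projective module `P` with dual basis `y_j`, `φ_j`, the bounded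
-- map `f ↦ ∑ f(y_j) ⊗ φ_j` inverts `N ⊗_B ℒ_B(P, B) → ℒ_B(P, N)` (`exists_nuc_inverse`). Hence `ν`
-- is an isomorphism for the complex `T` (`isIso_nuclearMap`). Both sides of `ν` are functorial and
-- homotopy invariant in both variables, so this isomorphism transports along `M → T → M` to a
-- homotopy inverse of `ν` for `M` (`exists_homotopyEquiv_nuclearMap`).
--
-- 2 ⇒ 3. Apply the homotopy between `ν ν⁻¹` and the identity to the cocycle `id_M`.
--
-- 3 ⇒ 4. Multiplicative convexity enters here. A nuclear map is a convergent sum `∑ f(p) x_p φ_p`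
-- with `∑ |f(p)| < ∞` and with `(x_p, φ_p)` in a bounded set. Cutting off finitely many terms
-- leaves a tail `R` of small weight. Powers of a tail only involve products of the elements
-- `φ_p(x_q)` of `B`, and these products stay in multiples of one submultiplicative bounded disc. So
-- the powers of `2R` are equibounded, the Neumann series of `1 - R` converges in the complete space
-- `ℒ_B(M, M)`, and `1 - R` is invertible (`exists_finiteRank_add_small`). Degree by degree this
-- gives `1 - R = g + δ(h)` with `g` of finite rank. Multiplication by the inverse `S` of `1 - R` is
-- not a chain map, but `δ(S)` is of finite rank because `δ(1 - R) = δ(g)` is. Thus `id_M` is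
-- homotopic to a graded map of finite rank (`isAlgNuclear_of_isNuclear`).
--
-- 4 ⇒ 1. A finite rank map factors through a finitely generated projective module, so this part is
-- a statement about an additive category with split idempotents and a class `P` of objects that is
-- closed under biproducts and retracts: if `1 - δ(h)` factors through `P` in each degree and the
-- degrees that matter form a finite range, then the complex is homotopy equivalent to a bounded
-- complex in `P` (`isPerfect_of_factorsThru`). The proof is by induction on the length of the
-- range. In the top degree `m`, the map `1 - δ(h)` factors through some `F` in `P`. The map from
-- `F` can be corrected to a chain map `F[-m] → C`, and its mapping cone has the same property with
-- a shorter range. When only one degree is left, `1 - δ(h)` is an idempotent there, and its image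
-- is a retract of an object of `P` to which the complex is homotopy equivalent.

universe v w

set_option linter.unusedSectionVars false

namespace Born

section Triangulated

open Limits Pretriangulated

/-! ### Perfect objects of the homotopy category of an additive category. -/

section Perfect

variable {𝒜 : Type w} [Category.{v} 𝒜] [Preadditive 𝒜] [HasZeroObject 𝒜] [HasBinaryBiproducts 𝒜]
  (P : ObjectProperty 𝒜)

/-- A complex vanishes outside a finite range of degrees. -/
def VanishesOutside (M : CochainComplex 𝒜 ℤ) (a b : ℤ) : Prop :=
  ∀ i, (i < a ∨ b < i) → IsZero (M.X i)

/-- An object of the homotopy category is perfect with respect to `P` if it is isomorphic to a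
complex of objects of `P` that vanishes outside a finite range of degrees. -/
def IsPerfect (K : HomotopyCategory 𝒜 (ComplexShape.up ℤ)) : Prop :=
  ∃ T : CochainComplex 𝒜 ℤ, (∃ a b, VanishesOutside T a b) ∧ (∀ i, P (T.X i)) ∧
    Nonempty (K ≅ (HomotopyCategory.quotient 𝒜 (ComplexShape.up ℤ)).obj T)

variable {P}

lemma IsPerfect.of_iso {K L : HomotopyCategory 𝒜 (ComplexShape.up ℤ)} (e : K ≅ L)
    (hL : IsPerfect P L) : IsPerfect P K := by
  obtain ⟨T, hT, hP, ⟨e'⟩⟩ := hL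
  exact ⟨T, hT, hP, ⟨e ≪≫ e'⟩⟩

lemma IsPerfect.shift {K : HomotopyCategory 𝒜 (ComplexShape.up ℤ)} (hK : IsPerfect P K) (n : ℤ) :
    IsPerfect P (K⟦n⟧) := by
  obtain ⟨T, ⟨a, b, hT⟩, hP, ⟨e⟩⟩ := hK
  exact ⟨T⟦n⟧, ⟨a - n, b - n, fun i hi => hT (i + n) (by omega)⟩, fun i => hP (i + n),
    ⟨(shiftFunctor _ n).mapIso e ≪≫
      (((HomotopyCategory.quotient 𝒜 (ComplexShape.up ℤ)).commShiftIso n).app T).symm⟩⟩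

/-- The quotient functor to the homotopy category is full, so the first morphism of the triangle is
represented by a chain map between the two bounded complexes in `P`. The third object is then the
mapping cone, whose terms are biproducts of objects of `P`. -/
lemma IsPerfect.obj₃ [P.IsClosedUnderIsomorphisms] (hP : ∀ X Y, P X → P Y → P (X ⊞ Y))
    (T : Triangle (HomotopyCategory 𝒜 (ComplexShape.up ℤ))) (hT : T ∈ distTriang _)
    (h₁ : IsPerfect P T.obj₁) (h₂ : IsPerfect P T.obj₂) : IsPerfect P T.obj₃ := by
  obtain ⟨K, ⟨a, b, hK⟩, hPK, ⟨e⟩⟩ := h₁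
  obtain ⟨L, ⟨a', b', hL⟩, hPL, ⟨e'⟩⟩ := h₂
  obtain ⟨φ, hφ⟩ := (HomotopyCategory.quotient 𝒜 (ComplexShape.up ℤ)).map_surjective
    (e.inv ≫ T.mor₁ ≫ e'.hom)
  have hc := HomotopyCategory.mappingCone_triangleh_distinguished φ
  let iso := isoTriangleOfIso₁₂ T _ hT hc e e' (by
    change T.mor₁ ≫ e'.hom = e.hom ≫ (HomotopyCategory.quotient 𝒜 (ComplexShape.up ℤ)).map φ
    rw [hφ, Iso.hom_inv_id_assoc])
  -- The cone has the term `K^{i+1} ⊞ L^i` in degree `i`, hence the bound `a - 1` on the left. On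
  -- the right `b - 1` would do for `K`; `b` is a harmless overestimate.
  refine ⟨CochainComplex.mappingCone φ, ⟨min (a - 1) a', max b b', fun i hi => ?_⟩, fun i => ?_,
    ⟨Triangle.π₃.mapIso iso⟩⟩
  · rw [CochainComplex.mappingCone.isZero_X_iff]
    exact ⟨hK _ (by omega), hL _ (by omega)⟩
  · exact P.prop_of_iso (HomologicalComplex.homotopyCofiber.XIsoBiprod φ i (i + 1) rfl).symm
      (hP _ _ (hPK _) (hPL _))

lemma IsPerfect.obj₂ [P.IsClosedUnderIsomorphisms] (hP : ∀ X Y, P X → P Y → P (X ⊞ Y))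
    (T : Triangle (HomotopyCategory 𝒜 (ComplexShape.up ℤ))) (hT : T ∈ distTriang _)
    (h₁ : IsPerfect P T.obj₁) (h₃ : IsPerfect P T.obj₃) : IsPerfect P T.obj₂ :=
  IsPerfect.obj₃ hP T.invRotate (inv_rot_of_distTriang _ hT) (h₃.shift (-1)) h₁

lemma isPerfect_single [P.IsClosedUnderIsomorphisms] [P.ContainsZero] (X : 𝒜) (hX : P X) (m : ℤ) :
    IsPerfect P ((HomotopyCategory.quotient 𝒜 (ComplexShape.up ℤ)).obj
      ((HomologicalComplex.single 𝒜 (ComplexShape.up ℤ) m).obj X)) := by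
  refine ⟨_, ⟨m, m, fun i hi => ?_⟩, fun i => ?_, ⟨Iso.refl _⟩⟩
  · exact HomologicalComplex.isZero_single_obj_X _ _ _ _ (by omega)
  · by_cases h : i = m
    · subst h
      exact P.prop_of_iso (HomologicalComplex.singleObjXSelf _ i X).symm hX
    · exact P.prop_of_isZero (HomologicalComplex.isZero_single_obj_X _ _ _ _ h)

/-! #### Morphisms that factor through `P` -/

variable (P) in
/-- A morphism factors through an object of `P`. -/
def FactorsThru {X Y : 𝒜} (f : X ⟶ Y) : Prop :=
  ∃ (Z : 𝒜) (_ : P Z) (a : X ⟶ Z) (b : Z ⟶ Y), a ≫ b = f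

lemma FactorsThru.comp_right {X Y Z : 𝒜} {f : X ⟶ Y} (hf : FactorsThru P f) (g : Y ⟶ Z) :
    FactorsThru P (f ≫ g) := by
  obtain ⟨F, hF, a, b, rfl⟩ := hf
  exact ⟨F, hF, a, b ≫ g, by simp⟩

lemma FactorsThru.comp_left {X Y Z : 𝒜} {g : Y ⟶ Z} (hg : FactorsThru P g) (f : X ⟶ Y) :
    FactorsThru P (f ≫ g) := by
  obtain ⟨F, hF, a, b, rfl⟩ := hg
  exact ⟨F, hF, f ≫ a, b, by simp⟩

/-- The middle object is the biproduct of the two. With the two composition lemmas, the morphisms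
that factor through `P` form a two-sided ideal, in which the error terms on mapping cones lie. -/
lemma FactorsThru.add (hP : ∀ X Y, P X → P Y → P (X ⊞ Y)) {X Y : 𝒜} {f g : X ⟶ Y}
    (hf : FactorsThru P f) (hg : FactorsThru P g) : FactorsThru P (f + g) := by
  obtain ⟨F, hF, a, b, rfl⟩ := hf
  obtain ⟨G, hG, c, d, rfl⟩ := hg
  exact ⟨F ⊞ G, hP _ _ hF hG, biprod.lift a c, biprod.desc b d, by simp⟩

lemma factorsThru_zero [P.ContainsZero] (X Y : 𝒜) : FactorsThru P (0 : X ⟶ Y) := by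
  obtain ⟨Z, -, hZ⟩ := ObjectProperty.ContainsZero.exists_zero (P := P)
  exact ⟨Z, hZ, 0, 0, by simp⟩

end Perfect

/-! ### A homotopy on a mapping cone. -/

section Domination

open CochainComplex CochainComplex.HomComplex

variable {𝒜 : Type w} [Category.{v} 𝒜] [Preadditive 𝒜] [HasZeroObject 𝒜] [HasBinaryBiproducts 𝒜]
  {P : ObjectProperty 𝒜}

/-- The homotopy `snd h inr + snd Φ inl` on the mapping cone of `x`. -/
lemma exists_cone_homotopy {X C : CochainComplex 𝒜 ℤ} (x : X ⟶ C) (h : Cochain C C (-1))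
    (Φ : Cochain C X 0) : ∃ (h' : Cochain (mappingCone x) (mappingCone x) (-1))
      (A : Cochain X (mappingCone x) (-1)) (B : Cochain (mappingCone x) X 1),
      Cochain.ofHom (𝟙 _) - δ (-1) 0 h' =
        (mappingCone.snd x).comp ((Cochain.ofHom (𝟙 _) - δ (-1) 0 h -
          Φ.comp (Cochain.ofHom x) (add_zero 0)).comp (Cochain.ofHom (mappingCone.inr x))
            (add_zero 0)) (add_zero 0) +
        (mappingCone.fst x : Cochain _ _ 1).comp A (by norm_num) +
        B.comp (mappingCone.inl x) (by norm_num) := by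
  -- The identity of the cone is `fst inl + snd inr`, and `δ(inl) = x inr`, `δ(snd) = -fst x`
  -- (composition in diagrammatic order). So `snd Φ inl` contributes the correction `-Φ x` to `1 -
  -- δ(h)`. Every other term starts with `fst` or ends with `inl`, hence factors through a term of
  -- `X`; these terms are collected in `A` and `B`.
  refine ⟨(mappingCone.snd x).comp (h.comp (Cochain.ofHom (mappingCone.inr x)) (add_zero _))
      (zero_add _) + (mappingCone.snd x).comp (Φ.comp (mappingCone.inl x) (zero_add _))
      (zero_add _),
      mappingCone.inl x - (Cochain.ofHom x).comp (h.comp (Cochain.ofHom (mappingCone.inr x))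
        (add_zero _)) (zero_add _) -
        (Cochain.ofHom x).comp (Φ.comp (mappingCone.inl x) (zero_add _))
      (zero_add _), (mappingCone.snd x).comp (δ 0 1 Φ) (zero_add _), ?_⟩
  rw [← mappingCone.id x, δ_add, δ_zero_cochain_comp _ _ _ (neg_add_cancel 1),
    δ_zero_cochain_comp _ _ _ (neg_add_cancel 1),
    δ_comp_zero_cochain _ _ _ (neg_add_cancel 1),
    δ_zero_cochain_comp _ _ _ (neg_add_cancel 1), mappingCone.δ_inl, mappingCone.δ_snd,
    δ_ofHom]
  simp [Cochain.sub_comp, Cochain.comp_sub]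
  abel

end Domination

/-! ### Perfectness of complexes whose identity factors through `P` up to homotopy. -/

section Domination

open CochainComplex CochainComplex.HomComplex

variable {𝒜 : Type w} [Category.{v} 𝒜] [Preadditive 𝒜]

/-- The graded map `1 - δ(h)` in degree `p`. -/
def defect {C : CochainComplex 𝒜 ℤ} (h : Cochain C C (-1)) (p : ℤ) : C.X p ⟶ C.X p :=
  (Cochain.ofHom (𝟙 C) - δ (-1) 0 h).v p p (add_zero p)

lemma defect_eq {C : CochainComplex 𝒜 ℤ} (h : Cochain C C (-1)) (p q r : ℤ) (hq : p + (-1) = q)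
    (hr : r + (-1) = p) :
    defect h p = 𝟙 _ - (h.v p q hq ≫ C.d q p + C.d p r ≫ h.v r p hr) := by
  rw [defect, Cochain.sub_v, Cochain.ofHom_v,
    δ_v (-1) 0 (neg_add_cancel 1) h p p (add_zero p) q r (by omega) (by omega)]
  simp

/-- `1 - δ(h)` is a cocycle of degree `0` because `δδ = 0`, that is, a chain map. -/
lemma defect_comm {C : CochainComplex 𝒜 ℤ} (h : Cochain C C (-1)) (p q : ℤ) (hpq : p + 1 = q) :
    defect h p ≫ C.d p q = C.d p q ≫ defect h q := by
  rw [← sub_eq_zero, defect, defect, ← δ_zero_cochain_v _ _ _ hpq, δ_sub, δ_δ, δ_ofHom]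
  simp

variable [HasZeroObject 𝒜] [HasBinaryBiproducts 𝒜] {P : ObjectProperty 𝒜}

/-- A complex whose identity is homotopic to a map concentrated in the lowest degree. -/
lemma isPerfect_of_defect_eq_zero [IsIdempotentComplete 𝒜] [P.IsClosedUnderIsomorphisms]
    [P.ContainsZero] [P.IsStableUnderRetracts] (a : ℤ) (C : CochainComplex 𝒜 ℤ)
    (hC : ∀ i < a, IsZero (C.X i)) (h : Cochain C C (-1)) (hf : FactorsThru P (defect h a))
    (h0 : ∀ i, a < i → defect h i = 0) :
    IsPerfect P ((HomotopyCategory.quotient 𝒜 (ComplexShape.up ℤ)).obj C) := by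
  have hd : defect h a ≫ C.d a (a + 1) = 0 := by
    rw [defect_comm h a _ rfl, h0 _ (by omega), comp_zero]
  -- As `C^{a-1} = 0`, the second factor is `1 - d h`, and the first factor is annihilated by `d`.
  have hidem : defect h a ≫ defect h a = defect h a := by
    nth_rw 2 [defect_eq h a (a - 1) (a + 1) (by omega) (by omega)]
    rw [(hC (a - 1) (by omega)).eq_zero_of_src (C.d (a - 1) a), comp_zero, zero_add,
      Preadditive.comp_sub, reassoc_of% hd, zero_comp, sub_zero]
    exact Category.comp_id _
  obtain ⟨Y, i, e, hie, hei⟩ := IsIdempotentComplete.idempotents_split _ _ hidem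
  -- The image `Y` of the idempotent is a retract of the object `Z` through which the idempotent
  -- factors: `1 = i e = i (u v) e`, where `e i = u v`.
  have hY : P Y := by
    obtain ⟨Z, hZ, u, v, huv⟩ := hf
    refine P.prop_of_retract (X := Y) (Y := Z) ⟨i ≫ u, v ≫ e, ?_⟩ hZ
    have : (i ≫ u) ≫ v ≫ e = i ≫ (u ≫ v) ≫ e := by simp
    rw [this, huv, ← hei]
    simp [hie]
  have hid : i ≫ C.d a (a + 1) = 0 := by
    have : i = i ≫ defect h a := by rw [← hei, ← Category.assoc, hie, Category.id_comp]
    rw [this, Category.assoc, hd, comp_zero]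
  let f : C ⟶ (HomologicalComplex.single 𝒜 (ComplexShape.up ℤ) a).obj Y :=
    HomologicalComplex.mkHomToSingle e fun j hj => by
      have : j < a := by simp only [ComplexShape.up_Rel] at hj; omega
      exact (hC j this).eq_of_src _ _
  let g : (HomologicalComplex.single 𝒜 (ComplexShape.up ℤ) a).obj Y ⟶ C :=
    HomologicalComplex.mkHomFromSingle i fun j hj => by
      obtain rfl : a + 1 = j := hj
      exact hid
  have hgf : g ≫ f = 𝟙 _ := by
    ext
    simp [f, g, reassoc_of% hie]
  have hfg : Homotopy (f ≫ g) (𝟙 C) := by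
    refine (Cochain.equivHomotopy _ _).symm ⟨-h, ?_⟩
    -- The two sides agree in every degree: below `a` the complex vanishes, in degree `a` both are
    -- the idempotent, and above `a` both are zero. So `f g` is equal to `1 - δ(h)`, and `-h` is the
    -- homotopy.
    have : Cochain.ofHom (f ≫ g) = Cochain.ofHom (𝟙 C) - δ (-1) 0 h := by
      ext p
      change _ = defect h p
      rw [Cochain.ofHom_v]
      rcases lt_trichotomy p a with hp | rfl | hp
      · exact (hC p hp).eq_of_src _ _
      · simp [f, g, hei]
      · rw [h0 p hp, HomologicalComplex.comp_f,
          (HomologicalComplex.isZero_single_obj_X _ a Y p (by omega)).eq_zero_of_src (g.f p),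
          comp_zero]
    rw [this, δ_neg]
    abel
  exact (isPerfect_single Y hY a).of_iso
    (HomotopyCategory.isoOfHomotopyEquiv ⟨f, g, hfg, Homotopy.ofEq hgf⟩)

/-- A complex that is bounded below and whose identity is homotopic to a graded map that is bounded
above and factors through objects of `P` in each degree is perfect. -/
theorem isPerfect_of_factorsThru [IsIdempotentComplete 𝒜] [P.IsClosedUnderIsomorphisms]
    [P.ContainsZero] [P.IsStableUnderRetracts] (hP : ∀ X Y, P X → P Y → P (X ⊞ Y)) (k : ℕ) (a : ℤ)
    (C : CochainComplex 𝒜 ℤ) (hC : ∀ i < a, IsZero (C.X i)) (h : Cochain C C (-1))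
    (hf : ∀ i, FactorsThru P (defect h i)) (h0 : ∀ i, a + k < i → defect h i = 0) :
    IsPerfect P ((HomotopyCategory.quotient 𝒜 (ComplexShape.up ℤ)).obj C) := by
  induction k generalizing C with
  | zero => exact isPerfect_of_defect_eq_zero a C hC h (hf a) fun i hi => h0 i (by simpa using hi)
  | succ k ih =>
    obtain ⟨m, hm⟩ : ∃ m : ℤ, m = a + (k + 1 : ℕ) := ⟨_, rfl⟩
    push_cast at hm
    obtain ⟨F, hF, φ, x, hφ⟩ := hf m
    have hm1 : defect h (m + 1) = 0 := h0 _ (by push_cast; omega)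
    -- In degree `m + 1` the identity is `h d + d h`; composition with `d` from the left kills the
    -- second term.
    have hdhd : C.d m (m + 1) ≫ h.v (m + 1) m (by omega) ≫ C.d m (m + 1) = C.d m (m + 1) := by
      have := congrArg (C.d m (m + 1) ≫ ·) (defect_eq h (m + 1) m (m + 2) (by omega) (by omega))
      simp only [hm1, comp_zero, Preadditive.comp_sub, Preadditive.comp_add,
        HomologicalComplex.d_comp_d_assoc, zero_comp, add_zero, Category.comp_id] at this
      exact (sub_eq_zero.1 this.symm).symm
    have hgd : defect h m ≫ C.d m (m + 1) = 0 := by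
      rw [defect_comm h m _ rfl, hm1, comp_zero]
    -- The given `x` need not map `F` to cocycles. Subtracting `x d h` makes it do so, because `d h
    -- d = d`, and it does not change `φ x`, because `φ x d = 0`.
    obtain ⟨y, hy, hyd⟩ : ∃ y : F ⟶ C.X m, φ ≫ y = defect h m ∧ y ≫ C.d m (m + 1) = 0 := by
      refine ⟨x - x ≫ C.d m (m + 1) ≫ h.v (m + 1) m (by omega), ?_, ?_⟩
      · rw [Preadditive.comp_sub, reassoc_of% hφ, reassoc_of% hgd, zero_comp, hφ, sub_zero]
      · simp [Preadditive.sub_comp, hdhd]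
    let X := (HomologicalComplex.single 𝒜 (ComplexShape.up ℤ) m).obj F
    have hX : ∀ i, i ≠ m → IsZero (X.X i) := fun i hi =>
      HomologicalComplex.isZero_single_obj_X _ _ _ _ hi
    have hXP : ∀ i, P (X.X i) := fun i => by
      by_cases hi : i = m
      · subst hi
        exact P.prop_of_iso (HomologicalComplex.singleObjXSelf _ i F).symm hF
      · exact P.prop_of_isZero (hX i hi)
    let y' : X ⟶ C := HomologicalComplex.mkHomFromSingle y fun j hj => by
      obtain rfl : m + 1 = j := hj
      exact hyd
    -- `Φ` is `φ` in degree `m` and zero elsewhere, so that `Φ y'` is the part of degree `m` of `1 -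
    -- δ(h)`. It is a graded map, not a chain map in general.
    let Φ : Cochain C X 0 := Cochain.single (p := m) (q := m)
      (φ ≫ (HomologicalComplex.singleObjXSelf (ComplexShape.up ℤ) m F).inv) 0
    have hΦm : (Φ.comp (Cochain.ofHom y') (add_zero 0)).v m m (add_zero m) = defect h m := by
      simp [Φ, y', hy]
    have hΦ : ∀ i, i ≠ m → (Φ.comp (Cochain.ofHom y') (add_zero 0)).v i i (add_zero i) = 0 := by
      intro i hi
      simp [Φ, Cochain.single_v_eq_zero _ _ _ _ _ hi]
    obtain ⟨h', A, A', hA⟩ := exists_cone_homotopy y' h Φ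
    have hdef : ∀ i, defect h' i = (mappingCone.snd y').v i i (add_zero i) ≫
        (defect h i - (Φ.comp (Cochain.ofHom y') (add_zero 0)).v i i (add_zero i)) ≫
          (mappingCone.inr y').f i +
        (mappingCone.fst y').1.v i (i + 1) rfl ≫ A.v (i + 1) i (by omega) +
        A'.v i (i + 1) rfl ≫ (mappingCone.inl y').v (i + 1) i (by omega) := by
      intro i
      have := Cochain.congr_v hA i i (add_zero i)
      rw [Cochain.add_v, Cochain.add_v, Cochain.comp_v _ _ _ i (i + 1) i rfl (by omega),
        Cochain.comp_v _ _ _ i (i + 1) i rfl (by omega)] at this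
      rw [defect, this, Cochain.zero_cochain_comp_v, Cochain.zero_cochain_comp_v,
        Cochain.ofHom_v]
      rfl
    -- `C` is the middle term of the triangle formed by `X = F[-m]`, `C` and the cone; the induction
    -- hypothesis is applied to the cone.
    refine IsPerfect.obj₂ hP _ (HomotopyCategory.mappingCone_triangleh_distinguished y')
      (isPerfect_single F hF m)
      (ih (mappingCone y') (fun i hi => ?_) h' (fun i => ?_) fun i hi => ?_)
    · rw [mappingCone.isZero_X_iff]
      -- `F` sits in degree `m - 1 = a + k` of the cone. As `a ≤ m - 1`, the lower bound `a` is
      -- preserved.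
      exact ⟨hX _ (by omega), hC i hi⟩
    · rw [hdef]
      refine ((FactorsThru.add hP ?_ ?_).add hP ?_)
      · refine (FactorsThru.comp_right ?_ _).comp_left _
        by_cases hi : i = m
        · subst hi
          rw [hΦm, sub_self]
          exact factorsThru_zero _ _
        · rw [hΦ i hi, sub_zero]
          exact hf i
      · exact ⟨_, hXP (i + 1), _, _, rfl⟩
      · exact ⟨_, hXP (i + 1), _, _, rfl⟩
    -- For `i > a + k`, that is `i ≥ m`, the object `X^{i+1}` is zero, so both error terms vanish.
    -- What is left is the main term: it is cancelled by `Φ y'` for `i = m`, and it is zero by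
    -- assumption for `i > m`.
    · rw [hdef, (hX (i + 1) (by omega)).eq_zero_of_src (A.v _ _ _),
        (hX (i + 1) (by omega)).eq_zero_of_src ((mappingCone.inl y').v _ _ _)]
      have : defect h i - (Φ.comp (Cochain.ofHom y') (add_zero 0)).v i i (add_zero i) = 0 := by
        by_cases hi : i = m
        · subst hi
          rw [hΦm, sub_self]
        · rw [hΦ i hi, sub_zero, h0 i (by push_cast; omega)]
      rw [this]
      simp

end Domination

end Triangulated

/-! ### Products of complete bornological vector spaces and of modules. -/

section Products

variable {𝕜 V W : Type*} [RCLike 𝕜] [AddCommGroup V] [Module 𝕜 V] [Bornology V]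
  [AddCommGroup W] [Module 𝕜 W] [Bornology W]

lemma isBddMap_fst : IsBddMap (Prod.fst : V × W → V) := fun _ hS =>
  (isBounded_image_fst_and_snd.2 hS).1

lemma isBddMap_snd : IsBddMap (Prod.snd : V × W → W) := fun _ hS =>
  (isBounded_image_fst_and_snd.2 hS).2

lemma IsBddMap.prodMk {U : Type*} [Bornology U] {f : U → V} {g : U → W} (hf : IsBddMap f)
    (hg : IsBddMap g) : IsBddMap fun x => (f x, g x) := fun S hS =>
  isBounded_image_fst_and_snd.1 ⟨by rw [Set.image_image]; exact hf S hS,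
    by rw [Set.image_image]; exact hg S hS⟩

lemma IsBddMap.congr {f g : V → W} (hf : IsBddMap f) (h : ∀ x, f x = g x) : IsBddMap g := by
  rwa [← funext h]

lemma mem_smul_prod {c : 𝕜} {D : Set V} {E : Set W} {x : V × W} :
    x ∈ c • (D ×ˢ E) ↔ x.1 ∈ c • D ∧ x.2 ∈ c • E := by
  constructor
  · rintro ⟨y, hy, rfl⟩
    exact ⟨⟨y.1, hy.1, rfl⟩, ⟨y.2, hy.2, rfl⟩⟩
  · rintro ⟨⟨d, hd, hd'⟩, ⟨e, he, he'⟩⟩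
    exact ⟨(d, e), ⟨hd, he⟩, Prod.ext hd' he'⟩

/-- The gauge of `D ×ˢ E` is the maximum of the two gauges, so everything can be checked in each
coordinate. -/
lemma IsCompletant.prod {D : Set V} {E : Set W} (hD : IsCompletant 𝕜 D) (hE : IsCompletant 𝕜 E) :
    IsCompletant 𝕜 (D ×ˢ E) where
  nonempty := hD.nonempty.prod hE.nonempty
  circled c hc x hx := ⟨hD.circled c hc _ hx.1, hE.circled c hc _ hx.2⟩
  convex x hx y hy t h0 h1 :=
    ⟨hD.convex _ hx.1 _ hy.1 t h0 h1, hE.convex _ hx.2 _ hy.2 t h0 h1⟩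
  norming x hx := Prod.ext (hD.norming _ fun ε hε => (mem_smul_prod.1 (hx ε hε)).1)
    (hE.norming _ fun ε hε => (mem_smul_prod.1 (hx ε hε)).2)
  complete u hu := by
    obtain ⟨x, hx⟩ := hD.complete (fun n => (u n).1) fun ε hε => by
      obtain ⟨N, hN⟩ := hu ε hε
      exact ⟨N, fun m n hm hn => (mem_smul_prod.1 (hN m n hm hn)).1⟩
    obtain ⟨y, hy⟩ := hE.complete (fun n => (u n).2) fun ε hε => by
      obtain ⟨N, hN⟩ := hu ε hε
      exact ⟨N, fun m n hm hn => (mem_smul_prod.1 (hN m n hm hn)).2⟩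
    refine ⟨(x, y), fun ε hε => ?_⟩
    obtain ⟨N, hN⟩ := hx ε hε
    obtain ⟨K, hK⟩ := hy ε hε
    exact ⟨max N K, fun n hn => mem_smul_prod.2 ⟨hN n ((le_max_left _ _).trans hn),
      hK n ((le_max_right _ _).trans hn)⟩⟩

instance Prod.instCompleteBorn [CompleteBorn 𝕜 V] [CompleteBorn 𝕜 W] :
    CompleteBorn 𝕜 (V × W) where
  isBounded_add {S T} hS hT := by
    have h := BornVec.isBounded_add (𝕜 := 𝕜) (isBddMap_fst S hS) (isBddMap_fst T hT)
    have h' := BornVec.isBounded_add (𝕜 := 𝕜) (isBddMap_snd S hS) (isBddMap_snd T hT)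
    refine (h.prod h').subset ?_
    rintro _ ⟨x, hx, y, hy, rfl⟩
    exact ⟨⟨_, ⟨x, hx, rfl⟩, _, ⟨y, hy, rfl⟩, rfl⟩, ⟨_, ⟨x, hx, rfl⟩, _, ⟨y, hy, rfl⟩, rfl⟩⟩
  isBounded_smul c {S} hS := by
    have h := BornVec.isBounded_smul c (isBddMap_fst S hS)
    have h' := BornVec.isBounded_smul c (isBddMap_snd S hS)
    refine (h.prod h').subset ?_
    rintro _ ⟨x, hx, rfl⟩
    exact ⟨⟨_, ⟨x, hx, rfl⟩, rfl⟩, ⟨_, ⟨x, hx, rfl⟩, rfl⟩⟩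
  exists_completant S hS := by
    obtain ⟨D, hD, hDb, hDc⟩ := CompleteBorn.exists_completant (𝕜 := 𝕜) _ (isBddMap_fst S hS)
    obtain ⟨E, hE, hEb, hEc⟩ := CompleteBorn.exists_completant (𝕜 := 𝕜) _ (isBddMap_snd S hS)
    exact ⟨D ×ˢ E, fun x hx => ⟨hD ⟨x, hx, rfl⟩, hE ⟨x, hx, rfl⟩⟩, hDb.prod hEb, hDc.prod hEc⟩

end Products

section Modules

variable {𝕜 B : Type*} [RCLike 𝕜] [Ring B] [Algebra 𝕜 B] [Bornology B] [BornAlg 𝕜 B]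

instance Prod.instBornMod {M N : Type*} [AddCommGroup M] [Module 𝕜 M] [Module Bᵐᵒᵖ M] [Bornology M]
    [AddCommGroup N] [Module 𝕜 N] [Module Bᵐᵒᵖ N] [Bornology N] [BornMod 𝕜 B M] [BornMod 𝕜 B N] :
    BornMod 𝕜 B (M × N) where
  isBounded_act {S T} hS hT := by
    refine ((BornMod.isBounded_act (𝕜 := 𝕜) (isBddMap_fst S hS) hT).prod
      (BornMod.isBounded_act (𝕜 := 𝕜) (isBddMap_snd S hS) hT)).subset ?_
    rintro _ ⟨x, hx, b, hb, rfl⟩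
    exact ⟨⟨_, ⟨x, hx, rfl⟩, b, hb, rfl⟩, ⟨_, ⟨x, hx, rfl⟩, b, hb, rfl⟩⟩

instance PUnit.instBornMod : BornMod 𝕜 B PUnit where
  isBounded_add _ _ := (Set.toFinite _).isBounded
  isBounded_smul _ _ _ := (Set.toFinite _).isBounded
  exists_completant _ _ := ⟨univ, subset_univ _, (Set.toFinite _).isBounded,
    ⟨⟨univ_nonempty, fun _ _ _ _ => trivial, fun _ _ _ _ _ _ _ => trivial⟩, fun _ _ => rfl,
      fun _ _ => ⟨0, fun _ _ => ⟨0, fun _ _ => ⟨0, trivial, rfl⟩⟩⟩⟩⟩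
  isBounded_act _ _ := (Set.toFinite _).isBounded

end Modules

/-! ### The module of fixed points of an endomorphism. -/

section KernelComplement

variable {𝕜 B M : Type*} [RCLike 𝕜] [Ring B] [Algebra 𝕜 B] [Bornology B] [BornAlg 𝕜 B]
  [AddCommGroup M] [Module 𝕜 M] [Module Bᵐᵒᵖ M] [IsScalarTower 𝕜 Bᵐᵒᵖ M] [Bornology M]
  [BornMod 𝕜 B M]

/-- The fixed points of a bounded `B`-linear map `e`. -/
def fixedPoints (e : BHom 𝕜 B M M) : Submodule Bᵐᵒᵖ M := LinearMap.eqLocus e.1 LinearMap.id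

instance (e : BHom 𝕜 B M M) : Module 𝕜 (fixedPoints e) :=
  inferInstanceAs (Module 𝕜 ((fixedPoints e).restrictScalars 𝕜))

instance (e : BHom 𝕜 B M M) : IsScalarTower 𝕜 Bᵐᵒᵖ (fixedPoints e) where
  smul_assoc c b x := Subtype.ext (smul_assoc c b x.1)

instance (e : BHom 𝕜 B M M) : Bornology (fixedPoints e) := inferInstanceAs (Bornology {_x // _})

lemma isBounded_fixedPoints {e : BHom 𝕜 B M M} {S : Set (fixedPoints e)} :
    IsBounded S ↔ IsBounded (Subtype.val '' S) := isBounded_image_subtype_val.symm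

instance (e : BHom 𝕜 B M M) : BornMod 𝕜 B (fixedPoints e) where
  isBounded_add {S T} hS hT := by
    rw [isBounded_fixedPoints] at *
    refine (BornVec.isBounded_add (𝕜 := 𝕜) hS hT).subset ?_
    rintro _ ⟨_, ⟨x, hx, y, hy, rfl⟩, rfl⟩
    exact ⟨_, ⟨x, hx, rfl⟩, _, ⟨y, hy, rfl⟩, rfl⟩
  isBounded_smul c {S} hS := by
    rw [isBounded_fixedPoints] at *
    refine (BornVec.isBounded_smul c hS).subset ?_
    rintro _ ⟨_, ⟨x, hx, rfl⟩, rfl⟩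
    exact ⟨_, ⟨x, hx, rfl⟩, rfl⟩
  isBounded_act {S T} hS hT := by
    rw [isBounded_fixedPoints] at *
    refine (BornMod.isBounded_act (𝕜 := 𝕜) hS hT).subset ?_
    rintro _ ⟨_, ⟨x, hx, b, hb, rfl⟩, rfl⟩
    exact ⟨_, ⟨x, hx, rfl⟩, b, hb, rfl⟩
  exists_completant S hS := by
    rw [isBounded_fixedPoints] at hS
    obtain ⟨D, hD, hb, hc⟩ := CompleteBorn.exists_completant (𝕜 := 𝕜) _ hS
    have hsm : ∀ {ε : ℝ}, 0 < ε → ∀ {x : fixedPoints e},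
        x ∈ (ε : 𝕜) • (Subtype.val ⁻¹' D : Set (fixedPoints e)) ↔ x.1 ∈ (ε : 𝕜) • D := by
      intro ε hε x
      have hε' : (ε : 𝕜) ≠ 0 := by exact_mod_cast hε.ne'
      rw [Set.mem_smul_set_iff_inv_smul_mem₀ hε', Set.mem_smul_set_iff_inv_smul_mem₀ hε']
      rfl
    refine ⟨Subtype.val ⁻¹' D, fun _ hx => hD ⟨_, hx, rfl⟩,
      isBounded_fixedPoints.2 (hb.subset (Set.image_preimage_subset _ _)),
      ⟨⟨⟨0, hc.zero_mem⟩, fun c h _ hx => hc.circled c h _ hx,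
        fun x hx y hy t h0 h1 => hc.convex _ hx _ hy t h0 h1⟩, fun x hx => ?_, fun u hu => ?_⟩⟩
    · exact Subtype.ext (hc.norming _ fun ε hε => (hsm hε).1 (hx ε hε))
    · obtain ⟨x, hx⟩ := hc.complete (fun n => (u n).1) fun ε hε => by
        obtain ⟨N, hN⟩ := hu ε hε
        exact ⟨N, fun m n hm hn => (hsm hε).1 (hN m n hm hn)⟩
      -- The fixed points are the kernel of the bounded map `e - 1`, hence closed; so the limit in
      -- `M` of a sequence of fixed points is a fixed point.
      have hclosed : IsBornClosed 𝕜 (LinearMap.ker ((e - BHom.id 𝕜 B M).1.restrictScalars 𝕜) :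
          Set M) := isBornClosed_ker _ (e - BHom.id 𝕜 B M).2
      have hxe : e.1 x = x := sub_eq_zero.1 <| hclosed (fun n => (u n).1) x
        (fun n => sub_eq_zero.2 (u n).2) ⟨D, hb, hx⟩
      refine ⟨⟨x, hxe⟩, fun ε hε => ?_⟩
      obtain ⟨N, hN⟩ := hx ε hε
      exact ⟨N, fun n hn => (hsm hε).2 (hN n hn)⟩

end KernelComplement

/-! ### Biproducts, split idempotents and finitely generated projective objects in `Mod(B)`. -/

section Category

variable {𝕜 : Type} {B : Type u} [RCLike 𝕜] [Ring B] [Algebra 𝕜 B] [Bornology B] [BornAlg 𝕜 B]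

open Limits

lemma BMod.isZero_iff (M : BMod 𝕜 B) : IsZero M ↔ Subsingleton M.carrier := by
  rw [IsZero.iff_id_eq_zero]
  constructor
  · intro h
    refine subsingleton_of_forall_eq 0 fun x => ?_
    exact LinearMap.congr_fun (congrArg Subtype.val h) x
  · intro h
    exact Subtype.ext (LinearMap.ext fun x => Subsingleton.elim _ _)

instance : HasZeroObject (BMod 𝕜 B) :=
  ⟨⟨{ carrier := PUnit }, (BMod.isZero_iff _).2 inferInstance⟩⟩

/-- The product of two bornological modules. -/
def BMod.prod (M N : BMod 𝕜 B) : BMod 𝕜 B where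
  carrier := M.carrier × N.carrier

/-- The product of two bornological modules is a biproduct. -/
def BMod.prodBicone (M N : BMod 𝕜 B) : BinaryBicone M N where
  pt := BMod.prod M N
  fst := ⟨LinearMap.fst _ _ _, isBddMap_fst⟩
  snd := ⟨LinearMap.snd _ _ _, isBddMap_snd⟩
  inl := ⟨LinearMap.inl _ _ _, IsBddMap.prodMk (fun S hS => by simpa using hS) isBddMap_zero⟩
  inr := ⟨LinearMap.inr _ _ _, IsBddMap.prodMk isBddMap_zero (fun S hS => by simpa using hS)⟩

lemma BMod.prodBicone_total (M N : BMod 𝕜 B) :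
    (BMod.prodBicone M N).fst ≫ (BMod.prodBicone M N).inl +
      (BMod.prodBicone M N).snd ≫ (BMod.prodBicone M N).inr = 𝟙 _ :=
  Subtype.ext <| LinearMap.ext fun x => Prod.ext (add_zero x.1) (zero_add x.2)

instance : HasBinaryBiproducts (BMod 𝕜 B) where
  has_binary_biproduct M N := hasBinaryBiproduct_of_total _ (BMod.prodBicone_total M N)

/-- The image of a bounded idempotent is its module of fixed points, which is complete for the
subspace bornology. Corestriction of the idempotent and inclusion are the two halves of the
splitting. -/
instance : IsIdempotentComplete (BMod 𝕜 B) where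
  idempotents_split M e he := by
    have he' : ∀ x, e.1 (e.1 x) = e.1 x := fun x => LinearMap.congr_fun (congrArg Subtype.val he) x
    refine ⟨{ carrier := fixedPoints (show BHom 𝕜 B M.carrier M.carrier from e) },
      ⟨(fixedPoints _).subtype, fun S hS => isBounded_fixedPoints.1 hS⟩,
      ⟨LinearMap.codRestrict _ e.1 he', fun S hS => isBounded_fixedPoints.2 ?_⟩, ?_, rfl⟩
    · rw [Set.image_image]
      exact e.2 S hS
    · exact Subtype.ext <| LinearMap.ext fun x => Subtype.ext x.2

variable (𝕜 B) in
/-- The finitely generated projective bornological modules. -/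
def fgProjective : ObjectProperty (BMod 𝕜 B) := IsFGProjective

instance : (fgProjective 𝕜 B).IsStableUnderRetracts where
  of_retract := by
    rintro M N r ⟨n, i, p, hi, hp, hpi⟩
    refine ⟨n, i ∘ₗ r.i.1, r.r.1 ∘ₗ p, hi.comp r.i.2,
      IsBddMap.comp (g := r.r.1) r.r.2 hp, ?_⟩
    refine LinearMap.ext fun x => ?_
    have h1 : p (i (r.i.1 x)) = r.i.1 x := LinearMap.congr_fun hpi _
    have h2 : r.r.1 (r.i.1 x) = x := LinearMap.congr_fun (congrArg Subtype.val r.retract) x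
    simpa [h1] using h2

instance : (fgProjective 𝕜 B).IsClosedUnderIsomorphisms where
  of_iso e h := ObjectProperty.prop_of_retract (P := fgProjective 𝕜 B) (Retract.ofIso e.symm) h

instance : (fgProjective 𝕜 B).ContainsZero where
  exists_zero := ⟨{ carrier := PUnit }, (BMod.isZero_iff _).2 inferInstance, 0, 0, 0,
    isBddMap_zero, isBddMap_zero, LinearMap.ext fun _ => rfl⟩

lemma fgProjective_prod (M N : BMod 𝕜 B) (hM : fgProjective 𝕜 B M) (hN : fgProjective 𝕜 B N) :
    fgProjective 𝕜 B (BMod.prod M N) := by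
  obtain ⟨m, i, p, hi, hp, hpi⟩ := hM
  obtain ⟨n, j, q, hj, hq, hqj⟩ := hN
  let s : (Fin (m + n) → B) ≃ₗ[Bᵐᵒᵖ] (Fin m → B) × (Fin n → B) :=
    (LinearEquiv.funCongrLeft Bᵐᵒᵖ B finSumFinEquiv).trans
      (LinearEquiv.sumArrowLequivProdArrow (Fin m) (Fin n) Bᵐᵒᵖ B)
  refine ⟨m + n, s.symm.toLinearMap ∘ₗ (i.prodMap j), (p.prodMap q) ∘ₗ s.toLinearMap, ?_, ?_, ?_⟩
  · refine isBddMap_pi fun k => ?_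
    refine Fin.addCases (fun k => ?_) (fun k => ?_) k
    · refine ((isBddMap_eval (Y := fun _ : Fin m => B) k).comp (hi.comp (isBddMap_fst
        (V := M.carrier) (W := N.carrier)))).congr fun x => ?_
      change _ = s.symm (i x.1, j x.2) (Fin.castAdd n k)
      simp [s]
    · refine ((isBddMap_eval (Y := fun _ : Fin n => B) k).comp (hj.comp (isBddMap_snd
        (V := M.carrier) (W := N.carrier)))).congr fun x => ?_
      change _ = s.symm (i x.1, j x.2) (Fin.natAdd m k)
      simp [s]
  · refine IsBddMap.prodMk (hp.comp (isBddMap_pi fun k => ?_)) (hq.comp (isBddMap_pi fun k => ?_))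
    · exact isBddMap_eval (Y := fun _ : Fin (m + n) => B) _
    · exact isBddMap_eval (Y := fun _ : Fin (m + n) => B) _
  · refine LinearMap.ext fun x => ?_
    have h1 : p (i x.1) = x.1 := LinearMap.congr_fun hpi _
    have h2 : q (j x.2) = x.2 := LinearMap.congr_fun hqj _
    change (p (s (s.symm (i x.1, j x.2))).1, q (s (s.symm (i x.1, j x.2))).2) = x
    rw [s.apply_symm_apply]
    exact Prod.ext h1 h2

lemma fgProjective_biprod (M N : BMod 𝕜 B) (hM : fgProjective 𝕜 B M) (hN : fgProjective 𝕜 B N) :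
    fgProjective 𝕜 B (M ⊞ N) :=
  (fgProjective 𝕜 B).prop_of_iso
    (biprod.uniqueUpToIso _ _ (isBinaryBilimitOfTotal _ (BMod.prodBicone_total M N)))
    (fgProjective_prod M N hM hN)

lemma fgProjective_self : fgProjective 𝕜 B { carrier := B } := by
  refine ⟨1, LinearMap.pi fun _ => LinearMap.id, LinearMap.proj 0, ?_, ?_, rfl⟩
  · exact isBddMap_pi fun _ => fun S hS => by simpa using hS
  · exact isBddMap_eval (Y := fun _ : Fin 1 => B) 0

end Category

/-! ### Convergent sums and completant discs. -/

section Sums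

variable {𝕜 V W : Type*} [RCLike 𝕜] [AddCommGroup V] [Module 𝕜 V] [Bornology V]
  [AddCommGroup W] [Module 𝕜 W] [Bornology W]

lemma TendstoBorn.map {u : ℕ → V} {x : V} (h : TendstoBorn 𝕜 u x) (T : V →ₗ[𝕜] W)
    (hT : IsBddMap T) : TendstoBorn 𝕜 (fun n => T (u n)) (T x) := by
  obtain ⟨S, hS, h⟩ := h
  refine ⟨T '' S, hT S hS, fun ε hε => ?_⟩
  obtain ⟨N, hN⟩ := h ε hε
  refine ⟨N, fun n hn => ?_⟩
  obtain ⟨d, hd, he⟩ := hN n hn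
  exact ⟨T d, ⟨d, hd, rfl⟩, by simpa using congrArg T he⟩

/-- The sum of a family `f i • g i` with `∑ ‖f i‖ < C` and `g i` in a completant disc `D` lies in
`C • D`. -/
lemma HasBornSum.mem_smul [CompleteBorn 𝕜 V] {ι : Type*} {D : Set V} (h : IsCompletant 𝕜 D)
    (hb : IsBounded D) {f : ι → 𝕜} {g : ι → V} (hg : ∀ i, f i ≠ 0 → g i ∈ D)
    (hf : Summable fun i => ‖f i‖) {C : ℝ} (hC : ∑' i, ‖f i‖ < C) {x : V}
    (hx : HasBornSum 𝕜 (fun i => f i • g i) x) : x ∈ (C : 𝕜) • D := by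
  obtain ⟨y, hy⟩ := exists_hasGaugeSum h f hf g hg
  -- The sum `x` may be given for the gauge of another disc; by uniqueness it is also the sum for
  -- the gauge of `D`.
  obtain rfl : x = y := hx.unique ⟨D, hb, h.toIsDisc, hy⟩
  -- The gap between `∑ ‖f i‖` and `C` absorbs the difference between `x` and a finite partial sum.
  -- This is the reason for a strict inequality.
  obtain ⟨s, hs⟩ := hy (C - ∑' i, ‖f i‖) (sub_pos.2 hC)
  have h0 : 0 ≤ ∑ i ∈ s, ‖f i‖ := Finset.sum_nonneg fun _ _ => norm_nonneg _
  have hle : ∑ i ∈ s, ‖f i‖ ≤ ∑' i, ‖f i‖ := hf.sum_le_tsum s fun _ _ => norm_nonneg _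
  have := h.add_mem (h0.trans hle) (sub_pos.2 hC).le
    (h.smul_mono h0 hle (h.sum_mem s f g fun i _ => hg i)) (hs s subset_rfl)
  simpa using this

end Sums

/-! ### Composition and evaluation as bounded linear maps. -/

section Composition

variable {𝕜 B P P' N N' : Type*} [RCLike 𝕜] [Ring B] [Algebra 𝕜 B] [Bornology B] [BornAlg 𝕜 B]
  [AddCommGroup P] [Module 𝕜 P] [Module Bᵐᵒᵖ P] [IsScalarTower 𝕜 Bᵐᵒᵖ P] [Bornology P]
  [BornMod 𝕜 B P]
  [AddCommGroup P'] [Module 𝕜 P'] [Module Bᵐᵒᵖ P'] [IsScalarTower 𝕜 Bᵐᵒᵖ P'] [Bornology P']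
  [BornMod 𝕜 B P']
  [AddCommGroup N] [Module 𝕜 N] [Module Bᵐᵒᵖ N] [IsScalarTower 𝕜 Bᵐᵒᵖ N] [Bornology N]
  [BornMod 𝕜 B N]
  [AddCommGroup N'] [Module 𝕜 N'] [Module Bᵐᵒᵖ N'] [IsScalarTower 𝕜 Bᵐᵒᵖ N'] [Bornology N']
  [BornMod 𝕜 B N']

/-- Composition with `f`, as a linear map. -/
def BHom.postcomp (f : BHom 𝕜 B N N') : BHom 𝕜 B P N →ₗ[𝕜] BHom 𝕜 B P N' where
  toFun φ := BHom.comp f φ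
  map_add' _ _ := Subtype.ext <| LinearMap.ext fun _ => map_add f.1 _ _
  map_smul' c _ := Subtype.ext <| LinearMap.ext fun _ => (f.1.restrictScalars 𝕜).map_smul c _

/-- Composition with `g`, as a linear map. -/
def BHom.precomp (g : BHom 𝕜 B P P') : BHom 𝕜 B P' N →ₗ[𝕜] BHom 𝕜 B P N where
  toFun φ := BHom.comp φ g
  map_add' _ _ := rfl
  map_smul' _ _ := rfl

/-- Evaluation at `x`, as a linear map. -/
def BHom.eval (x : P) : BHom 𝕜 B P N →ₗ[𝕜] N where
  toFun φ := φ.1 x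
  map_add' _ _ := rfl
  map_smul' _ _ := rfl

lemma BHom.isBddMap_eval (x : P) : IsBddMap (BHom.eval x : BHom 𝕜 B P N →ₗ[𝕜] N) := fun H hH => by
  have := BHom.isBounded_iff.1 hH {x} isBounded_singleton
  rwa [Set.image2_singleton_right] at this

end Composition

/-! ### Nuclear endomorphisms and the Neumann series. -/

section Neumann

variable {𝕜 B M : Type*} [RCLike 𝕜] [Ring B] [Algebra 𝕜 B] [Bornology B] [BornAlg 𝕜 B]
  [AddCommGroup M] [Module 𝕜 M] [Module Bᵐᵒᵖ M] [IsScalarTower 𝕜 Bᵐᵒᵖ M] [Bornology M]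
  [BornMod 𝕜 B M]

/-- If the powers of `Q` are equibounded, then `1 - Q / 2` is invertible: the Neumann series
converges. -/
lemma exists_inverse_of_equibounded (Q : BHom 𝕜 B M M)
    (hQ : ∀ U : Set M, IsBounded U → ∃ V : Set M, IsBounded V ∧ ∀ (n : ℕ), ∀ x ∈ U,
      (Q.1 ^ n) x ∈ V) :
    ∃ S : BHom 𝕜 B M M,
      BHom.comp S (BHom.id 𝕜 B M - ((2⁻¹ : ℝ) : 𝕜) • Q) = BHom.id 𝕜 B M ∧
      BHom.comp (BHom.id 𝕜 B M - ((2⁻¹ : ℝ) : 𝕜) • Q) S = BHom.id 𝕜 B M := by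
  let q : ℕ → BHom 𝕜 B M M := fun n => ⟨Q.1 ^ n, fun U hU => by
    obtain ⟨V, hV, h⟩ := hQ U hU
    exact hV.subset (by rintro _ ⟨x, hx, rfl⟩; exact h n x hx)⟩
  have hq : IsBounded (range q) := BHom.isBounded_iff.2 fun U hU => by
    obtain ⟨V, hV, h⟩ := hQ U hU
    exact hV.subset (by rintro _ ⟨_, ⟨n, rfl⟩, x, hx, rfl⟩; exact h n x hx)
  -- Completeness of `ℒ_B(M, M)` puts all the powers of `Q` in one completant disc `E`. The series
  -- `∑ 2⁻ⁱ Qⁱ` converges for its gauge.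
  obtain ⟨E, hE, hb, hc⟩ := CompleteBorn.exists_completant (𝕜 := 𝕜) _ hq
  obtain ⟨S, hS⟩ := hc.series q fun n => hE ⟨n, rfl⟩
  have hS' : TendstoBorn 𝕜 (fun n => ∑ i ∈ Finset.range n, ((2⁻¹ ^ i : ℝ) : 𝕜) • q i) S :=
    ⟨E, hb, hS⟩
  set R : BHom 𝕜 B M M := BHom.id 𝕜 B M - ((2⁻¹ : ℝ) : 𝕜) • Q with hR
  have hlim : TendstoBorn 𝕜 (fun n => BHom.id 𝕜 B M - ((2⁻¹ ^ n : ℝ) : 𝕜) • q n)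
      (BHom.id 𝕜 B M) := by
    refine ⟨E, hb, fun ε hε => ?_⟩
    obtain ⟨N, hN⟩ := exists_pow_lt_of_lt_one hε (by norm_num : (2⁻¹ : ℝ) < 1)
    refine ⟨N, fun n hn => ?_⟩
    rw [sub_sub_cancel_left]
    refine hc.neg_mem hε.le (hc.mono ?_ (hE ⟨n, rfl⟩))
    rw [RCLike.norm_ofReal, abs_of_pos (by positivity)]
    exact (pow_le_pow_of_le_one (by norm_num) (by norm_num) hn).trans hN.le
  have hpow : ∀ n : ℕ, (((2⁻¹ : ℝ) ^ (n + 1) : ℝ) : 𝕜) = ((2⁻¹ ^ n : ℝ) : 𝕜) * ((2⁻¹ : ℝ) : 𝕜) :=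
    fun n => by rw [pow_succ, RCLike.ofReal_mul]
  -- The partial sums telescope to `1 - 2⁻ⁿ Qⁿ` on either side of `R`, and the remainder tends to
  -- zero because the powers of `Q` stay in `E`. As composition with `R` is bounded, it commutes
  -- with the limit.
  have hleft : ∀ n, BHom.precomp R (∑ i ∈ Finset.range n, ((2⁻¹ ^ i : ℝ) : 𝕜) • q i) =
      BHom.id 𝕜 B M - ((2⁻¹ ^ n : ℝ) : 𝕜) • q n := fun n => by
    have hstep : ∀ i, BHom.precomp R (q i) = q i - ((2⁻¹ : ℝ) : 𝕜) • q (i + 1) := fun i =>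
      Subtype.ext <| LinearMap.ext fun x => by
        change (Q.1 ^ i) (x - ((2⁻¹ : ℝ) : 𝕜) • Q.1 x) =
          (Q.1 ^ i) x - ((2⁻¹ : ℝ) : 𝕜) • (Q.1 ^ (i + 1)) x
        rw [map_sub, pow_succ, Module.End.mul_apply]
        exact congrArg _ (((Q.1 ^ i).restrictScalars 𝕜).map_smul _ _)
    induction n with
    | zero =>
      rw [Finset.sum_range_zero, map_zero, pow_zero, RCLike.ofReal_one, one_smul]
      exact (sub_self _).symm
    | succ n ih =>
      rw [Finset.sum_range_succ, map_add, ih, map_smul, hstep, hpow, mul_smul, smul_sub]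
      abel
  have hright : ∀ n, BHom.postcomp R (∑ i ∈ Finset.range n, ((2⁻¹ ^ i : ℝ) : 𝕜) • q i) =
      BHom.id 𝕜 B M - ((2⁻¹ ^ n : ℝ) : 𝕜) • q n := fun n => by
    have hstep : ∀ i, BHom.postcomp R (q i) = q i - ((2⁻¹ : ℝ) : 𝕜) • q (i + 1) := fun i =>
      Subtype.ext <| LinearMap.ext fun x => by
        change (Q.1 ^ i) x - ((2⁻¹ : ℝ) : 𝕜) • Q.1 ((Q.1 ^ i) x) =
          (Q.1 ^ i) x - ((2⁻¹ : ℝ) : 𝕜) • (Q.1 ^ (i + 1)) x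
        rw [pow_succ', Module.End.mul_apply]
    induction n with
    | zero =>
      rw [Finset.sum_range_zero, map_zero, pow_zero, RCLike.ofReal_one, one_smul]
      exact (sub_self _).symm
    | succ n ih =>
      rw [Finset.sum_range_succ, map_add, ih, map_smul, hstep, hpow, mul_smul, smul_sub]
      abel
  refine ⟨S, ?_, ?_⟩
  · have := hS'.map (BHom.precomp R) (isBddMap_precomp R)
    simp only [hleft] at this
    exact this.unique hlim
  · have := hS'.map (BHom.postcomp R) (isBddMap_postcomp R)
    simp only [hright] at this
    exact this.unique hlim

/-- On the class of `f`, the map `nuc` is by construction a convergent sum of rank one maps in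
`ℒ_B(M, M)`. Evaluation at `x` is bounded, so it may be applied term by term. -/
lemma hasBornSum_nuc_mkQ (f : L1 𝕜 (M × Dual 𝕜 B M)) (x : M) :
    HasBornSum 𝕜 (fun p => f.1 p • (MulOpposite.op (p.2.1 x) • p.1))
      ((nuc M M (BTensor.mkQ 𝕜 B M (Dual 𝕜 B M) f)).1 x) :=
  (L1.lift_spec _ (isBalanced_rankOne (𝕜 := 𝕜) (B := B) (P := M) (N := M)).bounded f).map
    (BHom.eval x) (BHom.isBddMap_eval x)

/-- The powers of a nuclear map given by a small element of `ℓ¹(M × M')` are equibounded. -/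
lemma equibounded_pow_nuc (f : L1 𝕜 (M × Dual 𝕜 B M)) (D : Set B) (hD : IsBounded D)
    (hDD : D * D ⊆ D) (c : 𝕜)
    (hc : ∀ p q, f.1 p ≠ 0 → f.1 q ≠ 0 → p.2.1 q.1 ∈ c • D) (hf : (∑' p, ‖f.1 p‖) * ‖c‖ < 1)
    (U : Set M) (hU : IsBounded U) :
    ∃ V : Set M, IsBounded V ∧ ∀ (n : ℕ), ∀ x ∈ U,
      ((nuc M M (BTensor.mkQ 𝕜 B M (Dual 𝕜 B M) f)).1 ^ n) x ∈ V := by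
  set Q := (nuc M M (BTensor.mkQ 𝕜 B M (Dual 𝕜 B M) f)).1 with hQ
  obtain ⟨h1, h2⟩ := isBounded_image_fst_and_snd.2 f.2.1
  have hK := BHom.isBounded_iff.1 h2 U hU
  set S₁ := Prod.fst '' Function.support f.1
  set K := Set.image2 (fun (φ : Dual 𝕜 B M) x => φ.1 x) (Prod.snd '' Function.support f.1) U
  -- Write `p = (x_p, φ_p)`. The set consists of the elements `x_q d k` with `q` in the support of
  -- `f`, `d ∈ {1} ∪ D` and `k` a value of some `φ_p` on `U`. The unit is adjoined because `D` need
  -- not contain it and `Q` produces the terms `x_p φ_p(x)`, with no factor from `D`, when it is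
  -- applied to `x ∈ U` for the first time.
  have hG := BornMod.isBounded_act (𝕜 := 𝕜)
    (BornMod.isBounded_act (𝕜 := 𝕜) h1 ((isBounded_singleton (x := (1 : B))).union hD)) hK
  obtain ⟨W, hGW, hWb, hW⟩ := CompleteBorn.exists_completant (𝕜 := 𝕜) _ hG
  have hsum : ∀ (n : ℕ) (y : M), HasBornSum 𝕜
      (fun p => f.1 p • (Q ^ n) (MulOpposite.op (p.2.1 y) • p.1)) ((Q ^ (n + 1)) y) := fun n y => by
    have hb : ∀ n : ℕ, IsBddMap (Q ^ n) := fun n => by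
      induction n with
      | zero => exact fun S hS => by simpa using hS
      | succ n ih =>
        rw [pow_succ]
        exact ih.comp (nuc M M (BTensor.mkQ 𝕜 B M (Dual 𝕜 B M) f)).2
    have := (hasBornSum_nuc_mkQ f y).map ((Q ^ n).restrictScalars 𝕜) (hb n)
    simp only [map_smul] at this
    rw [pow_succ]
    exact this
  -- Induction on `n` works because `Q(x_q d k) = ∑ f(p) x_p φ_p(x_q) d k`, where `φ_p(x_q) d = c
  -- e_p` with `e_p ∈ D`, as `D D ⊆ D`. This is a sum of vectors `x_p e_p k` of the same kind, with
  -- coefficients `f(p) c` of total mass less than `1`; so the disc `W` is not left.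
  have key : ∀ (n : ℕ) (q : M × Dual 𝕜 B M), f.1 q ≠ 0 → ∀ d ∈ {1} ∪ D, ∀ k ∈ K,
      (Q ^ n) (MulOpposite.op k • MulOpposite.op d • q.1) ∈ W := by
    intro n
    induction n with
    | zero => exact fun q hq d hd k hk => hGW ⟨_, ⟨_, ⟨q, hq, rfl⟩, d, hd, rfl⟩, k, hk, rfl⟩
    | succ n ih =>
      intro q hq d hd k hk
      -- Off the support of `f` the value of `e` does not matter, and `0` is taken.
      have hex : ∀ p : M × Dual 𝕜 B M, ∃ e : B, f.1 p ≠ 0 → e ∈ D ∧ p.2.1 q.1 * d = c • e := by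
        intro p
        by_cases hp : f.1 p = 0
        · exact ⟨0, fun h => absurd hp h⟩
        · obtain ⟨e, he, hec⟩ := hc p q hp hq
          refine ⟨e * d, fun _ => ⟨?_, ?_⟩⟩
          · rcases hd with rfl | hd
            · simpa using he
            · exact hDD ⟨e, he, d, hd, rfl⟩
          · rw [← hec]
            exact smul_mul_assoc c e d
      choose e he using hex
      have hs := hsum n (MulOpposite.op k • MulOpposite.op d • q.1)
      have hfam : (fun p : M × Dual 𝕜 B M => f.1 p • (Q ^ n) (MulOpposite.op (p.2.1
          (MulOpposite.op k • MulOpposite.op d • q.1)) • p.1)) = fun p => (f.1 p * c) •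
            (Q ^ n) (MulOpposite.op k • MulOpposite.op (e p) • p.1) := by
        funext p
        by_cases hp : f.1 p = 0
        · simp [hp]
        · have h3 : p.2.1 (MulOpposite.op k • MulOpposite.op d • q.1) = (c • e p) * k := by
            rw [← (he p hp).2, map_smul, map_smul]
            rfl
          rw [h3, mul_smul, MulOpposite.op_mul, mul_smul, MulOpposite.op_smul, smul_assoc,
            smul_comm (MulOpposite.op k) c]
          exact congrArg _ (((Q ^ n).restrictScalars 𝕜).map_smul c _)
      rw [hfam] at hs
      have := hs.mem_smul (C := 1) hW hWb (fun p hp => ih p (left_ne_zero_of_mul hp) _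
        (Or.inr (he p (left_ne_zero_of_mul hp)).1) k hk)
        (by simpa only [norm_mul] using f.2.2.mul_right ‖c‖)
        (by simpa only [norm_mul, tsum_mul_right] using hf)
      simpa using this
  -- `U` accounts for the power `0`. A positive power maps `x ∈ U` to `∑ f(p) Qⁿ(x_p φ_p(x))`, and
  -- all the vectors `Qⁿ(x_p φ_p(x))` are in `W` by `key` with `d = 1`. The summand `1` only makes
  -- the inequality on the total mass strict.
  refine ⟨U ∪ ((∑' p, ‖f.1 p‖ + 1 : ℝ) : 𝕜) • W, hU.union (BornVec.isBounded_smul _ hWb),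
    fun n x hx => ?_⟩
  cases n with
  | zero => exact Or.inl hx
  | succ n =>
    refine Or.inr ((hsum n x).mem_smul hW hWb (fun p hp => ?_) f.2.2 (lt_add_one _))
    have := key n p hp 1 (Or.inl rfl) (p.2.1 x) ⟨p.2, ⟨p, hp, rfl⟩, x, hx, rfl⟩
    simpa using this

-- The mass of a summable family outside a large finite set is small. The tail `g` keeps its support
-- inside that of `f`, so that bounds found for the support of `f` hold for all tails at once.
open Classical in
lemma L1.exists_finite_add_small {P : Type*} [Bornology P] (f : L1 𝕜 P) {ε : ℝ} (hε : 0 < ε) :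
    ∃ (s : Finset P) (g : L1 𝕜 P), f = ∑ p ∈ s, f.1 p • L1.single (𝕜 := 𝕜) p + g ∧
      Function.support g.1 ⊆ Function.support f.1 ∧ ∑' p, ‖g.1 p‖ < ε := by
  obtain ⟨s, hs⟩ := ((tendsto_tsum_compl_atTop_zero fun p => ‖f.1 p‖).eventually_lt_const hε).exists
  have hval : ∀ q, (f - ∑ p ∈ s, f.1 p • L1.single (𝕜 := 𝕜) p).1 q =
      if q ∈ s then 0 else f.1 q := by
    intro q
    have : (f - ∑ p ∈ s, f.1 p • L1.single (𝕜 := 𝕜) p).1 q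
        = f.1 q - ∑ p ∈ s, f.1 p * (Pi.single p (1 : 𝕜) : P → 𝕜) q := by
      simp [L1.single]
    rw [this]
    simp only [Pi.single_apply, mul_ite, mul_one, mul_zero, Finset.sum_ite_eq]
    split_ifs <;> simp
  refine ⟨s, f - ∑ p ∈ s, f.1 p • L1.single p, by abel, fun q hq => ?_, ?_⟩
  · rw [Function.mem_support, hval] at hq
    split_ifs at hq with h
    · exact absurd rfl hq
    · exact hq
  · refine lt_of_eq_of_lt ?_ hs
    refine Eq.trans ?_ (tsum_subtype {p | p ∉ s} fun p => ‖f.1 p‖).symm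
    refine tsum_congr fun p => ?_
    rw [hval]
    by_cases h : p ∈ s <;> simp [h]

/-- Over a multiplicatively convex algebra, a nuclear endomorphism is the sum of a finite rank map
and a map `R` such that `1 - R` is invertible. -/
theorem exists_finiteRank_add_small (hB : MulConvex 𝕜 B) (z : BTensor 𝕜 B M (Dual 𝕜 B M)) :
    ∃ u ∈ Submodule.span 𝕜 {z : BTensor 𝕜 B M (Dual 𝕜 B M) | ∃ x φ, z = BTensor.tmul 𝕜 B x φ},
      ∃ R S : BHom 𝕜 B M M, nuc M M z = nuc M M u + R ∧
        BHom.comp S (BHom.id 𝕜 B M - R) = BHom.id 𝕜 B M ∧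
        BHom.comp (BHom.id 𝕜 B M - R) S = BHom.id 𝕜 B M := by
  obtain ⟨f, rfl⟩ := BTensor.mkQ_surjective 𝕜 B M (Dual 𝕜 B M) z
  obtain ⟨h1, h2⟩ := isBounded_image_fst_and_snd.2 f.2.1
  -- The bounded subset of `B` formed by all values `φ_p(x_q)`, with `p` and `q` in the support of
  -- `f`, is absorbed by a submultiplicative disc. The constant `c` is fixed before the tail is
  -- chosen, and the tail is cut so that `2 ‖g‖ ‖c‖ < 1`; adding `1` to `‖c‖` avoids a division by
  -- zero.
  obtain ⟨D, hD, -, hDD, c, hc⟩ := hB _ (BHom.isBounded_iff.1 h2 _ h1)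
  obtain ⟨s, g, hfg, hsupp, hg⟩ := L1.exists_finite_add_small f
    (ε := (2 * (‖c‖ + 1))⁻¹) (by positivity)
  -- The factor `2` is moved into the tensor: the Neumann series is applied to `1 - Q / 2` with `Q`
  -- the nuclear map of `2 g`.
  have hR : nuc M M (BTensor.mkQ 𝕜 B M (Dual 𝕜 B M) g) = ((2⁻¹ : ℝ) : 𝕜) •
      nuc M M (BTensor.mkQ 𝕜 B M (Dual 𝕜 B M) ((2 : 𝕜) • g)) := by
    rw [map_smul, map_smul, smul_smul, RCLike.ofReal_inv, RCLike.ofReal_ofNat,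
      inv_mul_cancel₀ two_ne_zero, one_smul]
  have hsupp2 : ∀ p, ((2 : 𝕜) • g).1 p ≠ 0 → f.1 p ≠ 0 := fun p hp =>
    hsupp fun h => hp (by simp [h])
  have hsmall : (∑' p, ‖((2 : 𝕜) • g).1 p‖) * ‖c‖ < 1 := by
    have : ∑' p, ‖((2 : 𝕜) • g).1 p‖ = 2 * ∑' p, ‖g.1 p‖ := by
      rw [← tsum_mul_left]
      exact tsum_congr fun p => by simp
    rw [this]
    have h0 : 0 ≤ ∑' p, ‖g.1 p‖ := tsum_nonneg fun _ => norm_nonneg _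
    rw [← one_div, lt_div_iff₀ (by positivity)] at hg
    linarith
  obtain ⟨S, hS, hS'⟩ := exists_inverse_of_equibounded _ (equibounded_pow_nuc ((2 : 𝕜) • g) D hD hDD
    c (fun p q hp hq => hc ⟨p.2, ⟨p, hsupp2 p hp, rfl⟩, q.1, ⟨q, hsupp2 q hq, rfl⟩, rfl⟩) hsmall)
  rw [← hR] at hS hS'
  refine ⟨BTensor.mkQ 𝕜 B M (Dual 𝕜 B M) (∑ p ∈ s, f.1 p • L1.single (𝕜 := 𝕜) p), ?_, _, S,
    ?_, hS, hS'⟩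
  · rw [map_sum]
    refine Submodule.sum_mem _ fun p _ => ?_
    rw [map_smul]
    exact Submodule.smul_mem _ _ (Submodule.subset_span ⟨p.1, p.2, rfl⟩)
  · rw [← map_add, ← map_add, ← hfg]

end Neumann

/-! ### The ideal of finite rank morphisms. -/

section FiniteRank

variable {𝕜 : Type} {B : Type u} [RCLike 𝕜] [Ring B] [Algebra 𝕜 B] [Bornology B] [BornAlg 𝕜 B]
  {L M N : BMod 𝕜 B}

/-- A morphism of finite rank: a finite sum of rank one maps. -/
def IsFiniteRank (f : M ⟶ N) : Prop :=
  ∃ u ∈ Submodule.span 𝕜 {z : BTensor 𝕜 B N.carrier (Dual 𝕜 B M.carrier) |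
    ∃ x φ, z = BTensor.tmul 𝕜 B x φ}, nuc M.carrier N.carrier u = f

lemma IsFiniteRank.add {f g : M ⟶ N} (hf : IsFiniteRank f) (hg : IsFiniteRank g) :
    IsFiniteRank (f + g) := by
  obtain ⟨u, hu, rfl⟩ := hf
  obtain ⟨v, hv, rfl⟩ := hg
  exact ⟨u + v, Submodule.add_mem _ hu hv, map_add _ _ _⟩

lemma IsFiniteRank.neg {f : M ⟶ N} (hf : IsFiniteRank f) : IsFiniteRank (-f) := by
  obtain ⟨u, hu, rfl⟩ := hf
  exact ⟨-u, Submodule.neg_mem _ hu, map_neg _ _⟩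

lemma IsFiniteRank.sub {f g : M ⟶ N} (hf : IsFiniteRank f) (hg : IsFiniteRank g) :
    IsFiniteRank (f - g) := by
  rw [sub_eq_add_neg]
  exact hf.add hg.neg

/-- The map `f ⊗ g^*` takes elementary tensors to elementary tensors. Together with the naturality
of `nuc`, this makes the finite rank morphisms a two-sided ideal. -/
lemma tmap_mem_span {M' N' : BMod 𝕜 B} (f : N ⟶ N') (g : M' ⟶ M)
    {u : BTensor 𝕜 B N.carrier (Dual 𝕜 B M.carrier)}
    (hu : u ∈ Submodule.span 𝕜 {z | ∃ x φ, z = BTensor.tmul 𝕜 B x φ}) :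
    tmap f g u ∈ Submodule.span 𝕜 {z | ∃ x φ, z = BTensor.tmul 𝕜 B x φ} := by
  have := Submodule.mem_map_of_mem (f := tmap f g) hu
  rw [Submodule.map_span] at this
  refine Submodule.span_mono ?_ this
  rintro _ ⟨_, ⟨x, φ, rfl⟩, rfl⟩
  exact ⟨_, _, tmap_tmul _ _ _ _⟩

lemma IsFiniteRank.comp_right {f : L ⟶ M} (hf : IsFiniteRank f) (g : M ⟶ N) :
    IsFiniteRank (f ≫ g) := by
  obtain ⟨u, hu, rfl⟩ := hf
  exact ⟨tmap g (𝟙 L) u, tmap_mem_span g (𝟙 L) hu, nuc_tmap _ _ _⟩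

lemma IsFiniteRank.comp_left {g : M ⟶ N} (hg : IsFiniteRank g) (f : L ⟶ M) :
    IsFiniteRank (f ≫ g) := by
  obtain ⟨u, hu, rfl⟩ := hg
  exact ⟨tmap (𝟙 N) f u, tmap_mem_span (𝟙 N) f hu, nuc_tmap _ _ _⟩

/-- The middle object is `B` itself: `φ` followed by `b ↦ x b`. -/
lemma factorsThru_rankOne (x : N.carrier) (φ : Dual 𝕜 B M.carrier) :
    FactorsThru (fgProjective 𝕜 B) (X := M) (Y := N) (rankOne x φ) := by
  refine ⟨{ carrier := B }, fgProjective_self, φ,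
    (rankOne x (BHom.id 𝕜 B B) : BHom 𝕜 B B N.carrier), rfl⟩

/-- Sums of rank one maps factor through biproducts of copies of `B`, and scalars are absorbed by
the second map. This is how finite rank leads to finitely generated projective modules. -/
lemma IsFiniteRank.factorsThru {f : M ⟶ N} (hf : IsFiniteRank f) :
    FactorsThru (fgProjective 𝕜 B) f := by
  obtain ⟨u, hu, rfl⟩ := hf
  induction hu using Submodule.span_induction with
  | mem z hz =>
    obtain ⟨x, φ, rfl⟩ := hz
    rw [nuc_tmul]
    exact factorsThru_rankOne x φ
  | zero =>
    rw [map_zero]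
    exact factorsThru_zero M N
  | add z w _ _ hz hw =>
    rw [map_add]
    exact FactorsThru.add fgProjective_biprod hz hw
  | smul c z _ hz =>
    rw [map_smul]
    obtain ⟨Z, hZ, a, b, hab⟩ := hz
    refine ⟨Z, hZ, a, c • b, ?_⟩
    rw [Linear.comp_smul, hab]

end FiniteRank

/-! ### Nuclear and algebraically nuclear identities of complexes. -/

section Complexes

open CochainComplex.HomComplex

variable {𝕜 : Type} {B : Type u} [RCLike 𝕜] [Ring B] [Algebra 𝕜 B] [Bornology B] [BornAlg 𝕜 B]
  {M N : CochainComplex (BMod 𝕜 B) ℤ}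

lemma isAlgNuclear_iff {n : ℤ} {f : Cochain M N n} :
    IsAlgNuclear f ↔ ∀ p q hpq, IsFiniteRank (f.v p q hpq) := by
  constructor
  · rintro ⟨u, hu, rfl⟩ p q hpq
    exact ⟨u ⟨p, q, hpq⟩, hu ⟨p, q, hpq⟩, rfl⟩
  · intro h
    choose u hu hu' using h
    let w : TensorDual M N n := fun T => u T.p T.q T.hpq
    refine ⟨w, fun T => hu T.p T.q T.hpq, ?_⟩
    ext p q hpq
    exact hu' p q hpq

/-- The homotopy from `ν ν⁻¹` to the identity is evaluated at `id_M`. As `id_M` is a cocycle, only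
the term of the form `δ(k')` remains, and it is a homotopy between `id_M` and the nuclear map
`ν(ν⁻¹(id_M))`. -/
lemma isNuclear_of_homotopyEquiv (e : HomotopyEquiv (tensorComplex M M) (homComplex M M))
    (he : e.hom = nuclearMap M M) :
    ∃ g : Cochain M M 0, IsNuclear g ∧ IsHomotopic (Cochain.ofHom (𝟙 M)) g := by
  have hc := e.homotopyInvHomId.comm 0
  generalize e.homotopyInvHomId.hom = H at hc
  rw [he, dNext_eq _ (show (ComplexShape.up ℤ).Rel 0 1 by simp),
    prevD_eq _ (show (ComplexShape.up ℤ).Rel (-1) 0 by simp)] at hc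
  have h := LinearMap.congr_fun (congrArg Subtype.val hc) (Cochain.ofHom (𝟙 M))
  let k : Cochain M M 1 → Cochain M M 0 := fun z => (H 1 0).1 z
  let k' : Cochain M M 0 → Cochain M M (-1) := fun z => (H 0 (-1)).1 z
  have hk : k 0 = 0 := map_zero (H 1 0).1
  have h' : nuclear 0 ((e.inv.f 0).1 (Cochain.ofHom (𝟙 M))) =
      k (δ 0 1 (Cochain.ofHom (𝟙 M))) + δ (-1) 0 (k' (Cochain.ofHom (𝟙 M))) +
        Cochain.ofHom (𝟙 M) := h
  rw [δ_ofHom, hk, zero_add] at h'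
  refine ⟨_, ⟨(e.inv.f 0).1 (Cochain.ofHom (𝟙 M)), h'⟩, -k' (Cochain.ofHom (𝟙 M)), ?_⟩
  rw [δ_neg]
  abel

/-- In each degree the nuclear map is a finite rank map plus some `R` with `1 - R` invertible. With
`r = 1 - R`, inverse `s` and finite rank part `g`, the given homotopy says `r = g + δ(h)`. Composing
with `s` on the right (in diagrammatic order) gives `1 = g s + δ(h) s = (g s - h δ(s)) + δ(h s)`.
The maps `r` and `s` need not be chain maps, but `δ(r) = δ(g)` has finite rank, hence so does `δ(s)
= -s δ(g) s`. -/
lemma isAlgNuclear_of_isNuclear (hB : MulConvex 𝕜 B)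
    (h : ∃ g : Cochain M M 0, IsNuclear g ∧ IsHomotopic (Cochain.ofHom (𝟙 M)) g) :
    ∃ g : Cochain M M 0, IsAlgNuclear g ∧ IsHomotopic (Cochain.ofHom (𝟙 M)) g := by
  obtain ⟨_, ⟨u, rfl⟩, h, hh⟩ := h
  choose v hv R S huv hS hS' using fun p : ℤ =>
    exists_finiteRank_add_small hB (u ⟨p, p, add_zero p⟩)
  let s : Cochain M M 0 := Cochain.ofHoms S
  let g : Cochain M M 0 := Cochain.ofHoms fun p => nuc (M.X p).carrier (M.X p).carrier (v p)
  let r : Cochain M M 0 := Cochain.ofHoms fun p => 𝟙 (M.X p) - R p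
  have hr : r = g + δ (-1) 0 h := by
    rw [← hh]
    ext p
    simp only [r, g, Cochain.add_v, Cochain.sub_v, Cochain.ofHoms_v, Cochain.ofHom_v]
    have : (nuclear 0 u).v p p (add_zero p) =
        nuc (M.X p).carrier (M.X p).carrier (v p) + R p := huv p
    rw [this]
    change _ = _ + (𝟙 (M.X p) - _)
    abel
  have hrs : r.comp s (add_zero 0) = Cochain.ofHom (𝟙 M) := by
    ext p
    simp only [r, s, Cochain.comp_zero_cochain_v, Cochain.ofHoms_v, Cochain.ofHom_v]
    exact hS p
  have hsr : s.comp r (add_zero 0) = Cochain.ofHom (𝟙 M) := by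
    ext p
    simp only [r, s, Cochain.comp_zero_cochain_v, Cochain.ofHoms_v, Cochain.ofHom_v]
    exact hS' p
  have hδr : δ 0 1 r = δ 0 1 g := by rw [hr, δ_add, δ_δ, add_zero]
  -- Differentiate `s r = 1` and compose with `s` on the right.
  have hδs : δ 0 1 s = -(s.comp (δ 0 1 g) (zero_add 1)).comp s (add_zero 1) := by
    have h1 := congrArg (δ 0 1) hsr
    rw [δ_ofHom, δ_comp_zero_cochain _ _ _ (zero_add 1), hδr] at h1
    have h2 := congrArg (fun z : Cochain M M 1 => z.comp s (add_zero 1))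
      (eq_neg_of_add_eq_zero_right h1)
    simp only [Cochain.comp_assoc_of_third_is_zero_cochain, hrs, Cochain.comp_id,
      Cochain.neg_comp] at h2
    rw [h2]
    simp
  have hg : ∀ p, IsFiniteRank (g.v p p (add_zero p)) := fun p => by
    simp only [g, Cochain.ofHoms_v]
    exact ⟨v p, hv p, rfl⟩
  have hδg : ∀ p q hpq, IsFiniteRank ((δ 0 1 g).v p q hpq) := fun p q hpq => by
    rw [δ_zero_cochain_v]
    exact ((hg p).comp_right _).sub ((hg q).comp_left _)
  -- The product rule `δ(h s) = h δ(s) + δ(h) s` dictates the correction `- h δ(s)`, whose finite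
  -- rank comes from that of `δ(g)`.
  refine ⟨g.comp s (add_zero 0) - h.comp (δ 0 1 s) (neg_add_cancel 1), ?_,
    h.comp s (add_zero _), ?_⟩
  · refine isAlgNuclear_iff.2 fun p q hpq => ?_
    obtain rfl : p = q := by omega
    rw [Cochain.sub_v, Cochain.comp_zero_cochain_v,
      Cochain.comp_v _ _ _ p (p - 1) p (by omega) (by omega)]
    refine ((hg p).comp_right _).sub (IsFiniteRank.comp_left ?_ _)
    rw [hδs, Cochain.neg_v, Cochain.comp_zero_cochain_v, Cochain.zero_cochain_comp_v]
    exact (((hδg _ _ _).comp_left _).comp_right _).neg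
  · rw [δ_comp_zero_cochain _ _ _ (neg_add_cancel 1), eq_sub_of_add_eq' hr.symm,
      Cochain.sub_comp, hrs]
    abel

/-- The algebraically nuclear map is `1 - δ(h)`, and it factors in each degree through a finitely
generated projective module. The complex is bounded, so the criterion for perfect complexes applies.
-/
lemma exists_homotopyEquiv_of_isAlgNuclear (hM : IsBoundedComplex M)
    (h : ∃ g : Cochain M M 0, IsAlgNuclear g ∧ IsHomotopic (Cochain.ofHom (𝟙 M)) g) :
    ∃ T : CochainComplex (BMod 𝕜 B) ℤ, IsBoundedComplex T ∧
      (∀ i, IsFGProjective (T.X i)) ∧ Nonempty (HomotopyEquiv M T) := by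
  obtain ⟨a, b, hab⟩ := hM
  obtain ⟨g, hg, h, hh⟩ := h
  have hdef : ∀ p, defect h p = g.v p p (add_zero p) := fun p => by
    rw [defect, ← hh, sub_sub_cancel]
  -- The length `(b - a).toNat` also covers the case `b < a`: every `i > a + (b - a).toNat`
  -- satisfies `i > b`.
  obtain ⟨T, ⟨a', b', hT⟩, hP, ⟨e⟩⟩ := isPerfect_of_factorsThru (P := fgProjective 𝕜 B)
    fgProjective_biprod (b - a).toNat a M (fun i hi => (BMod.isZero_iff _).2 (hab i (Or.inl hi))) h
    (fun p => hdef p ▸ (isAlgNuclear_iff.1 hg p p _).factorsThru)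
    (fun i hi => ((BMod.isZero_iff _).2 (hab i (Or.inr (by omega)))).eq_of_src _ _)
  exact ⟨T, ⟨a', b', fun i hi => (BMod.isZero_iff _).1 (hT i hi)⟩, hP,
    ⟨HomotopyCategory.homotopyEquivOfIso e⟩⟩

end Complexes

/-! ### The inverse of the nuclear map for a module with a finite dual basis. -/

section NuclearInverse

variable {𝕜 B P N : Type*} [RCLike 𝕜] [Ring B] [Algebra 𝕜 B] [Bornology B] [BornAlg 𝕜 B]
  [AddCommGroup P] [Module 𝕜 P] [Module Bᵐᵒᵖ P] [IsScalarTower 𝕜 Bᵐᵒᵖ P] [Bornology P]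
  [BornMod 𝕜 B P]
  [AddCommGroup N] [Module 𝕜 N] [Module Bᵐᵒᵖ N] [IsScalarTower 𝕜 Bᵐᵒᵖ N] [Bornology N]
  [BornMod 𝕜 B N]

lemma isBddMap_sum {V W ι : Type*} [Bornology V] [AddCommGroup W] [Module 𝕜 W] [Bornology W]
    [BornVec 𝕜 W] (s : Finset ι) (f : ι → V → W) (hf : ∀ i ∈ s, IsBddMap (f i)) :
    IsBddMap fun x => ∑ i ∈ s, f i x := by
  classical
  induction s using Finset.induction_on with
  | empty => simpa using isBddMap_zero
  | insert i s hi ih =>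
    simp only [Finset.sum_insert hi]
    exact IsBddMap.add 𝕜 (hf i (Finset.mem_insert_self _ _))
      (ih fun j hj => hf j (Finset.mem_insert_of_mem hj))

variable (N) in
/-- The map `h ↦ h(y) ⊗ φ`. -/
noncomputable def evalTmul (y : P) (φ : Dual 𝕜 B P) :
    BHom 𝕜 B P N →ₗ[𝕜] BTensor 𝕜 B N (Dual 𝕜 B P) where
  toFun h := BTensor.tmul 𝕜 B (h.1 y) φ
  map_add' _ _ := BTensor.isBalanced_tmul.add_left _ _ _
  map_smul' _ _ := BTensor.isBalanced_tmul.smul_left _ _ _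

lemma isBddMap_evalTmul (y : P) (φ : Dual 𝕜 B P) : IsBddMap (evalTmul N y φ) := fun H hH => by
  refine ((BTensor.isBalanced_tmul (𝕜 := 𝕜) (B := B) (M := N) (N := Dual 𝕜 B P)).bounded _
    ((BHom.isBddMap_eval y H hH).prod (isBounded_singleton (x := φ)))).subset ?_
  rintro _ ⟨h, hh, rfl⟩
  exact ⟨(h.1 y, φ), ⟨⟨h, hh, rfl⟩, rfl⟩, rfl⟩

/-- If `P` is finitely generated projective, with dual basis `y`, `φ`, then the map `nuc` has a
bounded inverse. -/
lemma exists_nuc_inverse {ι : Type*} [Fintype ι] (y : ι → P) (φ : ι → Dual 𝕜 B P)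
    (h : ∀ x, ∑ j, MulOpposite.op ((φ j).1 x) • y j = x) :
    ∃ σ : BHom 𝕜 B P N →ₗ[𝕜] BTensor 𝕜 B N (Dual 𝕜 B P), IsBddMap σ ∧
      (∀ z, σ (nuc P N z) = z) ∧ ∀ f, nuc P N (σ f) = f := by
  have hσ : IsBddMap (∑ j, evalTmul N (y j) (φ j) :
      BHom 𝕜 B P N →ₗ[𝕜] BTensor 𝕜 B N (Dual 𝕜 B P)) :=
    (isBddMap_sum (𝕜 := 𝕜) Finset.univ _ fun j _ => isBddMap_evalTmul (N := N) (y j)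
      (φ j)).congr fun f => by
      rw [LinearMap.sum_apply]
  refine ⟨∑ j, evalTmul N (y j) (φ j), hσ, fun z => ?_, fun f => ?_⟩
  · have : (∑ j, evalTmul N (y j) (φ j)) ∘ₗ nuc P N = LinearMap.id := by
      refine BTensor.hom_ext (hσ.comp isBddMap_nuc) (fun S hS => by simpa using hS) fun n ψ => ?_
      let τ : Dual 𝕜 B P →+ BTensor 𝕜 B N (Dual 𝕜 B P) :=
        AddMonoidHom.mk' (BTensor.tmul 𝕜 B n) (BTensor.isBalanced_tmul.add_right n)
      -- The `φ_j` generate the dual: this is `ψ` applied to the expansion of `x` in the dual basis.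
      -- Because the tensor product is balanced, `∑ n ψ(y_j) ⊗ φ_j = n ⊗ ∑ ψ(y_j) φ_j = n ⊗ ψ`.
      have hψ : ∑ j, ψ.1 (y j) • φ j = ψ := by
        refine Subtype.ext <| LinearMap.ext fun x => ?_
        have h1 : ψ.1 x = ∑ j, ψ.1 (y j) * (φ j).1 x := by
          conv_lhs => rw [← h x, map_sum]
          exact Finset.sum_congr rfl fun j _ => map_smul ψ.1 _ _
        rw [h1]
        have h2 : (BHom.eval x : Dual 𝕜 B P →ₗ[𝕜] B) (∑ j, ψ.1 (y j) • φ j) =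
            ∑ j, ψ.1 (y j) * (φ j).1 x := by
          rw [map_sum]
          rfl
        exact h2
      rw [LinearMap.comp_apply, nuc_tmul, LinearMap.sum_apply, LinearMap.id_apply]
      calc ∑ j, evalTmul N (y j) (φ j) (rankOne n ψ) = ∑ j, τ (ψ.1 (y j) • φ j) :=
            Finset.sum_congr rfl fun j _ => BTensor.isBalanced_tmul.balanced (ψ.1 (y j)) n (φ j)
        _ = τ (∑ j, ψ.1 (y j) • φ j) := (map_sum τ _ _).symm
        _ = BTensor.tmul 𝕜 B n ψ := congrArg τ hψ
    exact LinearMap.congr_fun this z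
  · refine Subtype.ext <| LinearMap.ext fun x => ?_
    have h1 : (BHom.eval x : BHom 𝕜 B P N →ₗ[𝕜] N) (nuc P N ((∑ j, evalTmul N (y j) (φ j)) f)) =
        ∑ j, MulOpposite.op ((φ j).1 x) • f.1 (y j) := by
      rw [LinearMap.sum_apply, map_sum, map_sum]
      refine Finset.sum_congr rfl fun j _ => ?_
      change (nuc P N (BTensor.tmul 𝕜 B (f.1 (y j)) (φ j))).1 x = _
      rw [nuc_tmul]
      rfl
    refine h1.trans ?_
    -- Only `x` on the right is expanded: `f(x) = ∑ f(y_j φ_j(x)) = ∑ f(y_j) φ_j(x)`.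
    conv_rhs => rw [← h x, map_sum]
    exact Finset.sum_congr rfl fun j _ => (map_smul f.1 _ _).symm

end NuclearInverse

/-! ### Additivity of the induced maps between tensor products. -/

section TMap

variable {𝕜 B : Type*} [RCLike 𝕜] [Ring B] [Algebra 𝕜 B] [Bornology B] [BornAlg 𝕜 B]
  {P P' N N' : Type*}
  [AddCommGroup P] [Module 𝕜 P] [Module Bᵐᵒᵖ P] [IsScalarTower 𝕜 Bᵐᵒᵖ P] [Bornology P]
  [BornMod 𝕜 B P]
  [AddCommGroup P'] [Module 𝕜 P'] [Module Bᵐᵒᵖ P'] [IsScalarTower 𝕜 Bᵐᵒᵖ P'] [Bornology P']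
  [BornMod 𝕜 B P']
  [AddCommGroup N] [Module 𝕜 N] [Module Bᵐᵒᵖ N] [IsScalarTower 𝕜 Bᵐᵒᵖ N] [Bornology N]
  [BornMod 𝕜 B N]
  [AddCommGroup N'] [Module 𝕜 N'] [Module Bᵐᵒᵖ N'] [IsScalarTower 𝕜 Bᵐᵒᵖ N'] [Bornology N']
  [BornMod 𝕜 B N']

lemma tmap_add_left (f f' : BHom 𝕜 B N N') (g : BHom 𝕜 B P P')
    (z : BTensor 𝕜 B N (Dual 𝕜 B P')) : tmap (f + f') g z = tmap f g z + tmap f' g z := by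
  have : tmap (f + f') g = tmap f g + tmap f' g :=
    BTensor.hom_ext (isBddMap_tmap _ _) (IsBddMap.add 𝕜 (isBddMap_tmap f g) (isBddMap_tmap f' g))
      fun n φ => by
        rw [LinearMap.add_apply, tmap_tmul, tmap_tmul, tmap_tmul]
        exact BTensor.isBalanced_tmul.add_left (f.1 n) (f'.1 n) _
  exact LinearMap.congr_fun this z

lemma tmap_add_right (f : BHom 𝕜 B N N') (g g' : BHom 𝕜 B P P')
    (z : BTensor 𝕜 B N (Dual 𝕜 B P')) : tmap f (g + g') z = tmap f g z + tmap f g' z := by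
  have : tmap f (g + g') = tmap f g + tmap f g' :=
    BTensor.hom_ext (isBddMap_tmap _ _) (IsBddMap.add 𝕜 (isBddMap_tmap f g) (isBddMap_tmap f g'))
      fun n φ => by
        rw [LinearMap.add_apply, tmap_tmul, tmap_tmul, tmap_tmul]
        have : (BHom.comp φ (g + g') : Dual 𝕜 B P) = BHom.comp φ g + BHom.comp φ g' :=
          Subtype.ext <| LinearMap.ext fun x => map_add φ.1 _ _
        rw [this]
        exact BTensor.isBalanced_tmul.add_right (f.1 n) _ _
  exact LinearMap.congr_fun this z

lemma tmap_id (z : BTensor 𝕜 B N (Dual 𝕜 B P)) :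
    tmap (BHom.id 𝕜 B N) (BHom.id 𝕜 B P) z = z := by
  have : tmap (BHom.id 𝕜 B N) (BHom.id 𝕜 B P) = LinearMap.id :=
    BTensor.hom_ext (isBddMap_tmap _ _) (fun S hS => by simpa using hS) fun n φ => tmap_tmul _ _ _ _
  exact LinearMap.congr_fun this z

end TMap

/-! ### Functoriality of the two complexes, and homotopy invariance of the complex of graded maps.
-/

section Functoriality

open CochainComplex.HomComplex

variable {𝕜 : Type} {B : Type u} [RCLike 𝕜] [Ring B] [Algebra 𝕜 B] [Bornology B] [BornAlg 𝕜 B]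
  {M M' N N' : CochainComplex (BMod 𝕜 B) ℤ}

section Operators

variable {n m : ℤ} (τ : Triplet m → Triplet n) (α : ∀ T, M'.X T.p ⟶ M.X (τ T).p)
  (β : ∀ T, N.X (τ T).q ⟶ N'.X T.q)

/-- The operator from graded maps to graded maps with components `z ↦ β ∘ z ∘ α`. -/
def homOperator : Cochain M N n →ₗ[𝕜] Cochain M' N' m where
  toFun z T := α T ≫ z (τ T) ≫ β T
  map_add' z z' := funext fun T => by
    change α T ≫ (z (τ T) + z' (τ T)) ≫ β T = α T ≫ z (τ T) ≫ β T + α T ≫ z' (τ T) ≫ β T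
    rw [Preadditive.add_comp, Preadditive.comp_add]
  map_smul' c z := funext fun T => by
    change α T ≫ (c • z (τ T)) ≫ β T = c • (α T ≫ z (τ T) ≫ β T)
    rw [Linear.smul_comp, Linear.comp_smul]

lemma isBddMap_homOperator : IsBddMap (homOperator τ α β) :=
  isBddMap_pi (Y := fun T : Triplet m => M'.X T.p ⟶ N'.X T.q) fun T =>
    (isBddMap_precomp (α T)).comp ((isBddMap_postcomp (β T)).comp
      (isBddMap_eval (Y := fun T : Triplet n => M.X T.p ⟶ N.X T.q) (τ T)))

/-- The operator between tensor products with components `u ↦ (β ⊗ α^*) u`. -/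
noncomputable def tensorOperator : TensorDual M N n →ₗ[𝕜] TensorDual M' N' m where
  toFun u T := tmap (β T) (α T) (u (τ T))
  map_add' u u' := funext fun T => map_add (tmap (β T) (α T)) (u (τ T)) (u' (τ T))
  map_smul' c u := funext fun T => map_smul (tmap (β T) (α T)) c (u (τ T))

lemma isBddMap_tensorOperator : IsBddMap (tensorOperator τ α β) :=
  isBddMap_pi fun T => (isBddMap_tmap (β T) (α T)).comp (isBddMap_eval (τ T))

end Operators

/-- The map `ℒ_B^•(M, N) → ℒ_B^•(M', N')` induced by `a : M' → M` and `b : N → N'`. -/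
def homMap (a : M' ⟶ M) (b : N ⟶ N') : homComplex M N ⟶ homComplex M' N' where
  f n := ⟨homOperator id (fun T => a.f T.p) (fun T => b.f T.q), isBddMap_homOperator _ _ _⟩
  comm' n m hnm := Subtype.ext <| LinearMap.ext fun (z : Cochain M N n) => by
    refine Cochain.ext _ _ fun p q hpq => ?_
    change ((a.f p ≫ z.v p (p + n) rfl ≫ b.f (p + n)) ≫ N'.d (p + n) q + m.negOnePow •
        M'.d p (p + m - n) ≫ (a.f _ ≫ z.v (p + m - n) q _ ≫ b.f q)) =
      a.f p ≫ (z.v p (p + n) rfl ≫ N.d (p + n) q + m.negOnePow •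
        M.d p (p + m - n) ≫ z.v (p + m - n) q _) ≫ b.f q
    simp

/-- The map `N ⊗_B ℒ_B^•(M, B) → N' ⊗_B ℒ_B^•(M', B)` induced by `a : M' → M` and `b : N → N'`. -/
noncomputable def tensorMap (a : M' ⟶ M) (b : N ⟶ N') :
    tensorComplex M N ⟶ tensorComplex M' N' where
  f n := ⟨tensorOperator id (fun T => a.f T.p) (fun T => b.f T.q), isBddMap_tensorOperator _ _ _⟩
  comm' n m hnm := Subtype.ext <| LinearMap.ext fun (u : TensorDual M N n) => by
    funext ⟨p, q, hpq⟩
    change tmap (N'.d (p + n) q) (𝟙 (M'.X p)) (tmap (b.f (p + n)) (a.f p) (u ⟨p, p + n, rfl⟩)) +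
        m.negOnePow • tmap (𝟙 (N'.X q)) (M'.d p (p + m - n))
          (tmap (b.f q) (a.f (p + m - n)) (u ⟨p + m - n, q, _⟩)) =
      tmap (b.f q) (a.f p) (tmap (N.d (p + n) q) (𝟙 (M.X p)) (u ⟨p, p + n, rfl⟩) +
        m.negOnePow • tmap (𝟙 (N.X q)) (M.d p (p + m - n)) (u ⟨p + m - n, q, _⟩))
    refine Eq.trans ?_ (map_add (tmap (b.f q) (a.f p)) _ _).symm
    refine congrArg₂ _ ?_ (Eq.trans (congrArg _ ?_) (map_zsmul (tmap (b.f q) (a.f p)) _ _).symm)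
    · refine (tmap_tmap _ _ _ _ _).trans (Eq.trans ?_ (tmap_tmap _ _ _ _ _).symm)
      exact congrArg (fun f => tmap f (a.f p) _) (b.comm (p + n) q)
    · refine (tmap_tmap _ _ _ _ _).trans (Eq.trans ?_ (tmap_tmap _ _ _ _ _).symm)
      exact congrArg (fun g => tmap (b.f q) g _) (a.comm p (p + m - n)).symm

lemma tensorMap_id : tensorMap (𝟙 M) (𝟙 N) = 𝟙 (tensorComplex M N) := by
  ext n
  exact Subtype.ext <| LinearMap.ext fun u => funext fun T => tmap_id _

lemma homMap_id : homMap (𝟙 M) (𝟙 N) = 𝟙 (homComplex M N) := rfl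

lemma tensorMap_comp {M'' N'' : CochainComplex (BMod 𝕜 B) ℤ} (a : M' ⟶ M) (b : N ⟶ N')
    (a' : M'' ⟶ M') (b' : N' ⟶ N'') :
    tensorMap a b ≫ tensorMap a' b' = tensorMap (a' ≫ a) (b ≫ b') := by
  ext n
  exact Subtype.ext <| LinearMap.ext fun u => funext fun T => tmap_tmap _ _ _ _ _

lemma homMap_comp {M'' N'' : CochainComplex (BMod 𝕜 B) ℤ} (a : M' ⟶ M) (b : N ⟶ N')
    (a' : M'' ⟶ M') (b' : N' ⟶ N'') :
    homMap a b ≫ homMap a' b' = homMap (a' ≫ a) (b ≫ b') := rfl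

lemma tensorMap_nuclearMap (a : M' ⟶ M) (b : N ⟶ N') :
    tensorMap a b ≫ nuclearMap M' N' = nuclearMap M N ≫ homMap a b := by
  ext n
  exact Subtype.ext <| LinearMap.ext fun u => funext fun T => nuc_tmap _ _ _

/-! #### Homotopies -/

/-- A homotopy between `f` and `g`, in terms of its components. -/
def homotopyOfComponents {K L : CochainComplex (Bor.{u} 𝕜) ℤ} {f g : K ⟶ L}
    (h : ∀ n m, K.X n ⟶ L.X m) (zero : ∀ n m, m + 1 ≠ n → h n m = 0)
    (comm : ∀ n x, (f.f n).1 x = (h (n + 1) n).1 ((K.d n (n + 1)).1 x) +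
      (L.d (n - 1) n).1 ((h n (n - 1)).1 x) + (g.f n).1 x) : Homotopy f g where
  hom := h
  zero n m hnm := zero n m hnm
  comm n := by
    rw [dNext_eq _ (show (ComplexShape.up ℤ).Rel n (n + 1) by simp),
      prevD_eq _ (show (ComplexShape.up ℤ).Rel (n - 1) n by simp)]
    exact Subtype.ext <| LinearMap.ext (comm n)

lemma homotopy_comm_int {a b : M ⟶ N} (k : Homotopy a b) {p q r : ℤ} (hq : q + 1 = p)
    (hr : p + 1 = r) : a.f p = M.d p r ≫ k.hom r p + k.hom p q ≫ N.d q p + b.f p := by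
  rw [k.comm, dNext_eq _ (show (ComplexShape.up ℤ).Rel p r from hr),
    prevD_eq _ (show (ComplexShape.up ℤ).Rel q p from hq)]

/-- The map `homMap` is homotopy invariant in the second variable. -/
def homMapHomotopyRight (a : M' ⟶ M) {b b' : N ⟶ N'} (k : Homotopy b b') :
    Homotopy (homMap a b) (homMap a b') :=
  homotopyOfComponents
    -- The homotopy is `z ↦ a z k`, without sign: in `δ(z) k` and `δ(z k)` the terms `d z k` have
    -- opposite signs and cancel. The formula makes sense for all pairs of degrees and vanishes off
    -- degree `-1` because `k` does.
    (fun n _ => ⟨homOperator (fun T => ⟨T.p, T.p + n, rfl⟩) (fun T => a.f T.p)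
      (fun T => k.hom (T.p + n) T.q), isBddMap_homOperator _ _ _⟩)
    (fun n m h => Subtype.ext <| LinearMap.ext fun (z : Cochain M N n) => by
      refine Cochain.ext _ _ fun p q hpq => ?_
      change a.f p ≫ z.v p (p + n) rfl ≫ k.hom (p + n) q = 0
      rw [k.zero _ _ fun h' => h (by simp only [ComplexShape.up_Rel] at h'; omega)]
      simp)
    (fun n (z : Cochain M N n) => by
      refine Cochain.ext _ _ fun p q hpq => ?_
      change a.f p ≫ z.v p q hpq ≫ b.f q =
        a.f p ≫ (δ n (n + 1) z).v p (p + (n + 1)) rfl ≫ k.hom (p + (n + 1)) q +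
        (δ (n - 1) n (Cochain.mk fun p q _ =>
          a.f p ≫ z.v p (p + n) rfl ≫ k.hom (p + n) q : Cochain M' N' (n - 1))).v p q hpq +
        a.f p ≫ z.v p q hpq ≫ b'.f q
      subst hpq
      rw [δ_v n (n + 1) rfl z p (p + (n + 1)) rfl (p + n) (p + 1) (by omega) rfl,
        δ_v (n - 1) n (by omega) _ p (p + n) rfl (p + n - 1) (p + 1) rfl rfl,
        homotopy_comm_int k (q := p + n - 1) (r := p + (n + 1)) (by omega) (by omega),
        Cochain.mk_v, Cochain.mk_v, Int.negOnePow_succ]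
      -- The two sides differ only by the indices `p + 1 + n` and `p + (n + 1)`, which are equal but
      -- not definitionally so.
      have hz : z.v (p + 1) (p + 1 + n) rfl ≫ k.hom (p + 1 + n) (p + n) =
          z.v (p + 1) (p + (n + 1)) (by omega) ≫ k.hom (p + (n + 1)) (p + n) := by
        congr! 2 <;> omega
      rw [hz]
      simp
      abel)

/-- The map `homMap` is homotopy invariant in the first variable. -/
def homMapHomotopyLeft {a a' : M' ⟶ M} (k : Homotopy a a') (b : N ⟶ N') :
    Homotopy (homMap a b) (homMap a' b) :=
  homotopyOfComponents
    -- The sign `(-1)^n` is forced by the sign of `d z` in `δ(z)`. With it, the terms `k z d` cancel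
    -- and both `k d z` and `d k z` get the coefficient `+1`.
    (fun n _ => ⟨homOperator (fun T => ⟨T.q - n, T.q, sub_add_cancel _ _⟩)
      (fun T => n.negOnePow • k.hom T.p (T.q - n)) (fun T => b.f T.q), isBddMap_homOperator _ _ _⟩)
    (fun n m h => Subtype.ext <| LinearMap.ext fun (z : Cochain M N n) => by
      refine Cochain.ext _ _ fun p q hpq => ?_
      change (n.negOnePow • k.hom p (q - n)) ≫ z.v (q - n) q _ ≫ b.f q = 0
      rw [k.zero _ _ fun h' => h (by simp only [ComplexShape.up_Rel] at h'; omega)]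
      simp)
    (fun n (z : Cochain M N n) => by
      refine Cochain.ext _ _ fun p q hpq => ?_
      change a.f p ≫ z.v p q hpq ≫ b.f q =
        ((n + 1).negOnePow • k.hom p (q - (n + 1))) ≫
          (δ n (n + 1) z).v (q - (n + 1)) q (by omega) ≫ b.f q +
        (δ (n - 1) n (Cochain.mk fun p q _ => (n.negOnePow • k.hom p (q - n)) ≫
          z.v (q - n) q (by omega) ≫ b.f q : Cochain M' N' (n - 1))).v p q hpq +
        a'.f p ≫ z.v p q hpq ≫ b.f q
      obtain rfl : p = q - n := by omega
      rw [δ_v n (n + 1) rfl z (q - (n + 1)) q (by omega) (q - 1) (q - n) (by omega) (by omega),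
        δ_v (n - 1) n (by omega) _ (q - n) q (by omega) (q - 1) (q - n + 1) rfl rfl,
        homotopy_comm_int k (q := q - (n + 1)) (r := q - n + 1) (by omega) (by omega),
        Cochain.mk_v, Cochain.mk_v, Int.negOnePow_succ]
      have hz : k.hom (q - n) (q - 1 - n) ≫ z.v (q - 1 - n) (q - 1) (by omega) =
          k.hom (q - n) (q - (n + 1)) ≫ z.v (q - (n + 1)) (q - 1) (by omega) := by
        congr! 2 <;> omega
      simp only [Linear.units_smul_comp, Category.assoc, Preadditive.add_comp,
        Linear.comp_units_smul, smul_smul, Int.units_mul_self, one_smul, Preadditive.comp_add,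
        reassoc_of% hz]
      simp
      abel)

end Functoriality

/-! ### Homotopy invariance of the tensor product complex. -/

section TensorHomotopy

open CochainComplex.HomComplex

variable {𝕜 : Type} {B : Type u} [RCLike 𝕜] [Ring B] [Algebra 𝕜 B] [Bornology B] [BornAlg 𝕜 B]

section Objects

variable {P P' P'' N N' N'' : BMod 𝕜 B}

/-- The map `tmap`, for morphisms of the category of bornological modules. -/
noncomputable def objTmap (f : N ⟶ N') (g : P ⟶ P') :
    BTensor 𝕜 B N.carrier (Dual 𝕜 B P'.carrier) →ₗ[𝕜] BTensor 𝕜 B N'.carrier (Dual 𝕜 B P.carrier) :=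
  tmap f g

lemma objTmap_objTmap (f : N ⟶ N') (f' : N' ⟶ N'') (g : P ⟶ P') (g' : P' ⟶ P'')
    (z : BTensor 𝕜 B N.carrier (Dual 𝕜 B P''.carrier)) :
    objTmap f' g (objTmap f g' z) = objTmap (f ≫ f') (g ≫ g') z :=
  tmap_tmap _ _ _ _ _

lemma objTmap_add_left (f f' : N ⟶ N') (g : P ⟶ P')
    (z : BTensor 𝕜 B N.carrier (Dual 𝕜 B P'.carrier)) :
    objTmap (f + f') g z = objTmap f g z + objTmap f' g z :=
  tmap_add_left _ _ _ _

lemma objTmap_add_right (f : N ⟶ N') (g g' : P ⟶ P')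
    (z : BTensor 𝕜 B N.carrier (Dual 𝕜 B P'.carrier)) :
    objTmap f (g + g') z = objTmap f g z + objTmap f g' z :=
  tmap_add_right _ _ _ _

lemma objTmap_units_smul_right (f : N ⟶ N') (e : ℤˣ) (g : P ⟶ P')
    (z : BTensor 𝕜 B N.carrier (Dual 𝕜 B P'.carrier)) :
    objTmap f (e • g) z = e • objTmap f g z :=
  map_zsmul (AddMonoidHom.mk' (fun g : P ⟶ P' => objTmap f g z)
    fun g g' => objTmap_add_right f g g' z) (e : ℤ) g

lemma objTmap_zero_left (g : P ⟶ P') (z : BTensor 𝕜 B N.carrier (Dual 𝕜 B P'.carrier)) :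
    objTmap (0 : N ⟶ N') g z = 0 :=
  tmap_zero_left _ _

lemma objTmap_zero_right (f : N ⟶ N') (z : BTensor 𝕜 B N.carrier (Dual 𝕜 B P'.carrier)) :
    objTmap f (0 : P ⟶ P') z = 0 :=
  tmap_zero_right _ _

lemma objTmap_units_smul (f : N ⟶ N') (g : P ⟶ P') (e : ℤˣ)
    (z : BTensor 𝕜 B N.carrier (Dual 𝕜 B P'.carrier)) :
    objTmap f g (e • z) = e • objTmap f g z :=
  map_zsmul (objTmap f g) (e : ℤ) z

end Objects

variable {M M' N N' : CochainComplex (BMod 𝕜 B) ℤ}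

lemma tensorδ_eq {n m : ℤ} (h : n + 1 = m) (u : TensorDual M N n) (p q : ℤ) (hpq : p + m = q)
    (p' q' : ℤ) (hp' : p' = p + 1) (hq' : q' = q - 1) :
    tensorδ n m u ⟨p, q, hpq⟩ =
      objTmap (N.d q' q) (𝟙 (M.X p)) (u ⟨p, q', by omega⟩) +
        m.negOnePow • objTmap (𝟙 (N.X q)) (M.d p p') (u ⟨p', q, by omega⟩) :=
  tensorδ_apply n m h u p q hpq p' q' hp' hq'

/-- The map `tensorMap` is homotopy invariant in the second variable. -/
noncomputable def tensorMapHomotopyRight (a : M' ⟶ M) {b b' : N ⟶ N'} (k : Homotopy b b') :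
    Homotopy (tensorMap a b) (tensorMap a b') :=
  homotopyOfComponents
    (fun n _ => ⟨tensorOperator (fun T => ⟨T.p, T.p + n, rfl⟩) (fun T => a.f T.p)
      (fun T => k.hom (T.p + n) T.q), isBddMap_tensorOperator _ _ _⟩)
    (fun n m h => Subtype.ext <| LinearMap.ext fun (u : TensorDual M N n) => by
      funext ⟨p, q, hpq⟩
      change objTmap (k.hom (p + n) q) (a.f p) (u ⟨p, p + n, rfl⟩) = 0
      rw [k.zero _ _ fun h' => h (by simp only [ComplexShape.up_Rel] at h'; omega)]
      exact objTmap_zero_left _ _)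
    (fun n (u : TensorDual M N n) => by
      funext ⟨p, q, hpq⟩
      -- A free index `r` with a proof of `T.p + m = r` takes the place of `T.p + m`, so that terms
      -- whose indices are only propositionally equal can be compared without transport. The
      -- computation is then the one for graded maps.
      have key : ∀ (m l : ℤ) (v : TensorDual M N m) (T : Triplet l) (r : ℤ) (hr : T.p + m = r),
          tensorOperator (m := l) (fun T => ⟨T.p, T.p + m, rfl⟩) (fun T => a.f T.p)
            (fun T => k.hom (T.p + m) T.q) v T =
          objTmap (k.hom r T.q) (a.f T.p) (v ⟨T.p, r, hr⟩) := by
        rintro m l v T _ rfl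
        rfl
      change objTmap (b.f q) (a.f p) (u ⟨p, q, hpq⟩) =
        tensorOperator _ _ _ (tensorδ n (n + 1) u) ⟨p, q, hpq⟩ +
        tensorδ (n - 1) n (tensorOperator _ _ _ u) ⟨p, q, hpq⟩ +
        objTmap (b'.f q) (a.f p) (u ⟨p, q, hpq⟩)
      rw [key _ _ _ _ (q + 1) (by dsimp only; omega),
        tensorδ_eq (by omega) _ p q hpq (p + 1) (q - 1) rfl rfl,
        tensorδ_eq rfl _ p (q + 1) (by omega) (p + 1) q rfl (by omega),
        key _ _ _ _ q (by dsimp only; omega), key _ _ _ _ (q + 1) (by dsimp only; omega),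
        homotopy_comm_int k (q := q - 1) (r := q + 1) (by omega) rfl]
      simp only [objTmap_add_left, map_add, objTmap_units_smul, objTmap_objTmap,
        Category.comp_id, Category.id_comp, a.comm, Int.negOnePow_succ, Units.neg_smul, map_neg]
      abel)

/-- The map `tensorMap` is homotopy invariant in the first variable. -/
noncomputable def tensorMapHomotopyLeft {a a' : M' ⟶ M} (k : Homotopy a a') (b : N ⟶ N') :
    Homotopy (tensorMap a b) (tensorMap a' b) :=
  homotopyOfComponents
    (fun n _ => ⟨tensorOperator (fun T => ⟨T.q - n, T.q, sub_add_cancel _ _⟩)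
      (fun T => n.negOnePow • k.hom T.p (T.q - n)) (fun T => b.f T.q),
      isBddMap_tensorOperator _ _ _⟩)
    (fun n m h => Subtype.ext <| LinearMap.ext fun (u : TensorDual M N n) => by
      funext ⟨p, q, hpq⟩
      change objTmap (b.f q) (n.negOnePow • k.hom p (q - n)) (u ⟨q - n, q, _⟩) = 0
      rw [k.zero _ _ fun h' => h (by simp only [ComplexShape.up_Rel] at h'; omega), smul_zero]
      exact objTmap_zero_right _ _)
    (fun n (u : TensorDual M N n) => by
      funext ⟨p, q, hpq⟩
      -- Besides freeing the index `r`, this moves the sign `(-1)^m` out of the tensor.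
      have key : ∀ (m l : ℤ) (v : TensorDual M N m) (T : Triplet l) (r : ℤ) (hr : r + m = T.q),
          tensorOperator (m := l) (fun T => ⟨T.q - m, T.q, sub_add_cancel _ _⟩)
            (fun T => m.negOnePow • k.hom T.p (T.q - m)) (fun T => b.f T.q) v T =
          m.negOnePow • objTmap (b.f T.q) (k.hom T.p r) (v ⟨r, T.q, hr⟩) := by
        rintro m l v T r hr
        obtain rfl : r = T.q - m := by omega
        exact objTmap_units_smul_right _ _ _ _
      change objTmap (b.f q) (a.f p) (u ⟨p, q, hpq⟩) =
        tensorOperator _ _ _ (tensorδ n (n + 1) u) ⟨p, q, hpq⟩ +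
        tensorδ (n - 1) n (tensorOperator _ _ _ u) ⟨p, q, hpq⟩ +
        objTmap (b.f q) (a'.f p) (u ⟨p, q, hpq⟩)
      rw [key _ _ _ _ (p - 1) (by dsimp only; omega),
        tensorδ_eq (by omega) _ p q hpq (p + 1) (q - 1) rfl rfl,
        tensorδ_eq rfl _ (p - 1) q (by omega) p (q - 1) (by omega) rfl,
        key _ _ _ _ (p - 1) (by dsimp only; omega), key _ _ _ _ p (by dsimp only; omega),
        homotopy_comm_int k (q := p - 1) (r := p + 1) (by omega) rfl]
      simp only [objTmap_add_right, map_add, objTmap_units_smul, objTmap_objTmap, smul_add,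
        Category.comp_id, Category.id_comp, b.comm, Int.negOnePow_succ, Units.neg_smul,
        smul_neg, map_neg]
      simp only [smul_smul, Int.units_mul_self, one_smul]
      abel)

end TensorHomotopy

/-! ### The nuclear map and complexes of finitely generated projective modules. -/

section Projective

open CochainComplex.HomComplex

variable {𝕜 : Type} {B : Type u} [RCLike 𝕜] [Ring B] [Algebra 𝕜 B] [Bornology B] [BornAlg 𝕜 B]

/-- A direct summand of `B^n` has a finite dual basis: the images under `r` of the standard basis
vectors, and the coordinates of `i`. -/
lemma IsFGProjective.exists_nuc_inverse {P : BMod 𝕜 B} (hP : IsFGProjective P) (N : BMod 𝕜 B) :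
    ∃ σ : BHom 𝕜 B P.carrier N.carrier →ₗ[𝕜] BTensor 𝕜 B N.carrier (Dual 𝕜 B P.carrier),
      IsBddMap σ ∧ (∀ z, σ (nuc P.carrier N.carrier z) = z) ∧
        ∀ f, nuc P.carrier N.carrier (σ f) = f := by
  obtain ⟨n, i, r, hi, hr, hri⟩ := hP
  refine Born.exists_nuc_inverse (ι := Fin n) (fun j => r (Pi.single j 1))
    (fun j => (⟨(LinearMap.proj j : (Fin n → B) →ₗ[Bᵐᵒᵖ] B) ∘ₗ i, (isBddMap_eval j).comp hi⟩ :
      BHom 𝕜 B P.carrier B))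
    fun x => ?_
  conv_rhs => rw [← LinearMap.id_apply (R := Bᵐᵒᵖ) x, ← hri, LinearMap.comp_apply]
  rw [← Finset.univ_sum_single (i x), map_sum]
  refine Finset.sum_congr rfl fun j _ => ?_
  rw [← map_smul, ← Pi.single_smul]
  congr 2
  exact one_mul _

variable (M N : CochainComplex (BMod 𝕜 B) ℤ)

/-- In each degree the map is a product of maps `nuc`, so the bounded inverses of the factors give a
bounded inverse of the product. A chain map that is invertible in each degree is an isomorphism of
complexes. -/
lemma isIso_nuclearMap (hM : ∀ i, IsFGProjective (M.X i)) : IsIso (nuclearMap M N) := by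
  have (n : ℤ) : IsIso ((nuclearMap M N).f n) := by
    choose σ hσ h₁ h₂ using fun T : Triplet n => (hM T.p).exists_nuc_inverse (N.X T.q)
    let τ : Cochain M N n →ₗ[𝕜] TensorDual M N n :=
      { toFun := fun z T => σ T (z T)
        map_add' := fun z z' => funext fun T => map_add (σ T) (z T) (z' T)
        map_smul' := fun c z => funext fun T => map_smul (σ T) c (z T) }
    have hτ : IsBddMap τ := isBddMap_pi fun T =>
      (hσ T).comp (isBddMap_eval (Y := fun T : Triplet n => M.X T.p ⟶ N.X T.q) T)
    let τ' : (homComplex M N).X n ⟶ (tensorComplex M N).X n := ⟨τ, hτ⟩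
    exact ⟨τ', Subtype.ext <| LinearMap.ext fun u => funext fun T => h₁ T (u T),
      Subtype.ext <| LinearMap.ext fun z => funext fun T => h₂ T (z T)⟩
  exact HomologicalComplex.Hom.isIso_of_components _

variable {M N} {T : CochainComplex (BMod 𝕜 B) ℤ}

/-- If the identity of `M` factors up to homotopy through a complex of finitely generated
projective modules, then `nuclearMap M M` is a homotopy equivalence. -/
lemma exists_homotopyEquiv_nuclearMap (hT : ∀ i, IsFGProjective (T.X i)) (f : M ⟶ T) (g : T ⟶ M)
    (k : Homotopy (f ≫ g) (𝟙 M)) :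
    ∃ e : HomotopyEquiv (tensorComplex M M) (homComplex M M), e.hom = nuclearMap M M := by
  have := isIso_nuclearMap T T hT
  -- The candidate for the inverse goes from graded maps of `M` to graded maps of `T`, then through
  -- the inverse of `ν` for `T`, then back to `M`. By naturality of `ν`, either composite with `ν`
  -- is the map induced by `f ≫ g` in both variables, which is homotopic to the identity.
  have h₁ : nuclearMap M M ≫ homMap g f ≫ inv (nuclearMap T T) ≫ tensorMap f g =
      tensorMap (f ≫ g) (f ≫ g) := by
    rw [← reassoc_of% tensorMap_nuclearMap g f, IsIso.hom_inv_id_assoc, tensorMap_comp]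
  have h₂ : (homMap g f ≫ inv (nuclearMap T T) ≫ tensorMap f g) ≫ nuclearMap M M =
      homMap (f ≫ g) (f ≫ g) := by
    rw [Category.assoc, Category.assoc, tensorMap_nuclearMap, IsIso.inv_hom_id_assoc, homMap_comp]
  exact ⟨{ hom := nuclearMap M M
           inv := homMap g f ≫ inv (nuclearMap T T) ≫ tensorMap f g
           homotopyHomInvId := (Homotopy.ofEq h₁).trans <|
             (tensorMapHomotopyLeft k (f ≫ g)).trans <|
             (tensorMapHomotopyRight (𝟙 M) k).trans (Homotopy.ofEq tensorMap_id)
           homotopyInvHomId := (Homotopy.ofEq h₂).trans <|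
             (homMapHomotopyLeft k (f ≫ g)).trans <|
             (homMapHomotopyRight (𝟙 M) k).trans (Homotopy.ofEq homMap_id) }, rfl⟩

end Projective

end Born

/-! ### The equivalence of the five conditions. -/

theorem propositionP {𝕜 : Type} [RCLike 𝕜] {B : Type u} [Ring B] [Algebra 𝕜 B] [Bornology B]
    [Born.BornAlg 𝕜 B] (hB : Born.MulConvex 𝕜 B)
    (M : CochainComplex (Born.BMod 𝕜 B) ℤ) (hM : Born.IsBoundedComplex M) :
    List.TFAE [
      ∃ T : CochainComplex (Born.BMod 𝕜 B) ℤ, Born.IsBoundedComplex T ∧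
        (∀ i, Born.IsFGProjective (T.X i)) ∧ Nonempty (HomotopyEquiv M T),
      ∃ e : HomotopyEquiv (Born.tensorComplex M M) (Born.homComplex M M),
        e.hom = Born.nuclearMap M M,
      ∃ g : CochainComplex.HomComplex.Cochain M M 0, Born.IsNuclear g ∧
        Born.IsHomotopic (CochainComplex.HomComplex.Cochain.ofHom (𝟙 M)) g,
      ∃ g : CochainComplex.HomComplex.Cochain M M 0, Born.IsAlgNuclear g ∧
        Born.IsHomotopic (CochainComplex.HomComplex.Cochain.ofHom (𝟙 M)) g,
      ∃ T : CochainComplex (Born.BMod 𝕜 B) ℤ, Born.IsBoundedComplex T ∧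
        (∀ i, Born.IsFGProjective (T.X i)) ∧
        ∃ (f : M ⟶ T) (g : T ⟶ M), Nonempty (Homotopy (f ≫ g) (𝟙 M))] := by
  tfae_have 1 → 5 := fun ⟨T, hT, hP, ⟨e⟩⟩ => ⟨T, hT, hP, e.hom, e.inv, ⟨e.homotopyHomInvId⟩⟩
  tfae_have 5 → 2 := fun ⟨_, _, hP, f, g, ⟨k⟩⟩ => Born.exists_homotopyEquiv_nuclearMap hP f g k
  tfae_have 2 → 3 := fun ⟨e, he⟩ => Born.isNuclear_of_homotopyEquiv e he
  tfae_have 3 → 4 := Born.isAlgNuclear_of_isNuclear hB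
  tfae_have 4 → 1 := Born.exists_homotopyEquiv_of_isAlgNuclear hM
  tfae_finish
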